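/- Setting. Let $d\ge 0$, $D=d+1$, $L>0$, and let $\Lambda=(\mathbb R/L\mathbb Z)^{d}$ be the $d$-dimensional torus of side length $L$ (a single point of mass one if $d=0$); write $x=(x_1,x^\perp)\in\mathbb R\times\Lambda$, with $x_1,\dots,x_D$ the coordinates. Let $\beta>1$, and let $J\colon\mathbb R^D\to[0,\infty)$ be a smooth, spherically symmetric probability density with compact support. For functions $v$ on $\mathbb R\times\Lambda$ let $(J\star v)(x)=\int_{\mathbb R^D}J(z)\,v(x-z)\,dz$, and let $\overline J(x_1)=\int_{\mathbb R^{d}}J(x_1,y)\,dy$. Let $$f(m)=-\tfrac12m^2+\tfrac1\beta\Big[\tfrac{1+m}2\ln\tfrac{1+m}2+\tfrac{1-m}2\ln\tfrac{1-m}2\Big],\qquad m\in[-1,1],$$ let $m_\beta>0$ be its positive minimizer on $[-1,1]$, and set $$\mathcal F_1(m)=\int_{\mathbb R}[f(m(x))-f(m_\beta)]\,dx+\tfrac14\int_{\mathbb R}\int_{\mathbb R}\overline J(x-y)[m(x)-m(y)]^2\,dx\,dy .$$ Let $\overline m_0$ be the front, i.e. the (continuous representative of the) minimizer of $\mathcal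 F_1$ among measurable $m\colon\mathbb R\to[-1,1]$ with $\operatorname{sgn}(x)m(x)\ge0$ for all $x$ and such that $\lim_{x\to\pm\infty}\operatorname{sgn}(x)m(x)$ exist and are positive. For $a\in\mathbb R$ put $\overline m(x)=\overline m_a(x_1)=\overline m_0(x_1-a)$. Let $\sigma(m)=\beta(1-m^2)$, $$\mathcal Bv=\frac{v}{\beta(1-\overline m^2)}-J\star v,$$ $$U(v)=\frac1\beta\,\frac{2\overline m}{(1-\overline m^2)^2}\,v\,v_{x_1}+\frac1\beta\,\frac{1+3\overline m^2+2\overline m v}{(1-\overline m^2)^2\,(1-(\overline m+v)^2)}\,v^2\,(v_{x_1}+\overline m'),$$ and, for $\epsilon>0$, $$G_\epsilon(v)=\epsilon\sum_{i=1}^{D}\int_{\mathbb R\times\Lambda}\sigma(\overline m)\,[(\mathcal Bv)_{x_i}]^2\,dx-\frac1\epsilon\int_{\mathbb R\times\Lambda}\sigma(\overline m)\,[U(v)]^2\,dx .$$ For $k\in\mathbb N$, $W^{k,2}(\mathbb R\times\Lambda)$ is the space of functions in $L^2$ whose distributional derivatives of order $\le k$ are in $L^2$, with norm $\|u\|_{W^{k,2}}=\sum_{|\alpha|\le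 k}\|D^\alpha u\|_{2}$. Proposition. There is a function $L\mapsto r(L)>0$ with the following property. For all $d,L,\beta,J$ as above, every $s\in\mathbb N$ with $s>D/2$ and the front $\overline m_0$, there is $\epsilon_1>0$ such that for every $0<\epsilon\le\epsilon_1$, every $a\in\mathbb R$ and every $v\in W^{s+1,2}(\mathbb R\times\Lambda)$ with $$\int_{\mathbb R\times\Lambda}v(x)\,\overline m'(x_1)\,dx=0\qquad\text{and}\qquad\|v\|_{W^{s+1,2}}^2\le\epsilon^{2+r(L)},$$ the quantity $G_\epsilon(v)$ is well defined (that is, $\mathcal Bv\in W^{1,2}(\mathbb R\times\Lambda)$ and $\sigma(\overline m)U(v)^2$ is integrable) and $$G_\epsilon(v)\ge0 .$$ -/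

import Mathlib

open Set Filter Topology MeasureTheory
open scoped ENNReal ContDiff

namespace PlanarFront

noncomputable section

/-- The cylinder `ℝ × Λ`, where `Λ` is the `d`-dimensional torus of side length `L`; its dimension
is `D = d + 1`.  It carries the product of Lebesgue measures, so that `Λ` has measure `L ^ d`. -/
abbrev Cylinder (d : ℕ) (L : ℝ) : Type := ℝ × (Fin d → AddCircle L)

/-- The space `ℝ^D`, `D = d + 1`; the coordinate `0` is the longitudinal one. -/
abbrev Space (d : ℕ) : Type := EuclideanSpace ℝ (Fin (d + 1))

/-- The covering homomorphism `ℝ^D → ℝ × Λ`. -/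
def toCylinder (d : ℕ) (L : ℝ) (z : Space d) : Cylinder d L :=
  (z 0, fun j => ((z j.succ : ℝ) : AddCircle L))

/-! ### Sobolev spaces on the cylinder -/

/-- The classical partial derivative in the `i`-th coordinate direction of the cylinder. -/
def partialDeriv {d : ℕ} {L : ℝ} (i : Fin (d + 1)) (φ : Cylinder d L → ℝ) : Cylinder d L → ℝ :=
  fun p => deriv (fun t : ℝ => φ (p + toCylinder d L (EuclideanSpace.single i t))) 0

/-- The classical derivative `D^α` for a multi-index `α`. -/
def multiDeriv {d : ℕ} {L : ℝ} (α : Fin (d + 1) → ℕ) (φ : Cylinder d L → ℝ) : Cylinder d L → ℝ :=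
  (List.finRange (d + 1)).foldr (fun i ψ => (partialDeriv i)^[α i] ψ) φ

/-- Test functions: smooth functions with compact support on the cylinder. -/
def IsTestFunction {d : ℕ} {L : ℝ} (φ : Cylinder d L → ℝ) : Prop :=
  ContDiff ℝ ∞ (fun z : Space d => φ (toCylinder d L z)) ∧ HasCompactSupport φ

/-- `g` is the distributional derivative `D^α v`. -/
def HasWeakDeriv {d : ℕ} {L : ℝ} [Fact (0 < L)] (α : Fin (d + 1) → ℕ)
    (v g : Cylinder d L → ℝ) : Prop :=
  ∀ φ : Cylinder d L → ℝ, IsTestFunction φ →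
    ∫ p, v p * multiDeriv α φ p = (-1) ^ (∑ i, α i) * ∫ p, g p * φ p

/-- `v ∈ W^{k,2}(ℝ × Λ)`: `v` and all its distributional derivatives of order at most `k` are
in `L²`. -/
def MemSobolev {d : ℕ} {L : ℝ} [Fact (0 < L)] (k : ℕ) (v : Cylinder d L → ℝ) : Prop :=
  MemLp v 2 volume ∧
    ∀ α : Fin (d + 1) → ℕ, ∑ i, α i ≤ k → ∃ g, MemLp g 2 volume ∧ HasWeakDeriv α v g

open Classical in
/-- The distributional derivative `D^α v` as an `L²` function (unique up to a null set when it
exists; `0` when it does not exist). -/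
def weakDeriv {d : ℕ} {L : ℝ} [Fact (0 < L)] (α : Fin (d + 1) → ℕ)
    (v : Cylinder d L → ℝ) : Cylinder d L → ℝ :=
  if h : ∃ g, MemLp g 2 volume ∧ HasWeakDeriv α v g then h.choose else 0

/-- The first-order distributional derivative `v_{x_i}`. -/
def weakPartial {d : ℕ} {L : ℝ} [Fact (0 < L)] (i : Fin (d + 1))
    (v : Cylinder d L → ℝ) : Cylinder d L → ℝ :=
  weakDeriv (Pi.single i 1) v

/-- The norm `‖v‖_{W^{k,2}} = ∑_{|α| ≤ k} ‖D^α v‖_{L²}`. -/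
def sobolevNorm {d : ℕ} {L : ℝ} [Fact (0 < L)] (k : ℕ) (v : Cylinder d L → ℝ) : ℝ :=
  ∑ n ∈ Finset.range (k + 1), ∑ α ∈ Finset.piAntidiag (Finset.univ : Finset (Fin (d + 1))) n,
    (eLpNorm (weakDeriv α v) 2 volume).toReal

/-! ### The interaction kernel, the free energy and the front -/

/-- `J` is a smooth, spherically symmetric probability density on `ℝ^D` with compact support. -/
structure IsKernel {d : ℕ} (J : Space d → ℝ) : Prop where
  smooth : ContDiff ℝ ∞ J
  compactSupport : HasCompactSupport J
  nonneg : ∀ z, 0 ≤ J z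
  integral_eq_one : ∫ z, J z = 1
  radial : ∀ z z', ‖z‖ = ‖z'‖ → J z = J z'

/-- The one-dimensional projection `J̄` of the kernel: `J` integrated over the transverse
directions. -/
def projKernel {d : ℕ} (J : Space d → ℝ) (x : ℝ) : ℝ :=
  ∫ y : Fin d → ℝ, J (WithLp.toLp 2 (Fin.cons x y))

/-- The double-well potential `f`. -/
def potential (β m : ℝ) : ℝ :=
  -(1 / 2) * m ^ 2 + (1 / β) *
    ((1 + m) / 2 * Real.log ((1 + m) / 2) + (1 - m) / 2 * Real.log ((1 - m) / 2))

/-- `mβ` is the positive minimizer of `f` on `[-1, 1]`. -/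
def IsPosMinimizer (β mβ : ℝ) : Prop :=
  0 < mβ ∧ mβ ∈ Icc (-1 : ℝ) 1 ∧ IsMinOn (potential β) (Icc (-1 : ℝ) 1) mβ

/-- The one-dimensional free energy functional
`∫ [f(m) - f(mβ)] dx + 1/4 ∬ J̄(x-y) [m(x) - m(y)]² dx dy`, with values in `[0, ∞]`. -/
def freeEnergy {d : ℕ} (β mβ : ℝ) (J : Space d → ℝ) (m : ℝ → ℝ) : ℝ≥0∞ :=
  (∫⁻ x, ENNReal.ofReal (potential β (m x) - potential β mβ)) +
    ENNReal.ofReal (1 / 4) *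
      ∫⁻ x, ∫⁻ y, ENNReal.ofReal (projKernel J (x - y) * (m x - m y) ^ 2)

/-- The profiles among which the front minimizes the free energy: measurable `m : ℝ → [-1, 1]`
with `sgn(x) m(x) ≥ 0` and `lim_{x → ±∞} sgn(x) m(x) > 0`. -/
structure IsAdmissible (m : ℝ → ℝ) : Prop where
  measurable : Measurable m
  mem_Icc : ∀ x, m x ∈ Icc (-1 : ℝ) 1
  sign_mul_nonneg : ∀ x, 0 ≤ Real.sign x * m x
  lim_atTop : ∃ l, 0 < l ∧ Tendsto (fun x => Real.sign x * m x) atTop (𝓝 l)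
  lim_atBot : ∃ l, 0 < l ∧ Tendsto (fun x => Real.sign x * m x) atBot (𝓝 l)

/-- `m₀` is the front: the minimizer of the one-dimensional free energy among all admissible
profiles.  Since a minimizer is determined only up to a null set, continuity is required in
order to select its regular representative. -/
structure IsFront {d : ℕ} (β mβ : ℝ) (J : Space d → ℝ) (m₀ : ℝ → ℝ) : Prop where
  admissible : IsAdmissible m₀
  continuous : Continuous m₀
  minimizes : ∀ m, IsAdmissible m → freeEnergy β mβ J m₀ ≤ freeEnergy β mβ J m

/-- The translate `m̄_a(x₁) = m̄_0(x₁ - a)`. -/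
def shiftFront (m₀ : ℝ → ℝ) (a : ℝ) : ℝ → ℝ := fun x => m₀ (x - a)

/-! ### The operator `B`, the nonlinearity `U` and the functional `G_ε` -/

/-- The mobility `σ(m) = β (1 - m²)`. -/
def mobility (β m : ℝ) : ℝ := β * (1 - m ^ 2)

/-- The convolution `J ⋆ v` on the cylinder. -/
def cylConv {d : ℕ} {L : ℝ} (J : Space d → ℝ) (v : Cylinder d L → ℝ) : Cylinder d L → ℝ :=
  fun p => ∫ z : Space d, J z * v (p - toCylinder d L z)

/-- The operator `B v = v / (β (1 - m̄²)) - J ⋆ v`, for a profile `m̄` depending only on the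
longitudinal coordinate. -/
def opB {d : ℕ} {L : ℝ} (β : ℝ) (J : Space d → ℝ) (mbar : ℝ → ℝ) (v : Cylinder d L → ℝ) :
    Cylinder d L → ℝ :=
  fun p => v p / (β * (1 - mbar p.1 ^ 2)) - cylConv J v p

/-- The nonlinear term `U(v)`, where `m = m̄ + v`. -/
def opU {d : ℕ} {L : ℝ} [Fact (0 < L)] (β : ℝ) (mbar : ℝ → ℝ) (v : Cylinder d L → ℝ) :
    Cylinder d L → ℝ :=
  fun p =>
    (1 / β) * (2 * mbar p.1 / (1 - mbar p.1 ^ 2) ^ 2) * v p * weakPartial 0 v p +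
    (1 / β) * ((1 + 3 * mbar p.1 ^ 2 + 2 * mbar p.1 * v p) /
      ((1 - mbar p.1 ^ 2) ^ 2 * (1 - (mbar p.1 + v p) ^ 2))) * v p ^ 2 *
        (weakPartial 0 v p + deriv mbar p.1)

/-- `G_ε(v) = ε ∑_i ∫ σ(m̄) [(B v)_{x_i}]² dx - (1/ε) ∫ σ(m̄) [U(v)]² dx`. -/
def functionalG {d : ℕ} {L : ℝ} [Fact (0 < L)] (β : ℝ) (J : Space d → ℝ) (mbar : ℝ → ℝ)
    (ε : ℝ) (v : Cylinder d L → ℝ) : ℝ :=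
  ε * (∑ i : Fin (d + 1),
      ∫ p : Cylinder d L, mobility β (mbar p.1) * weakPartial i (opB β J mbar v) p ^ 2) -
    (1 / ε) * ∫ p : Cylinder d L, mobility β (mbar p.1) * opU β mbar v p ^ 2

end

end PlanarFront

open PlanarFront

set_option linter.unusedSectionVars false

namespace PlanarFront

noncomputable section

/-! ### The covering map -/

section Covering

variable {d : ℕ} {L : ℝ}

@[simp] theorem toCylinder_add (z w : Space d) :
    toCylinder d L (z + w) = toCylinder d L z + toCylinder d L w := by
  ext <;> simp [toCylinder]

@[simp] theorem toCylinder_zero : toCylinder d L 0 = 0 := by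
  ext <;> simp [toCylinder]

@[simp] theorem toCylinder_neg (z : Space d) : toCylinder d L (-z) = -toCylinder d L z := by
  ext <;> simp [toCylinder]

@[simp] theorem toCylinder_sub (z w : Space d) :
    toCylinder d L (z - w) = toCylinder d L z - toCylinder d L w := by
  ext <;> simp [toCylinder]

@[simp] theorem toCylinder_fst (z : Space d) : (toCylinder d L z).1 = z 0 := rfl

theorem continuous_toCylinder : Continuous (toCylinder d L) := by
  unfold toCylinder
  refine Continuous.prodMk (by fun_prop) (continuous_pi fun j => ?_)
  exact (AddCircle.continuous_mk' L).comp (by fun_prop)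

theorem toCylinder_surjective : Function.Surjective (toCylinder d L) := by
  intro p
  have h : ∀ j, ∃ t : ℝ, (t : AddCircle L) = p.2 j := fun j => QuotientAddGroup.mk_surjective _
  choose t ht using h
  refine ⟨WithLp.toLp 2 (Fin.cons p.1 t), ?_⟩
  ext
  · simp [toCylinder]
  · simp [toCylinder, ht]

/-- Euclidean space as the product of the longitudinal and the transverse coordinates. -/
def splitEquiv (d : ℕ) : Space d ≃ᵐ ℝ × (Fin d → ℝ) :=
  (MeasurableEquiv.toLp 2 (Fin (d + 1) → ℝ)).symm.trans
    (MeasurableEquiv.piFinSuccAbove (fun _ => ℝ) 0)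

theorem splitEquiv_apply (z : Space d) : splitEquiv d z = (z 0, fun j => z j.succ) := rfl

theorem splitEquiv_symm_apply (x : ℝ) (y : Fin d → ℝ) :
    (splitEquiv d).symm (x, y) = WithLp.toLp 2 (Fin.cons x y) := by
  rw [MeasurableEquiv.symm_apply_eq, splitEquiv_apply]
  simp

theorem measurePreserving_splitEquiv : MeasurePreserving (splitEquiv d) volume volume :=
  (volume_preserving_piFinSuccAbove (fun _ : Fin (d + 1) => ℝ) 0).comp
    (PiLp.volume_preserving_ofLp (Fin (d + 1)))

/-- The strip of points whose transverse coordinates lie in a given period cell. -/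
def strip (d : ℕ) (L : ℝ) (a : Fin d → ℝ) : Set (Space d) :=
  {z | ∀ j : Fin d, z j.succ ∈ Ioc (a j) (a j + L)}

theorem strip_eq_preimage (a : Fin d → ℝ) :
    strip d L a = splitEquiv d ⁻¹' (univ ×ˢ (univ.pi fun j => Ioc (a j) (a j + L))) := by
  ext z; simp [strip, splitEquiv_apply]

theorem measurableSet_strip (a : Fin d → ℝ) : MeasurableSet (strip d L a) := by
  rw [strip_eq_preimage]
  exact (splitEquiv d).measurable
    (MeasurableSet.univ.prod (MeasurableSet.univ_pi fun _ => measurableSet_Ioc))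

variable [Fact (0 < L)]

instance : (volume : Measure (Fin d → AddCircle L)).IsAddHaarMeasure := by
  rw [volume_pi]; infer_instance

instance : (volume : Measure (Cylinder d L)).IsAddHaarMeasure := by
  rw [Measure.volume_eq_prod]; infer_instance

instance : (volume : Measure (Cylinder d L)).Regular :=
  Measure.Regular.of_sigmaCompactSpace_of_isLocallyFiniteMeasure _

theorem measurePreserving_toCylinder_strip (a : Fin d → ℝ) :
    MeasurePreserving (toCylinder d L) (volume.restrict (strip d L a)) volume := by
  have h1 : MeasurePreserving (splitEquiv d) (volume.restrict (strip d L a))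
      ((volume : Measure ℝ).prod
        (Measure.pi fun j => (volume : Measure ℝ).restrict (Ioc (a j) (a j + L)))) := by
    have := (measurePreserving_splitEquiv (d := d)).restrict_preimage_emb
      (splitEquiv d).measurableEmbedding (univ ×ˢ (univ.pi fun j => Ioc (a j) (a j + L)))
    rw [strip_eq_preimage]
    rw [Measure.volume_eq_prod, ← Measure.prod_restrict, Measure.restrict_univ, volume_pi,
      Measure.restrict_pi_pi] at this
    exact this
  have h2 : MeasurePreserving (fun y : Fin d → ℝ => fun j => (y j : AddCircle L))
      (Measure.pi fun j => (volume : Measure ℝ).restrict (Ioc (a j) (a j + L))) volume :=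
    measurePreserving_pi _ _ fun j => AddCircle.measurePreserving_mk L (a j)
  exact ((MeasurePreserving.id (volume : Measure ℝ)).prod h2).comp h1

theorem iUnion_strip : ⋃ k : Fin d → ℤ, strip d L (fun j => k j • L) = univ := by
  have hL : 0 < L := Fact.out
  refine eq_univ_of_forall fun z => mem_iUnion.2 ?_
  have h : ∀ j : Fin d, ∃ k : ℤ, z j.succ ∈ Ioc (k • L) (k • L + L) := fun j => by
    obtain ⟨k, hk, -⟩ := existsUnique_sub_zsmul_mem_Ioc hL (z j.succ) 0
    refine ⟨k, ?_⟩
    simp only [zero_add, mem_Ioc] at hk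
    constructor <;> linarith [hk.1, hk.2]
  choose k hk using h
  exact ⟨k, hk⟩

theorem quasiMeasurePreserving_toCylinder :
    Measure.QuasiMeasurePreserving (toCylinder d L) volume volume := by
  refine ⟨continuous_toCylinder.measurable, Measure.AbsolutelyContinuous.mk fun s hs h0 => ?_⟩
  rw [Measure.map_apply continuous_toCylinder.measurable hs,
    ← inter_univ (toCylinder d L ⁻¹' s), ← iUnion_strip (d := d) (L := L), inter_iUnion]
  refine measure_iUnion_null fun k => ?_
  have := (measurePreserving_toCylinder_strip (d := d) (L := L) (fun j => k j • L)).measure_preimage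
    hs.nullMeasurableSet
  rw [Measure.restrict_apply (continuous_toCylinder.measurable hs)] at this
  rw [this, h0]

theorem measurePreserving_sub_toCylinder (w : Cylinder d L) :
    MeasurePreserving (fun p : Cylinder d L => p - w) volume volume :=
  measurePreserving_sub_right volume w

theorem measurePreserving_add_toCylinder (w : Cylinder d L) :
    MeasurePreserving (fun p : Cylinder d L => p + w) volume volume :=
  measurePreserving_add_right volume w

theorem quasiMeasurePreserving_sub_toCylinder (p : Cylinder d L) :
    Measure.QuasiMeasurePreserving (fun z : Space d => p - toCylinder d L z) volume volume :=
  (Measure.measurePreserving_sub_left volume p).quasiMeasurePreserving.comp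
    quasiMeasurePreserving_toCylinder

theorem quasiMeasurePreserving_prod_sub :
    Measure.QuasiMeasurePreserving
      (fun q : Cylinder d L × Space d => q.1 - toCylinder d L q.2) (volume.prod volume) volume := by
  have hm : Measurable fun q : Cylinder d L × Space d => q.1 - toCylinder d L q.2 :=
    (continuous_fst.sub (continuous_toCylinder.comp continuous_snd)).measurable
  refine ⟨hm, Measure.AbsolutelyContinuous.mk fun s hs h0 => ?_⟩
  rw [Measure.map_apply hm hs, Measure.measure_prod_null (hm hs)]
  refine Eventually.of_forall fun p => ?_
  exact (quasiMeasurePreserving_sub_toCylinder p).preimage_null h0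

/-- A strip seen from a point of the cylinder carries the measure of the cylinder. -/
theorem lintegral_strip_sub (a : Fin d → ℝ) (p : Cylinder d L) {g : Cylinder d L → ℝ≥0∞}
    (hg : AEMeasurable g volume) :
    ∫⁻ z in strip d L a, g (p - toCylinder d L z) = ∫⁻ q, g q := by
  have h1 := (Measure.measurePreserving_sub_left (volume : Measure (Cylinder d L)) p).comp
    (measurePreserving_toCylinder_strip (d := d) (L := L) a)
  rw [← h1.map_eq, lintegral_map' (by rwa [h1.map_eq]) h1.measurable.aemeasurable]
  rfl

theorem lintegral_strip_add (a : Fin d → ℝ) (p : Cylinder d L) {g : Cylinder d L → ℝ≥0∞}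
    (hg : AEMeasurable g volume) :
    ∫⁻ z in strip d L a, g (p + toCylinder d L z) = ∫⁻ q, g q := by
  have h1 := (measurePreserving_add_left (volume : Measure (Cylinder d L)) p).comp
    (measurePreserving_toCylinder_strip (d := d) (L := L) a)
  rw [← h1.map_eq, lintegral_map' (by rwa [h1.map_eq]) h1.measurable.aemeasurable]
  rfl

end Covering

/-! ### Square integrals -/

section Squares

variable {α : Type*} [MeasurableSpace α] {μ : Measure α}

theorem lintegral_enorm_sq_eq (v : α → ℝ) :
    ∫⁻ x, ‖v x‖ₑ ^ 2 ∂μ = eLpNorm v 2 μ ^ 2 := by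
  have := eLpNorm_nnreal_pow_eq_lintegral (f := v) (p := 2) (μ := μ) two_ne_zero
  simpa using this.symm

theorem memLp_two_iff_lintegral {v : α → ℝ} (hv : AEStronglyMeasurable v μ) :
    MemLp v 2 μ ↔ ∫⁻ x, ‖v x‖ₑ ^ 2 ∂μ < ⊤ := by
  rw [lintegral_enorm_sq_eq]
  constructor
  · intro h
    exact ENNReal.pow_lt_top h.2
  · intro h
    refine ⟨hv, ?_⟩
    by_contra hc
    rw [not_lt, top_le_iff] at hc
    simp [hc] at h

theorem ofReal_integral_sq {v : α → ℝ} (hv : MemLp v 2 μ) :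
    ENNReal.ofReal (∫ x, v x ^ 2 ∂μ) = ∫⁻ x, ‖v x‖ₑ ^ 2 ∂μ := by
  rw [ofReal_integral_eq_lintegral_ofReal hv.integrable_sq
    (Eventually.of_forall fun x => sq_nonneg _)]
  refine lintegral_congr fun x => ?_
  rw [← ofReal_norm, ← ENNReal.ofReal_pow (norm_nonneg _), Real.norm_eq_abs, sq_abs]

theorem eLpNorm_toReal_sq {v : α → ℝ} (hv : MemLp v 2 μ) :
    (eLpNorm v 2 μ).toReal ^ 2 = ∫ x, v x ^ 2 ∂μ := by
  have h := ofReal_integral_sq hv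
  rw [lintegral_enorm_sq_eq] at h
  rw [← ENNReal.toReal_pow, ← h,
    ENNReal.toReal_ofReal (integral_nonneg fun x => sq_nonneg _)]

theorem integral_sq_le_of_lintegral {v : α → ℝ} (hv : MemLp v 2 μ) {C : ℝ} (hC : 0 ≤ C)
    (h : ∫⁻ x, ‖v x‖ₑ ^ 2 ∂μ ≤ ENNReal.ofReal C) : ∫ x, v x ^ 2 ∂μ ≤ C := by
  rw [← ofReal_integral_sq hv] at h
  exact (ENNReal.ofReal_le_ofReal_iff hC).1 h

/-- The Cauchy–Schwarz inequality. -/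
theorem sq_integral_mul_le {v w : α → ℝ} (hv : MemLp v 2 μ) (hw : MemLp w 2 μ) :
    (∫ x, v x * w x ∂μ) ^ 2 ≤ (∫ x, v x ^ 2 ∂μ) * ∫ x, w x ^ 2 ∂μ := by
  have hvw : Integrable (fun x => v x * w x) μ := hv.integrable_mul hw
  have key : ∀ t : ℝ, 0 ≤ (∫ x, w x ^ 2 ∂μ) * (t * t) + (2 * ∫ x, v x * w x ∂μ) * t
      + ∫ x, v x ^ 2 ∂μ := by
    intro t
    have h0 : 0 ≤ ∫ x, (v x + t * w x) ^ 2 ∂μ := integral_nonneg fun x => sq_nonneg _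
    have h1 : ∫ x, (v x + t * w x) ^ 2 ∂μ
        = ∫ x, (v x ^ 2 + ((2 * t) * (v x * w x) + t ^ 2 * w x ^ 2)) ∂μ :=
      integral_congr_ae (Eventually.of_forall fun x => by ring)
    have i2 : Integrable (fun x => (2 * t) * (v x * w x)) μ := hvw.const_mul _
    have i3 : Integrable (fun x => t ^ 2 * w x ^ 2) μ := hw.integrable_sq.const_mul _
    rw [h1, integral_add hv.integrable_sq (i2.fun_add i3), integral_add i2 i3, integral_const_mul,
      integral_const_mul] at h0
    linarith
  have := discrim_le_zero key
  rw [discrim] at this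
  nlinarith

theorem ENNReal_sq_lintegral_mul_le {f g : α → ℝ≥0∞} (hf : AEMeasurable f μ)
    (hg : AEMeasurable g μ) :
    (∫⁻ x, f x * g x ∂μ) ^ 2 ≤ (∫⁻ x, f x ^ 2 ∂μ) * ∫⁻ x, g x ^ 2 ∂μ := by
  have h := ENNReal.lintegral_mul_le_Lp_mul_Lq μ Real.HolderConjugate.two_two hf hg
  simp only [Pi.mul_apply] at h
  calc (∫⁻ x, f x * g x ∂μ) ^ 2
      ≤ ((∫⁻ x, f x ^ (2 : ℝ) ∂μ) ^ (1 / 2 : ℝ) * (∫⁻ x, g x ^ (2 : ℝ) ∂μ) ^ (1 / 2 : ℝ)) ^ 2 := by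
        gcongr
    _ = _ := by
        rw [mul_pow, ← ENNReal.rpow_natCast, ← ENNReal.rpow_natCast, ← ENNReal.rpow_mul,
          ← ENNReal.rpow_mul]
        norm_num

theorem sq_lintegral_weight_le {k f : α → ℝ≥0∞} (hk : AEMeasurable k μ)
    (hf : AEMeasurable f μ) :
    (∫⁻ x, k x * f x ∂μ) ^ 2 ≤ (∫⁻ x, k x ∂μ) * ∫⁻ x, k x * f x ^ 2 ∂μ := by
  have hk' : AEMeasurable (fun x => k x ^ (1 / 2 : ℝ)) μ := hk.pow_const _
  have e : ∀ x, k x ^ (1 / 2 : ℝ) * k x ^ (1 / 2 : ℝ) = k x := fun x => by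
    rw [← ENNReal.rpow_add_of_nonneg _ _ (by norm_num) (by norm_num)]; norm_num
  have h := ENNReal_sq_lintegral_mul_le hk' (hk'.mul hf)
  have e1 : ∀ x, k x ^ (1 / 2 : ℝ) * (k x ^ (1 / 2 : ℝ) * f x) = k x * f x := fun x => by
    rw [← mul_assoc, e]
  have e2 : ∀ x, (k x ^ (1 / 2 : ℝ)) ^ 2 = k x := fun x => by rw [sq, e]
  simpa only [Pi.mul_apply, e1, mul_pow, e2] using h

end Squares

/-! ### Convolution on the cylinder -/

section Convolution

variable {d : ℕ} {L : ℝ} [Fact (0 < L)]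

/-- Minkowski's integral inequality for square integrals with a weight. -/
theorem lintegral_sq_integral_mul_le {K : Space d → ℝ} (hK : AEStronglyMeasurable K volume)
    {F : Cylinder d L → Space d → ℝ}
    (hF : AEStronglyMeasurable (Function.uncurry F) (volume.prod volume)) :
    ∫⁻ p, (∫⁻ z, ‖K z‖ₑ * ‖F p z‖ₑ) ^ 2 ≤
      (∫⁻ z, ‖K z‖ₑ) * ∫⁻ z, ‖K z‖ₑ * ∫⁻ p, ‖F p z‖ₑ ^ 2 := by
  have h1 : ∀ᵐ p : Cylinder d L, (∫⁻ z, ‖K z‖ₑ * ‖F p z‖ₑ) ^ 2 ≤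
      (∫⁻ z, ‖K z‖ₑ) * ∫⁻ z, ‖K z‖ₑ * ‖F p z‖ₑ ^ 2 := by
    filter_upwards [hF.prodMk_left] with p hp
    exact sq_lintegral_weight_le hK.enorm hp.enorm
  have hm : AEMeasurable (fun q : Cylinder d L × Space d => ‖K q.2‖ₑ * ‖F q.1 q.2‖ₑ ^ 2)
      (volume.prod volume) :=
    (hK.comp_quasiMeasurePreserving Measure.quasiMeasurePreserving_snd).enorm.mul
      (hF.enorm.pow_const 2)
  calc _ ≤ ∫⁻ p : Cylinder d L, (∫⁻ z, ‖K z‖ₑ) * ∫⁻ z, ‖K z‖ₑ * ‖F p z‖ₑ ^ 2 :=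
        lintegral_mono_ae h1
    _ = (∫⁻ z, ‖K z‖ₑ) * ∫⁻ p : Cylinder d L, ∫⁻ z, ‖K z‖ₑ * ‖F p z‖ₑ ^ 2 :=
        lintegral_const_mul'' _ hm.lintegral_prod_right'
    _ = (∫⁻ z, ‖K z‖ₑ) * ∫⁻ z, ∫⁻ p : Cylinder d L, ‖K z‖ₑ * ‖F p z‖ₑ ^ 2 := by
        rw [lintegral_lintegral_swap hm]
    _ = _ := by
        congr 1
        refine lintegral_congr_ae ?_
        filter_upwards [hF.prodMk_right] with z hz
        exact lintegral_const_mul'' _ (hz.enorm.pow_const 2)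

theorem aestronglyMeasurable_prod_sub {v : Cylinder d L → ℝ}
    (hv : AEStronglyMeasurable v volume) :
    AEStronglyMeasurable (fun q : Cylinder d L × Space d => v (q.1 - toCylinder d L q.2))
      (volume.prod volume) :=
  hv.comp_quasiMeasurePreserving quasiMeasurePreserving_prod_sub

theorem cylConv_congr_ae {K : Space d → ℝ} {v w : Cylinder d L → ℝ} (h : v =ᵐ[volume] w) :
    cylConv K v = cylConv K w := by
  ext p
  refine integral_congr_ae ?_
  filter_upwards [(quasiMeasurePreserving_sub_toCylinder p).ae_eq_comp h] with z hz
  simp only [Function.comp_apply] at hz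
  rw [hz]

theorem lintegral_comp_sub (w : Cylinder d L) {g : Cylinder d L → ℝ≥0∞}
    (hg : AEMeasurable g volume) : ∫⁻ p, g (p - w) = ∫⁻ p, g p := by
  have h1 := measurePreserving_sub_toCylinder (d := d) (L := L) w
  conv_rhs => rw [← h1.map_eq, lintegral_map' (by rwa [h1.map_eq]) h1.measurable.aemeasurable]

theorem lintegral_comp_add (w : Cylinder d L) {g : Cylinder d L → ℝ≥0∞}
    (hg : AEMeasurable g volume) : ∫⁻ p, g (p + w) = ∫⁻ p, g p := by
  have := lintegral_comp_sub (-w) hg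
  simpa using this

theorem memLp_comp_sub {v : Cylinder d L → ℝ} (hv : MemLp v 2 volume) (w : Cylinder d L) :
    MemLp (fun p => v (p - w)) 2 volume :=
  hv.comp_measurePreserving (measurePreserving_sub_toCylinder w)

theorem memLp_comp_add {v : Cylinder d L → ℝ} (hv : MemLp v 2 volume) (w : Cylinder d L) :
    MemLp (fun p => v (p + w)) 2 volume :=
  hv.comp_measurePreserving (measurePreserving_add_toCylinder w)

theorem integral_comp_add (f : Cylinder d L → ℝ) (w : Cylinder d L) :
    ∫ p, f (p + w) = ∫ p, f p := integral_add_right_eq_self f w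

theorem integral_comp_sub (f : Cylinder d L → ℝ) (w : Cylinder d L) :
    ∫ p, f (p - w) = ∫ p, f p := integral_sub_right_eq_self f w

variable {K : Space d → ℝ} {v w : Cylinder d L → ℝ}

theorem lintegral_sq_cylConv_le (hK : Integrable K) (hv : MemLp v 2 volume) :
    ∫⁻ p, (∫⁻ z, ‖K z‖ₑ * ‖v (p - toCylinder d L z)‖ₑ) ^ 2 ≤
      (∫⁻ z, ‖K z‖ₑ) ^ 2 * ∫⁻ p, ‖v p‖ₑ ^ 2 := by
  refine (lintegral_sq_integral_mul_le hK.1 (F := fun p z => v (p - toCylinder d L z))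
    (aestronglyMeasurable_prod_sub hv.1)).trans_eq ?_
  have : ∀ z : Space d, ∫⁻ p : Cylinder d L, ‖v (p - toCylinder d L z)‖ₑ ^ 2 =
      ∫⁻ p, ‖v p‖ₑ ^ 2 := fun z =>
    lintegral_comp_sub (toCylinder d L z) (g := fun p => ‖v p‖ₑ ^ 2) (hv.1.enorm.pow_const 2)
  simp_rw [this]
  rw [lintegral_mul_const'' _ hK.1.enorm, sq, mul_assoc]

theorem ae_integrable_cylConv (hK : Integrable K) (hv : MemLp v 2 volume) :
    ∀ᵐ p : Cylinder d L, Integrable fun z => K z * v (p - toCylinder d L z) := by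
  have h1 := lintegral_sq_cylConv_le hK hv
  have h2 : ∫⁻ p, (∫⁻ z, ‖K z‖ₑ * ‖v (p - toCylinder d L z)‖ₑ) ^ 2 ≠ ⊤ := by
    refine (h1.trans_lt (ENNReal.mul_lt_top (ENNReal.pow_lt_top hK.2) ?_)).ne
    exact (memLp_two_iff_lintegral hv.1).1 hv
  have hm : AEStronglyMeasurable
      (fun q : Cylinder d L × Space d => K q.2 * v (q.1 - toCylinder d L q.2))
      (volume.prod volume) :=
    (hK.1.comp_quasiMeasurePreserving Measure.quasiMeasurePreserving_snd).mul
      (aestronglyMeasurable_prod_sub hv.1)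
  have hm2 : AEMeasurable (fun p : Cylinder d L =>
      (∫⁻ z, ‖K z‖ₑ * ‖v (p - toCylinder d L z)‖ₑ) ^ 2) volume := by
    have := hm.enorm.lintegral_prod_right'
    simp only [enorm_mul] at this
    exact this.pow_const 2
  filter_upwards [ae_lt_top' hm2 h2, hm.prodMk_left] with p hp hp2
  refine ⟨hp2, ?_⟩
  rw [hasFiniteIntegral_iff_enorm]
  simp only [enorm_mul]
  by_contra hc
  rw [not_lt, top_le_iff] at hc
  simp [hc] at hp

theorem aestronglyMeasurable_cylConv (hK : AEStronglyMeasurable K volume)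
    (hv : AEStronglyMeasurable v volume) : AEStronglyMeasurable (cylConv K v) volume :=
  AEStronglyMeasurable.integral_prod_right'
    (f := fun q : Cylinder d L × Space d => K q.2 * v (q.1 - toCylinder d L q.2))
    ((hK.comp_quasiMeasurePreserving Measure.quasiMeasurePreserving_snd).mul
      (aestronglyMeasurable_prod_sub hv))

theorem enorm_cylConv_le (K : Space d → ℝ) (v : Cylinder d L → ℝ) (p : Cylinder d L) :
    ‖cylConv K v p‖ₑ ≤ ∫⁻ z, ‖K z‖ₑ * ‖v (p - toCylinder d L z)‖ₑ := by
  refine (enorm_integral_le_lintegral_enorm _).trans_eq ?_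
  simp only [enorm_mul]

theorem lintegral_cylConv_sq_le (hK : Integrable K) (hv : MemLp v 2 volume) :
    ∫⁻ p, ‖cylConv K v p‖ₑ ^ 2 ≤ (∫⁻ z, ‖K z‖ₑ) ^ 2 * ∫⁻ p, ‖v p‖ₑ ^ 2 := by
  refine le_trans (lintegral_mono fun p => ?_) (lintegral_sq_cylConv_le hK hv)
  gcongr
  exact enorm_cylConv_le K v p

theorem memLp_cylConv (hK : Integrable K) (hv : MemLp v 2 volume) :
    MemLp (cylConv K v) 2 volume := by
  rw [memLp_two_iff_lintegral (aestronglyMeasurable_cylConv hK.1 hv.1)]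
  exact (lintegral_cylConv_sq_le hK hv).trans_lt (ENNReal.mul_lt_top (ENNReal.pow_lt_top hK.2)
    ((memLp_two_iff_lintegral hv.1).1 hv))

theorem integral_cylConv_sq_le (hK : Integrable K) (hv : MemLp v 2 volume) :
    ∫ p, cylConv K v p ^ 2 ≤ (∫ z, |K z|) ^ 2 * ∫ p, v p ^ 2 := by
  refine integral_sq_le_of_lintegral (memLp_cylConv hK hv) (by positivity) ?_
  refine (lintegral_cylConv_sq_le hK hv).trans_eq ?_
  rw [ENNReal.ofReal_mul (by positivity), ofReal_integral_sq hv, ENNReal.ofReal_pow (by positivity)]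
  congr 2
  have := ofReal_integral_norm_eq_lintegral_enorm hK
  simpa using this.symm

theorem cylConv_sub (hK : Integrable K) (hv : MemLp v 2 volume) (hw : MemLp w 2 volume) :
    cylConv K (fun p => v p - w p) =ᵐ[volume] fun p => cylConv K v p - cylConv K w p := by
  filter_upwards [ae_integrable_cylConv hK hv, ae_integrable_cylConv hK hw] with p h1 h2
  simp only [cylConv, mul_sub]
  exact integral_sub h1 h2

theorem cylConv_const_mul (c : ℝ) (K : Space d → ℝ) (v : Cylinder d L → ℝ) :
    cylConv K (fun p => c * v p) = fun p => c * cylConv K v p := by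
  ext p
  simp only [cylConv, ← integral_const_mul]
  congr 1; ext z; ring

theorem cylConv_comp_add (K : Space d → ℝ) (v : Cylinder d L → ℝ) (w p : Cylinder d L) :
    cylConv K (fun q => v (q + w)) p = cylConv K v (p + w) := by
  simp only [cylConv]
  congr 1; ext z
  rw [sub_add_eq_add_sub]

theorem integrable_prod_cylConv (hK : Integrable K) (hv : MemLp v 2 volume)
    (hw : MemLp w 2 volume) :
    Integrable (fun q : Cylinder d L × Space d => K q.2 * v (q.1 - toCylinder d L q.2) * w q.1)
      (volume.prod volume) := by
  have hmv := aestronglyMeasurable_prod_sub (d := d) (L := L) hv.1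
  have hm : AEStronglyMeasurable (fun q : Cylinder d L × Space d =>
      K q.2 * v (q.1 - toCylinder d L q.2) * w q.1) (volume.prod volume) :=
    ((hK.1.comp_quasiMeasurePreserving Measure.quasiMeasurePreserving_snd).mul hmv).mul
      (hw.1.comp_quasiMeasurePreserving Measure.quasiMeasurePreserving_fst)
  refine (integrable_prod_iff' hm).2 ⟨Eventually.of_forall fun z => ?_, ?_⟩
  · have := ((memLp_comp_sub hv (toCylinder d L z)).integrable_mul hw).const_mul (K z)
    simpa [mul_assoc] using this
  · have hb : Integrable fun z : Space d => ‖K z‖ * ((∫ p, v p ^ 2) + ∫ p, w p ^ 2) :=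
      hK.norm.mul_const _
    refine hb.mono' hm.norm.prod_swap.integral_prod_right' (Eventually.of_forall fun z => ?_)
    rw [Real.norm_of_nonneg (integral_nonneg fun p => norm_nonneg _)]
    have hvz := memLp_comp_sub hv (toCylinder d L z)
    have : ∀ p : Cylinder d L, ‖K z * v (p - toCylinder d L z) * w p‖ ≤
        ‖K z‖ * (v (p - toCylinder d L z) ^ 2 + w p ^ 2) := fun p => by
      rw [mul_assoc, norm_mul]
      gcongr
      rw [Real.norm_eq_abs, abs_mul]
      nlinarith [sq_nonneg (|v (p - toCylinder d L z)| - |w p|), sq_abs (v (p - toCylinder d L z)),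
        sq_abs (w p), abs_nonneg (v (p - toCylinder d L z)), abs_nonneg (w p)]
    refine (integral_mono_of_nonneg (Eventually.of_forall fun p => norm_nonneg _)
      ((hvz.integrable_sq.add hw.integrable_sq).const_mul _)
      (Eventually.of_forall this)).trans_eq ?_
    rw [integral_const_mul]
    simp only [Pi.add_apply]
    rw [integral_add hvz.integrable_sq hw.integrable_sq,
      integral_comp_sub (fun p => v p ^ 2) (toCylinder d L z)]

/-- The adjoint of the convolution with `K` is the convolution with the reflected kernel. -/
theorem integral_cylConv_mul (hK : Integrable K) (hv : MemLp v 2 volume) (hw : MemLp w 2 volume) :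
    ∫ p, cylConv K v p * w p = ∫ p, v p * cylConv (fun z => K (-z)) w p := by
  have e1 : ∫ p, cylConv K v p * w p =
      ∫ z : Space d, ∫ p : Cylinder d L, K z * v (p - toCylinder d L z) * w p := by
    rw [← integral_integral_swap (f := fun (p : Cylinder d L) (z : Space d) =>
      K z * v (p - toCylinder d L z) * w p) (integrable_prod_cylConv hK hv hw)]
    simp only [cylConv, integral_mul_const]
  have e2 : ∫ p, v p * cylConv (fun z => K (-z)) w p =
      ∫ z : Space d, ∫ p : Cylinder d L, K (-z) * w (p - toCylinder d L z) * v p := by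
    rw [← integral_integral_swap (f := fun (p : Cylinder d L) (z : Space d) =>
      K (-z) * w (p - toCylinder d L z) * v p) (integrable_prod_cylConv hK.comp_neg hw hv)]
    simp only [cylConv, integral_mul_const, mul_comm (v _)]
  rw [e1, e2, ← integral_neg_eq_self (fun z : Space d => ∫ p : Cylinder d L,
    K z * v (p - toCylinder d L z) * w p)]
  congr 1; ext z
  rw [← integral_comp_sub _ (toCylinder d L z)]
  congr 1; ext p
  simp only [toCylinder_neg, sub_neg_eq_add, sub_add_cancel]
  ring

end Convolution

/-! ### Mollification -/

section Mollification

variable {d : ℕ} {L : ℝ} [Fact (0 < L)]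

theorem tendsto_lintegral_translation {v : Cylinder d L → ℝ} (hv : MemLp v 2 volume) :
    Tendsto (fun z : Space d => ∫⁻ p, ‖v (p - toCylinder d L z) - v p‖ₑ ^ 2) (𝓝 0) (𝓝 0) := by
  have : Fact ((2 : ℝ≥0∞) ≠ ⊤) := ⟨by simp⟩
  have : ContinuousVAdd (Cylinder d L)ᵈᵃᵃ (Lp ℝ 2 (volume : Measure (Cylinder d L))) :=
    Lp.instContinuousVAddDomAddAct
  let f : Lp ℝ 2 (volume : Measure (Cylinder d L)) := hv.toLp v
  have hc : Continuous fun z : Space d =>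
      (DomAddAct.mk (-toCylinder d L z) +ᵥ f : Lp ℝ 2 (volume : Measure (Cylinder d L))) :=
    (continuous_vadd.comp ((DomAddAct.continuous_mk.comp
      (continuous_toCylinder.neg)).prodMk continuous_const))
  have h1 : Tendsto (fun z : Space d => edist (DomAddAct.mk (-toCylinder d L z) +ᵥ f) f ^ 2)
      (𝓝 0) (𝓝 0) := by
    have h2 := (hc.tendsto 0).edist (tendsto_const_nhds (x := f))
    have h3 : DomAddAct.mk (-toCylinder d L 0) +ᵥ f = f := by simp
    rw [h3, edist_self] at h2
    simpa using ENNReal.Tendsto.pow (n := 2) h2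
  refine h1.congr fun z => ?_
  rw [lintegral_enorm_sq_eq, DomAddAct.mk_vadd_toLp, Lp.edist_toLp_toLp]
  congr 2
  ext p
  simp [sub_eq_add_neg, add_comm]

/-- Convolution with an approximate identity converges in `L²`. -/
theorem tendsto_cylConv {v : Cylinder d L → ℝ} (hv : MemLp v 2 volume)
    {ρ : ℕ → Space d → ℝ} (hρ : ∀ n, Integrable (ρ n)) (h1 : ∀ n, ∫ z, ρ n z = 1) {C : ℝ≥0∞}
    (hC : C ≠ ⊤) (hρC : ∀ n, ∫⁻ z, ‖ρ n z‖ₑ ≤ C) {r : ℕ → ℝ} (hr : Tendsto r atTop (𝓝 0))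
    (hρr : ∀ n z, ρ n z ≠ 0 → ‖z‖ ≤ r n) :
    Tendsto (fun n => ∫⁻ p, ‖cylConv (ρ n) v p - v p‖ₑ ^ 2) atTop (𝓝 0) := by
  have hT := tendsto_lintegral_translation hv
  have key : ∀ n, ∫⁻ p, ‖cylConv (ρ n) v p - v p‖ₑ ^ 2 ≤
      C * ∫⁻ z, ‖ρ n z‖ₑ * ∫⁻ p, ‖v (p - toCylinder d L z) - v p‖ₑ ^ 2 := by
    intro n
    have hm : AEStronglyMeasurable (Function.uncurry fun (p : Cylinder d L) (z : Space d) =>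
        v (p - toCylinder d L z) - v p) (volume.prod volume) :=
      (aestronglyMeasurable_prod_sub hv.1).sub
        (hv.1.comp_quasiMeasurePreserving Measure.quasiMeasurePreserving_fst)
    calc ∫⁻ p, ‖cylConv (ρ n) v p - v p‖ₑ ^ 2
        ≤ ∫⁻ p : Cylinder d L, (∫⁻ z, ‖ρ n z‖ₑ * ‖v (p - toCylinder d L z) - v p‖ₑ) ^ 2 := by
          refine lintegral_mono_ae ?_
          filter_upwards [ae_integrable_cylConv (hρ n) hv] with p hp
          gcongr
          have : cylConv (ρ n) v p - v p = ∫ z, ρ n z * (v (p - toCylinder d L z) - v p) := by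
            simp only [mul_sub, cylConv]
            rw [integral_sub hp ((hρ n).mul_const _), integral_mul_const, h1, one_mul]
          rw [this]
          refine (enorm_integral_le_lintegral_enorm _).trans_eq ?_
          simp only [enorm_mul]
      _ ≤ _ := lintegral_sq_integral_mul_le (hρ n).1 hm
      _ ≤ _ := by gcongr; exact hρC n
  rw [ENNReal.tendsto_nhds_zero]
  intro ε hε
  obtain ⟨δ, hδ, hδε⟩ : ∃ δ : ℝ≥0∞, 0 < δ ∧ C * (C * δ) ≤ ε := by
    have : Tendsto (fun δ : ℝ≥0∞ => C * (C * δ)) (𝓝 0) (𝓝 (C * (C * 0))) :=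
      ENNReal.Tendsto.const_mul (ENNReal.Tendsto.const_mul tendsto_id (Or.inr hC)) (Or.inr hC)
    simp only [mul_zero] at this
    have h2 := (ENNReal.tendsto_nhds_zero.1 this) ε hε
    obtain ⟨δ, h3, h4⟩ := (ENNReal.nhds_zero_basis_Iic.eventually_iff).1 h2
    exact ⟨δ, h3, h4 (mem_Iic.2 le_rfl)⟩
  have h3 := (ENNReal.tendsto_nhds_zero.1 hT) δ hδ
  obtain ⟨s, hs, hsb⟩ := Metric.eventually_nhds_iff.1 h3
  have h4 : ∀ᶠ n in atTop, r n < s := hr.eventually_lt_const hs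
  filter_upwards [h4] with n hn
  refine (key n).trans (le_trans ?_ hδε)
  gcongr
  calc _ ≤ ∫⁻ z, ‖ρ n z‖ₑ * δ := by
        refine lintegral_mono fun z => ?_
        by_cases hz : ρ n z = 0
        · simp [hz]
        · gcongr
          exact hsb (by simpa using (hρr n z hz).trans_lt hn)
    _ = (∫⁻ z, ‖ρ n z‖ₑ) * δ := lintegral_mul_const'' _ (hρ n).1.enorm
    _ ≤ C * δ := by gcongr; exact hρC n

theorem isOpenQuotientMap_toCylinder : IsOpenQuotientMap (toCylinder d L) := by
  have h1 : IsOpenQuotientMap (fun y : Fin d → ℝ => fun j => (y j : AddCircle L)) :=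
    IsOpenQuotientMap.piMap fun _ => QuotientAddGroup.isOpenQuotientMap_mk
  have h2 := (IsOpenQuotientMap.id (X := ℝ)).prodMap h1
  let e : Space d ≃ₜ ℝ × (Fin d → ℝ) :=
    { toEquiv := (splitEquiv d).toEquiv
      continuous_toFun := by
        change Continuous fun z : Space d => (z 0, fun j : Fin d => z j.succ)
        fun_prop
      continuous_invFun := by
        have : ((splitEquiv d).toEquiv.invFun) =
            fun q : ℝ × (Fin d → ℝ) => WithLp.toLp 2 (Fin.cons q.1 q.2 : Fin (d + 1) → ℝ) :=
          funext fun q => splitEquiv_symm_apply q.1 q.2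
        rw [this]
        refine (PiLp.continuous_toLp 2 _).comp ?_
        exact Continuous.finCons continuous_fst continuous_snd }
  exact h2.comp e.isOpenQuotientMap

end Mollification

/-! ### Test functions and partial derivatives -/

section TestFunctions

variable {d : ℕ} {L : ℝ}

theorem single_eq_smul (i : Fin (d + 1)) (t : ℝ) :
    (EuclideanSpace.single i t : Space d) = t • EuclideanSpace.single i 1 := by
  ext j
  by_cases h : j = i <;> simp [h]

theorem continuous_single (i : Fin (d + 1)) :
    Continuous fun t : ℝ => (EuclideanSpace.single i t : Space d) := by
  rw [funext (single_eq_smul i)]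
  fun_prop

theorem single_zero_eq (i : Fin (d + 1)) : (EuclideanSpace.single i (0 : ℝ) : Space d) = 0 := by
  rw [single_eq_smul, zero_smul]

theorem partialDeriv_toCylinder {φ : Cylinder d L → ℝ}
    (hφ : Differentiable ℝ fun z : Space d => φ (toCylinder d L z)) (i : Fin (d + 1))
    (z : Space d) :
    partialDeriv i φ (toCylinder d L z) =
      fderiv ℝ (fun z : Space d => φ (toCylinder d L z)) z (EuclideanSpace.single i 1) := by
  have h1 : HasDerivAt (fun t : ℝ => z + t • (EuclideanSpace.single i 1 : Space d))
      (EuclideanSpace.single i 1) 0 := by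
    simpa using ((hasDerivAt_id (0 : ℝ)).smul_const
      (EuclideanSpace.single i 1 : Space d)).const_add z
  have h2 := (hφ (z + (0 : ℝ) • (EuclideanSpace.single i 1 : Space d))).hasFDerivAt.comp_hasDerivAt
    (0 : ℝ) h1
  simp only [zero_smul, add_zero] at h2
  rw [partialDeriv, ← h2.deriv]
  congr 1
  ext t
  simp [single_eq_smul i t]

theorem hasDerivAt_line {φ : Cylinder d L → ℝ}
    (hφ : Differentiable ℝ fun z : Space d => φ (toCylinder d L z)) (i : Fin (d + 1))
    (p : Cylinder d L) (t : ℝ) :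
    HasDerivAt (fun t : ℝ => φ (p + toCylinder d L (EuclideanSpace.single i t)))
      (partialDeriv i φ (p + toCylinder d L (EuclideanSpace.single i t))) t := by
  obtain ⟨z, rfl⟩ := toCylinder_surjective p
  have h1 : HasDerivAt (fun t : ℝ => z + t • (EuclideanSpace.single i 1 : Space d))
      (EuclideanSpace.single i 1) t := by
    simpa using ((hasDerivAt_id t).smul_const
      (EuclideanSpace.single i 1 : Space d)).const_add z
  have h2 := (hφ (z + t • (EuclideanSpace.single i 1 : Space d))).hasFDerivAt.comp_hasDerivAt t h1
  rw [← toCylinder_add, partialDeriv_toCylinder hφ, single_eq_smul]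
  have h3 : (fun t : ℝ => φ (toCylinder d L z + toCylinder d L (EuclideanSpace.single i t))) =
      (fun z : Space d => φ (toCylinder d L z)) ∘
        fun t : ℝ => z + t • (EuclideanSpace.single i 1 : Space d) := by
    ext s
    rw [single_eq_smul i s]
    simp
  rw [h3]
  exact h2

variable [Fact (0 < L)]

theorem continuous_of_lift {φ : Cylinder d L → ℝ}
    (h : Continuous fun z : Space d => φ (toCylinder d L z)) : Continuous φ :=
  isOpenQuotientMap_toCylinder.continuous_comp_iff.1 h

theorem IsTestFunction.continuous {φ : Cylinder d L → ℝ} (hφ : IsTestFunction φ) :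
    Continuous φ := continuous_of_lift hφ.1.continuous

theorem IsTestFunction.differentiable {φ : Cylinder d L → ℝ} (hφ : IsTestFunction φ) :
    Differentiable ℝ fun z : Space d => φ (toCylinder d L z) :=
  hφ.1.differentiable (by simp)

theorem IsTestFunction.memLp {φ : Cylinder d L → ℝ} (hφ : IsTestFunction φ) :
    MemLp φ 2 volume := hφ.continuous.memLp_of_hasCompactSupport hφ.2

theorem contDiff_lift_partialDeriv {φ : Cylinder d L → ℝ}
    (hφ : ContDiff ℝ ∞ fun z : Space d => φ (toCylinder d L z)) (i : Fin (d + 1)) :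
    ContDiff ℝ ∞ fun z : Space d => partialDeriv i φ (toCylinder d L z) := by
  have : (fun z : Space d => partialDeriv i φ (toCylinder d L z)) = fun z =>
      fderiv ℝ (fun z : Space d => φ (toCylinder d L z)) z (EuclideanSpace.single i 1) :=
    funext fun z => partialDeriv_toCylinder (hφ.differentiable (by simp)) i z
  rw [this]
  exact (hφ.fderiv_right (m := ∞) (by norm_num)).clm_apply contDiff_const

theorem IsTestFunction.partialDeriv {φ : Cylinder d L → ℝ} (hφ : IsTestFunction φ)
    (i : Fin (d + 1)) : IsTestFunction (partialDeriv i φ) := by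
  refine ⟨contDiff_lift_partialDeriv hφ.1 i, ?_⟩
  refine hφ.2.mono' fun p hp => ?_
  by_contra hc
  rw [notMem_tsupport_iff_eventuallyEq] at hc
  apply hp
  have hcont : Continuous fun t : ℝ => p + toCylinder d L (EuclideanSpace.single i t) :=
    continuous_const.add (continuous_toCylinder.comp (continuous_single i))
  have h0 : p + toCylinder d L (EuclideanSpace.single i 0) = p := by
    simp [single_zero_eq]
  have h1 : (fun t : ℝ => φ (p + toCylinder d L (EuclideanSpace.single i t))) =ᶠ[𝓝 0]
      fun _ => 0 := by
    have h2 := hcont.tendsto 0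
    rw [h0] at h2
    exact h2.eventually hc
  rw [PlanarFront.partialDeriv, h1.deriv_eq]
  simp

theorem multiDeriv_single (i : Fin (d + 1)) (k : ℕ) (φ : Cylinder d L → ℝ) :
    multiDeriv (Pi.single i k) φ = (partialDeriv i)^[k] φ := by
  have key : ∀ l : List (Fin (d + 1)), l.Nodup →
      l.foldr (fun j ψ => (partialDeriv j)^[(Pi.single i k : Fin (d + 1) → ℕ) j] ψ) φ =
        if i ∈ l then (partialDeriv i)^[k] φ else φ := by
    intro l
    induction l with
    | nil => simp
    | cons a l ih =>
      intro hl
      rw [List.nodup_cons] at hl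
      rw [List.foldr_cons, ih hl.2]
      by_cases ha : a = i
      · subst ha
        simp [hl.1]
      · rw [Pi.single_eq_of_ne ha]
        simp [Ne.symm ha]
  rw [multiDeriv, key _ (List.nodup_finRange _)]
  simp

theorem multiDeriv_zero (φ : Cylinder d L → ℝ) : multiDeriv 0 φ = φ := by
  have := multiDeriv_single (0 : Fin (d + 1)) 0 φ
  simpa using this

theorem hasWeakDeriv_single_iff {i : Fin (d + 1)} {k : ℕ} {v g : Cylinder d L → ℝ} :
    HasWeakDeriv (Pi.single i k) v g ↔ ∀ φ, IsTestFunction φ →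
      ∫ p, v p * (partialDeriv i)^[k] φ p = (-1) ^ k * ∫ p, g p * φ p := by
  simp [HasWeakDeriv, multiDeriv_single]

theorem hasWeakDeriv_one_iff {i : Fin (d + 1)} {v g : Cylinder d L → ℝ} :
    HasWeakDeriv (Pi.single i 1) v g ↔ ∀ φ, IsTestFunction φ →
      ∫ p, v p * partialDeriv i φ p = - ∫ p, g p * φ p := by
  simp [hasWeakDeriv_single_iff]

/-! ### Smooth kernels -/

variable {K : Space d → ℝ}

/-- The partial derivative of a kernel. -/
def kernelDeriv (i : Fin (d + 1)) (K : Space d → ℝ) : Space d → ℝ :=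
  fun z => fderiv ℝ K z (EuclideanSpace.single i 1)

/-- Smooth compactly supported kernels. -/
def IsSmoothKernel (K : Space d → ℝ) : Prop := ContDiff ℝ ∞ K ∧ HasCompactSupport K

theorem IsSmoothKernel.integrable (hK : IsSmoothKernel K) : Integrable K :=
  hK.1.continuous.integrable_of_hasCompactSupport hK.2

theorem IsSmoothKernel.kernelDeriv (hK : IsSmoothKernel K) (i : Fin (d + 1)) :
    IsSmoothKernel (kernelDeriv i K) :=
  ⟨(hK.1.fderiv_right (m := ∞) (by norm_num)).clm_apply contDiff_const,
    hK.2.fderiv_apply ℝ _⟩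

theorem IsSmoothKernel.comp_neg (hK : IsSmoothKernel K) : IsSmoothKernel fun z => K (-z) :=
  ⟨hK.1.comp contDiff_neg, hK.2.comp_homeomorph (Homeomorph.neg _)⟩

theorem kernelDeriv_comp_neg (hK : Differentiable ℝ K) (i : Fin (d + 1)) (z : Space d) :
    kernelDeriv i (fun z => K (-z)) z = - kernelDeriv i K (-z) := by
  have h := (hK (-z)).hasFDerivAt.comp z (hasFDerivAt_id z).neg
  have h2 : fderiv ℝ (fun z => K (-z)) z = (fderiv ℝ K (-z)).comp (-ContinuousLinearMap.id ℝ _) :=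
    h.fderiv
  simp [kernelDeriv, h2]

theorem cylConv_toCylinder (K : Space d → ℝ) (φ : Cylinder d L → ℝ) (z : Space d) :
    cylConv K φ (toCylinder d L z) =
      convolution K (fun z => φ (toCylinder d L z)) (ContinuousLinearMap.lsmul ℝ ℝ) volume z := by
  simp [cylConv, MeasureTheory.convolution]

theorem isTestFunction_cylConv (hK : IsSmoothKernel K) {φ : Cylinder d L → ℝ}
    (hφ : Continuous φ) (hφc : HasCompactSupport φ) : IsTestFunction (cylConv K φ) := by
  constructor
  · rw [funext (cylConv_toCylinder K φ)]
    exact hK.2.contDiff_convolution_left _ hK.1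
      (hφ.comp continuous_toCylinder).locallyIntegrable
  · refine HasCompactSupport.intro
      ((hφc.isCompact).add (hK.2.isCompact.image continuous_toCylinder)) fun p hp => ?_
    rw [cylConv]
    refine integral_eq_zero_of_ae (Eventually.of_forall fun z => ?_)
    by_contra hc
    simp only [Pi.zero_apply, mul_eq_zero, not_or] at hc
    apply hp
    rw [← sub_add_cancel p (toCylinder d L z)]
    exact Set.add_mem_add (subset_tsupport _ hc.2) ⟨z, subset_tsupport _ hc.1, rfl⟩

theorem partialDeriv_cylConv_kernel (hK : IsSmoothKernel K) {φ : Cylinder d L → ℝ}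
    (hφ : Continuous φ) (i : Fin (d + 1)) :
    partialDeriv i (cylConv K φ) = cylConv (kernelDeriv i K) φ := by
  have hloc : LocallyIntegrable (fun z : Space d => φ (toCylinder d L z)) volume :=
    (hφ.comp continuous_toCylinder).locallyIntegrable
  have hd := fun z => hK.2.hasFDerivAt_convolution_left (ContinuousLinearMap.lsmul ℝ ℝ)
    (hK.1.of_le (by norm_num)) hloc z
  ext p
  obtain ⟨z, rfl⟩ := toCylinder_surjective p
  have hdiff : Differentiable ℝ fun z : Space d => cylConv K φ (toCylinder d L z) := by
    rw [funext (cylConv_toCylinder K φ)]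
    exact fun z => (hd z).differentiableAt
  rw [partialDeriv_toCylinder hdiff]
  have : (fun z : Space d => cylConv K φ (toCylinder d L z)) =
    convolution K (fun z => φ (toCylinder d L z)) (ContinuousLinearMap.lsmul ℝ ℝ) volume :=
      funext fun z => cylConv_toCylinder K φ z
  rw [this, (hd z).fderiv, MeasureTheory.convolution, ContinuousLinearMap.integral_apply]
  · simp [cylConv, kernelDeriv]
  · have h1 : HasCompactSupport (fderiv ℝ K) := hK.2.fderiv ℝ
    have h2 : Continuous (fderiv ℝ K) := hK.1.continuous_fderiv (by simp)
    have h3 : Integrable fun t : Space d => φ (toCylinder d L (z - t)) • fderiv ℝ K t := by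
      have h4 : Continuous fun t : Space d => φ (toCylinder d L (z - t)) :=
        hφ.comp (continuous_toCylinder.comp (continuous_const.sub continuous_id))
      have h5 : Continuous fun t : Space d => φ (toCylinder d L (z - t)) • fderiv ℝ K t :=
        h4.smul h2
      refine h5.integrable_of_hasCompactSupport ?_
      exact h1.mono fun t ht => fun h => ht (by simp [h])
    refine h3.congr (Eventually.of_forall fun t => ?_)
    ext w
    simp [mul_comm]

theorem iterate_partialDeriv_cylConv_kernel (hK : IsSmoothKernel K) {φ : Cylinder d L → ℝ}
    (hφ : Continuous φ) (i : Fin (d + 1)) (k : ℕ) :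
    (partialDeriv i)^[k] (cylConv K φ) = cylConv ((kernelDeriv i)^[k] K) φ := by
  induction k generalizing K with
  | zero => rfl
  | succ k ih =>
    rw [Function.iterate_succ_apply, partialDeriv_cylConv_kernel hK hφ, ih (hK.kernelDeriv i),
      Function.iterate_succ_apply]

theorem partialDeriv_cylConv (hK : IsSmoothKernel K) {φ : Cylinder d L → ℝ}
    (hφ : IsTestFunction φ) (i : Fin (d + 1)) :
    partialDeriv i (cylConv K φ) = cylConv K (partialDeriv i φ) := by
  ext p
  obtain ⟨C, hC⟩ := (hφ.partialDeriv i).2.exists_bound_of_continuous (hφ.partialDeriv i).continuous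
  have hc : ∀ {ψ : Cylinder d L → ℝ} (_ : Continuous ψ) (p : Cylinder d L),
      Continuous fun z : Space d => K z * ψ (p - toCylinder d L z) := fun hψ p =>
    hK.1.continuous.mul (hψ.comp (continuous_const.sub continuous_toCylinder))
  have key := hasDerivAt_integral_of_dominated_loc_of_deriv_le (μ := (volume : Measure (Space d)))
    (F := fun (t : ℝ) z => K z * φ (p + toCylinder d L (EuclideanSpace.single i t) -
      toCylinder d L z))
    (F' := fun (t : ℝ) z => K z * partialDeriv i φ (p + toCylinder d L (EuclideanSpace.single i t) -
      toCylinder d L z)) (x₀ := 0) (s := univ) (bound := fun z => ‖K z‖ * C) univ_mem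
    (Eventually.of_forall fun t => (hc hφ.continuous _).aestronglyMeasurable)
    ((hc hφ.continuous _).integrable_of_hasCompactSupport (hK.2.mul_right))
    (hc (hφ.partialDeriv i).continuous _).aestronglyMeasurable
    (Eventually.of_forall fun z t _ => by
      rw [norm_mul]; gcongr; exact hC _)
    (hK.integrable.norm.mul_const C)
    (Eventually.of_forall fun z t _ => by
      have := (hasDerivAt_line hφ.differentiable i (p - toCylinder d L z) t).const_mul (K z)
      simpa only [sub_add_eq_add_sub] using this)
  have h0 : p + toCylinder d L (EuclideanSpace.single i 0) = p := by simp [single_zero_eq]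
  have := key.2.deriv
  simp only [h0] at this
  exact this

end TestFunctions

/-! ### Density of test functions and duality -/

section Duality

variable {d : ℕ} {L : ℝ} [Fact (0 < L)]

theorem integrable_fun_mul {α : Type*} [MeasurableSpace α] {μ : Measure α} {v w : α → ℝ}
    (hv : MemLp v 2 μ) (hw : MemLp w 2 μ) : Integrable (fun x => v x * w x) μ :=
  hv.integrable_mul hw

theorem exists_isTestFunction_eLpNorm_sub_le {h : Cylinder d L → ℝ} (hh : MemLp h 2 volume)
    {ε : ℝ≥0∞} (hε : ε ≠ 0) : ∃ φ, IsTestFunction φ ∧ eLpNorm (h - φ) 2 volume ≤ ε := by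
  have hε2 : ε / 2 ≠ 0 := by simpa using hε
  obtain ⟨χ, hχc, hχ, hχcont, hχm⟩ := hh.exists_hasCompactSupport_eLpNorm_sub_le (by simp) hε2
  let b : ℕ → ContDiffBump (0 : Space d) := fun n =>
    ⟨1 / (2 * ((n : ℝ) + 1)), 1 / ((n : ℝ) + 1), by positivity, by
      apply one_div_lt_one_div_of_lt <;> [positivity; skip]
      have : (0 : ℝ) ≤ n := n.cast_nonneg
      linarith⟩
  let ρ : ℕ → Space d → ℝ := fun n => (b n).normed volume
  have hρs : ∀ n, IsSmoothKernel (ρ n) := fun n =>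
    ⟨(b n).contDiff_normed, (b n).hasCompactSupport_normed⟩
  have hlim := tendsto_cylConv hχm (ρ := ρ) (fun n => (hρs n).integrable)
    (fun n => (b n).integral_normed) (C := 1) (by simp)
    (fun n => by
      have := ofReal_integral_norm_eq_lintegral_enorm (hρs n).integrable
      rw [← this]
      have h2 : ∫ z, ‖ρ n z‖ = 1 := by
        rw [← (b n).integral_normed (μ := volume)]
        congr 1; ext z
        exact Real.norm_of_nonneg ((b n).nonneg_normed z)
      rw [h2]
      simp)
    tendsto_one_div_add_atTop_nhds_zero_nat
    (fun n z hz => by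
      have : z ∈ Function.support (ρ n) := hz
      rw [(b n).support_normed_eq] at this
      exact (mem_ball_zero_iff.1 this).le)
  have hev := (ENNReal.tendsto_nhds_zero.1 hlim) ((ε / 2) ^ 2)
    (pos_iff_ne_zero.2 (pow_ne_zero 2 hε2))
  obtain ⟨n, hn⟩ := hev.exists
  refine ⟨cylConv (ρ n) χ, isTestFunction_cylConv (hρs n) hχcont hχc, ?_⟩
  have h2 : eLpNorm (χ - cylConv (ρ n) χ) 2 volume ≤ ε / 2 := by
    rw [eLpNorm_sub_comm]
    rw [lintegral_enorm_sq_eq (fun p => cylConv (ρ n) χ p - χ p)] at hn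
    exact (ENNReal.pow_le_pow_left_iff two_ne_zero).1 hn
  calc eLpNorm (h - cylConv (ρ n) χ) 2 volume
      = eLpNorm ((h - χ) + (χ - cylConv (ρ n) χ)) 2 volume := by congr 1; ring
    _ ≤ ε / 2 + ε / 2 := (eLpNorm_add_le (hh.1.sub hχm.1)
        (hχm.1.sub (memLp_cylConv (hρs n).integrable hχm).1) (by norm_num)).trans
          (add_le_add hχ h2)
    _ = ε := ENNReal.add_halves ε

theorem exists_isTestFunction_integral_sub_sq_le {h : Cylinder d L → ℝ} (hh : MemLp h 2 volume)
    {ε : ℝ} (hε : 0 < ε) : ∃ φ, IsTestFunction φ ∧ ∫ p, (h p - φ p) ^ 2 ≤ ε ^ 2 := by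
  obtain ⟨φ, hφ, h1⟩ := exists_isTestFunction_eLpNorm_sub_le hh
    (ε := ENNReal.ofReal ε) (by simpa using hε)
  refine ⟨φ, hφ, ?_⟩
  have hm := hh.sub hφ.memLp
  have := eLpNorm_toReal_sq hm
  simp only [Pi.sub_apply] at this
  rw [← this]
  gcongr
  exact ENNReal.toReal_le_of_le_ofReal hε.le h1

/-- The `L²` norm is controlled by testing against test functions. -/
theorem integral_sq_le_of_test {h : Cylinder d L → ℝ} (hh : MemLp h 2 volume) {c : ℝ} (hc : 0 ≤ c)
    (H : ∀ φ, IsTestFunction φ → (∫ p, h p * φ p) ^ 2 ≤ c ^ 2 * ∫ p, φ p ^ 2) :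
    ∫ p, h p ^ 2 ≤ c ^ 2 := by
  set a := Real.sqrt (∫ p, h p ^ 2) with ha
  have ha2 : a ^ 2 = ∫ p, h p ^ 2 := Real.sq_sqrt (integral_nonneg fun p => sq_nonneg _)
  have ha0 : 0 ≤ a := Real.sqrt_nonneg _
  have key : ∀ η : ℝ, 0 < η → a ^ 2 ≤ c * (a + η) + a * η := by
    intro η hη
    obtain ⟨φ, hφ, h1⟩ := exists_isTestFunction_integral_sub_sq_le hh hη
    have hm : MemLp (fun p => h p - φ p) 2 volume := hh.sub hφ.memLp
    have e1 : (∫ p, h p * (h p - φ p)) ^ 2 ≤ (a * η) ^ 2 := by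
      refine (sq_integral_mul_le hh hm).trans ?_
      rw [mul_pow, ha2]
      gcongr
    have e2 : ∫ p, h p ^ 2 = (∫ p, h p * φ p) + ∫ p, h p * (h p - φ p) := by
      rw [← integral_add (integrable_fun_mul hh hφ.memLp) (integrable_fun_mul hh hm)]
      congr 1; ext p; ring
    have e3 : ∫ p, φ p ^ 2 ≤ (a + η) ^ 2 := by
      have e4 : (∫ p, h p * (h p - φ p)) ^ 2 ≤ (a * η) ^ 2 := e1
      have e5 : ∫ p, φ p ^ 2 = (∫ p, h p ^ 2) - 2 * (∫ p, h p * (h p - φ p))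
          + ∫ p, (h p - φ p) ^ 2 := by
        have i1 : Integrable fun p => h p ^ 2 - 2 * (h p * (h p - φ p)) :=
          hh.integrable_sq.sub ((integrable_fun_mul hh hm).const_mul 2)
        rw [← integral_const_mul, ← integral_sub hh.integrable_sq
          ((integrable_fun_mul hh hm).const_mul 2), ← integral_add
          i1 hm.integrable_sq]
        congr 1; ext p; ring
      have := abs_le_of_sq_le_sq' e4 (by positivity)
      rw [e5, ← ha2]
      nlinarith [this.1, this.2]
    have e6 : (∫ p, h p * φ p) ^ 2 ≤ (c * (a + η)) ^ 2 := by
      refine (H φ hφ).trans ?_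
      rw [mul_pow]
      gcongr
    have e7 := (abs_le_of_sq_le_sq' e6 (by positivity)).2
    have e8 := (abs_le_of_sq_le_sq' e1 (by positivity)).2
    rw [ha2, e2]
    linarith
  have hle : a ^ 2 ≤ c * a := by
    refine le_of_forall_pos_le_add fun ε hε => ?_
    have h1 := key (ε / (c + a + 1)) (by positivity)
    have h2 : (c + a) * (ε / (c + a + 1)) ≤ ε := by
      rw [mul_div_assoc', div_le_iff₀ (by positivity)]
      nlinarith
    nlinarith
  rw [← ha2]
  rcases ha0.eq_or_lt with h0 | h0
  · rw [← h0]; simpa using sq_nonneg c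
  · have : a ≤ c := by
      by_contra hcon
      push Not at hcon
      nlinarith
    gcongr

theorem ae_eq_zero_of_test {h : Cylinder d L → ℝ} (hh : MemLp h 2 volume)
    (H : ∀ φ, IsTestFunction φ → ∫ p, h p * φ p = 0) : h =ᵐ[volume] 0 := by
  have h1 := integral_sq_le_of_test hh le_rfl (fun φ hφ => by simp [H φ hφ])
  have h2 : ∫ p, h p ^ 2 = 0 :=
    le_antisymm (by simpa using h1) (integral_nonneg fun p => sq_nonneg _)
  have h3 := (integral_eq_zero_iff_of_nonneg (fun p => sq_nonneg _) hh.integrable_sq).1 h2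
  filter_upwards [h3] with p hp
  simpa using hp

theorem ae_eq_of_test {h h' : Cylinder d L → ℝ} (hh : MemLp h 2 volume) (hh' : MemLp h' 2 volume)
    (H : ∀ φ, IsTestFunction φ → ∫ p, h p * φ p = ∫ p, h' p * φ p) : h =ᵐ[volume] h' := by
  have := ae_eq_zero_of_test (hh.sub hh') fun φ hφ => by
    simp only [Pi.sub_apply, sub_mul]
    rw [integral_sub (integrable_fun_mul hh hφ.memLp) (integrable_fun_mul hh' hφ.memLp),
      H φ hφ, sub_self]
  filter_upwards [this] with p hp
  simpa [sub_eq_zero] using hp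

/-! ### Weak derivatives -/

theorem HasWeakDeriv.ae_unique {α : Fin (d + 1) → ℕ} {v g g' : Cylinder d L → ℝ}
    (hg : MemLp g 2 volume) (hg' : MemLp g' 2 volume) (h : HasWeakDeriv α v g)
    (h' : HasWeakDeriv α v g') : g =ᵐ[volume] g' := by
  refine ae_eq_of_test hg hg' fun φ hφ => ?_
  have := (h φ hφ).symm.trans (h' φ hφ)
  exact mul_left_cancel₀ (pow_ne_zero _ (by norm_num)) this

theorem weakDeriv_spec {α : Fin (d + 1) → ℕ} {v : Cylinder d L → ℝ}
    (h : ∃ g, MemLp g 2 volume ∧ HasWeakDeriv α v g) :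
    MemLp (weakDeriv α v) 2 volume ∧ HasWeakDeriv α v (weakDeriv α v) := by
  unfold weakDeriv
  rw [dif_pos h]
  exact h.choose_spec

theorem HasWeakDeriv.weakDeriv_ae_eq {α : Fin (d + 1) → ℕ} {v g : Cylinder d L → ℝ}
    (hg : MemLp g 2 volume) (h : HasWeakDeriv α v g) : weakDeriv α v =ᵐ[volume] g :=
  have hs := weakDeriv_spec ⟨g, hg, h⟩
  hs.2.ae_unique hs.1 hg h

theorem hasWeakDeriv_zero (v : Cylinder d L → ℝ) : HasWeakDeriv 0 v v := by
  intro φ _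
  simp [multiDeriv_zero]

variable {v g w f : Cylinder d L → ℝ} {K : Space d → ℝ}

theorem HasWeakDeriv.cylConv {i : Fin (d + 1)} (hK : IsSmoothKernel K) (hv : MemLp v 2 volume)
    (hg : MemLp g 2 volume) (h : HasWeakDeriv (Pi.single i 1) v g) :
    HasWeakDeriv (Pi.single i 1) (cylConv K v) (cylConv K g) := by
  rw [hasWeakDeriv_one_iff] at h ⊢
  intro φ hφ
  have hKn := hK.comp_neg
  have ht : IsTestFunction (PlanarFront.cylConv (fun z => K (-z)) φ) :=
    isTestFunction_cylConv hKn hφ.continuous hφ.2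
  rw [integral_cylConv_mul hK.integrable hv (hφ.partialDeriv i).memLp,
    integral_cylConv_mul hK.integrable hg hφ.memLp, ← partialDeriv_cylConv hKn hφ i, h _ ht]

theorem iterate_kernelDeriv_isSmoothKernel (hK : IsSmoothKernel K) (i : Fin (d + 1)) (k : ℕ) :
    IsSmoothKernel ((kernelDeriv i)^[k] K) := by
  induction k with
  | zero => exact hK
  | succ k ih => rw [Function.iterate_succ_apply']; exact ih.kernelDeriv i

theorem kernelDeriv_const_mul (c : ℝ) (hK : Differentiable ℝ K) (i : Fin (d + 1)) :
    kernelDeriv i (fun z => c * K z) = fun z => c * kernelDeriv i K z := by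
  ext z
  simp [kernelDeriv, fderiv_const_mul (hK z)]

theorem iterate_kernelDeriv_comp_neg (hK : IsSmoothKernel K) (i : Fin (d + 1)) (k : ℕ) :
    (kernelDeriv i)^[k] (fun z => K (-z)) = fun z => (-1) ^ k * (kernelDeriv i)^[k] K (-z) := by
  induction k with
  | zero => simp
  | succ k ih =>
    have hs := iterate_kernelDeriv_isSmoothKernel hK i k
    rw [Function.iterate_succ_apply', ih, kernelDeriv_const_mul _
      (hs.comp_neg.1.differentiable (by simp))]
    ext z
    rw [kernelDeriv_comp_neg (hs.1.differentiable (by simp)), Function.iterate_succ_apply']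
    ring

/-- Derivatives may be moved from the kernel to the function. -/
theorem cylConv_iterate_kernelDeriv {i : Fin (d + 1)} {k : ℕ} (hK : IsSmoothKernel K)
    (hv : MemLp v 2 volume) (hg : MemLp g 2 volume) (h : HasWeakDeriv (Pi.single i k) v g) :
    cylConv ((kernelDeriv i)^[k] K) v =ᵐ[volume] cylConv K g := by
  have hKk := iterate_kernelDeriv_isSmoothKernel hK i k
  rw [hasWeakDeriv_single_iff] at h
  refine ae_eq_of_test (memLp_cylConv hKk.integrable hv) (memLp_cylConv hK.integrable hg)
    fun φ hφ => ?_
  rw [integral_cylConv_mul hKk.integrable hv hφ.memLp,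
    integral_cylConv_mul hK.integrable hg hφ.memLp]
  have ht := isTestFunction_cylConv hK.comp_neg hφ.continuous hφ.2
  have h1 := h _ ht
  rw [iterate_partialDeriv_cylConv_kernel hK.comp_neg hφ.continuous,
    iterate_kernelDeriv_comp_neg hK] at h1
  have h2 : cylConv (fun z => (-1) ^ k * (kernelDeriv i)^[k] K (-z)) φ =
      fun p => (-1) ^ k * cylConv (fun z => (kernelDeriv i)^[k] K (-z)) φ p := by
    ext p
    simp only [PlanarFront.cylConv, ← integral_const_mul, mul_assoc]
  rw [h2] at h1
  have h3 : ∀ p, v p * ((-1) ^ k * cylConv (fun z => (kernelDeriv i)^[k] K (-z)) φ p) =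
      (-1) ^ k * (v p * cylConv (fun z => (kernelDeriv i)^[k] K (-z)) φ p) := fun p => by ring
  simp_rw [h3, integral_const_mul] at h1
  exact mul_left_cancel₀ (pow_ne_zero _ (by norm_num)) h1

theorem HasWeakDeriv.sub {α : Fin (d + 1) → ℕ} (hv : MemLp v 2 volume) (hg : MemLp g 2 volume)
    (hw : MemLp w 2 volume) (hf : MemLp f 2 volume) (h : HasWeakDeriv α v g)
    (h' : HasWeakDeriv α w f)
    (hα : ∀ φ : Cylinder d L → ℝ, IsTestFunction φ → MemLp (multiDeriv α φ) 2 volume) :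
    HasWeakDeriv α (fun p => v p - w p) (fun p => g p - f p) := by
  intro φ hφ
  simp only [sub_mul]
  rw [integral_sub (integrable_fun_mul hv (hα φ hφ)) (integrable_fun_mul hw (hα φ hφ)),
    integral_sub (integrable_fun_mul hg hφ.memLp) (integrable_fun_mul hf hφ.memLp), h φ hφ, h' φ hφ]
  ring

theorem IsTestFunction.comp_sub {φ : Cylinder d L → ℝ} (hφ : IsTestFunction φ)
    (q : Cylinder d L) : IsTestFunction fun p => φ (p - q) := by
  constructor
  · obtain ⟨w, rfl⟩ := toCylinder_surjective q
    simp_rw [← toCylinder_sub]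
    exact hφ.1.comp (contDiff_id.sub contDiff_const)
  · exact hφ.2.comp_homeomorph (Homeomorph.subRight q)

theorem partialDeriv_comp_sub (i : Fin (d + 1)) (φ : Cylinder d L → ℝ) (q p : Cylinder d L) :
    partialDeriv i (fun p => φ (p - q)) p = partialDeriv i φ (p - q) := by
  simp only [PlanarFront.partialDeriv]
  congr 1; ext t
  congr 1
  abel

theorem HasWeakDeriv.comp_add {i : Fin (d + 1)} (h : HasWeakDeriv (Pi.single i 1) v g)
    (q : Cylinder d L) :
    HasWeakDeriv (Pi.single i 1) (fun p => v (p + q)) (fun p => g (p + q)) := by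
  rw [hasWeakDeriv_one_iff] at h ⊢
  intro φ hφ
  have h1 := h _ (hφ.comp_sub q)
  simp_rw [partialDeriv_comp_sub] at h1
  rw [← integral_comp_add _ q, ← integral_comp_add (fun p => g p * φ (p - q)) q] at h1
  simpa using h1

/-- The product rule for a smooth function of the longitudinal coordinate. -/
theorem HasWeakDeriv.smooth_mul {i : Fin (d + 1)} {b : ℝ → ℝ} (hb : ContDiff ℝ ∞ b)
    (hv : MemLp v 2 volume) (hg : MemLp g 2 volume) (h : HasWeakDeriv (Pi.single i 1) v g) :
    HasWeakDeriv (Pi.single i 1) (fun p => b p.1 * v p)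
      (fun p => b p.1 * g p + (if i = 0 then deriv b p.1 else 0) * v p) := by
  rw [hasWeakDeriv_one_iff] at h ⊢
  intro φ hφ
  have htest : ∀ {c : ℝ → ℝ} (_ : ContDiff ℝ ∞ c) {φ : Cylinder d L → ℝ} (_ : IsTestFunction φ),
      IsTestFunction fun p => c p.1 * φ p := by
    intro c hc φ hφ
    refine ⟨?_, hφ.2.mul_left⟩
    have : ContDiff ℝ ∞ fun z : Space d => c (z 0) :=
      hc.comp (by fun_prop)
    exact this.mul hφ.1
  have hb' : ContDiff ℝ ∞ (deriv b) := (contDiff_infty_iff_deriv.1 hb).2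
  have h1 := h _ (htest hb hφ)
  have h2 : ∀ p : Cylinder d L, partialDeriv i (fun p => b p.1 * φ p) p =
      b p.1 * partialDeriv i φ p + (if i = 0 then deriv b p.1 else 0) * φ p := by
    intro p
    have e1 := hasDerivAt_line hφ.differentiable i p 0
    have e2 : HasDerivAt (fun t : ℝ => b (p + toCylinder d L (EuclideanSpace.single i t)).1)
        (if i = 0 then deriv b p.1 else 0) 0 := by
      by_cases hi : i = 0
      · subst hi
        have := ((hb.differentiable (by simp)) (p.1 + 0)).hasDerivAt.scomp (0 : ℝ)
          ((hasDerivAt_id (0 : ℝ)).const_add p.1)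
        simpa [Function.comp_def] using this
      · simpa [hi, Ne.symm hi] using hasDerivAt_const (0 : ℝ) (b p.1)
    have e3 := e2.mul e1
    rw [PlanarFront.partialDeriv]
    refine e3.deriv.trans ?_
    simp [single_zero_eq, PlanarFront.partialDeriv]
    ring
  simp_rw [h2] at h1
  have i1 : Integrable (fun p : Cylinder d L => v p * (b p.1 * partialDeriv i φ p)) :=
    integrable_fun_mul hv (htest hb (hφ.partialDeriv i)).memLp
  have ht2 : MemLp (fun p : Cylinder d L => (if i = 0 then deriv b p.1 else 0) * φ p) 2 volume := by
    by_cases hi : i = 0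
    · simpa [hi] using (htest hb' hφ).memLp
    · simp [hi]
  have i2 : Integrable (fun p : Cylinder d L => v p * ((if i = 0 then deriv b p.1 else 0) * φ p)) :=
    integrable_fun_mul hv ht2
  have i3 : Integrable (fun p : Cylinder d L => g p * (b p.1 * φ p)) :=
    integrable_fun_mul hg (htest hb hφ).memLp
  simp_rw [mul_add] at h1
  rw [integral_add i1 i2] at h1
  have e5 : ∫ p : Cylinder d L, (b p.1 * g p + (if i = 0 then deriv b p.1 else 0) * v p) * φ p =
      (∫ p : Cylinder d L, g p * (b p.1 * φ p)) +
        ∫ p : Cylinder d L, v p * ((if i = 0 then deriv b p.1 else 0) * φ p) := by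
    rw [← integral_add i3 i2]
    congr 1; ext p; ring
  rw [e5]
  have e6 : ∫ p : Cylinder d L, b p.1 * v p * partialDeriv i φ p =
      ∫ p : Cylinder d L, v p * (b p.1 * partialDeriv i φ p) := by
    congr 1; ext p; ring
  rw [e6]
  linarith

/-! ### Translation estimates -/

open scoped Pointwise in
theorem integral_sub_translate_single_sq_le {i : Fin (d + 1)} (hv : MemLp v 2 volume)
    (hg : MemLp g 2 volume) (h : HasWeakDeriv (Pi.single i 1) v g) (t : ℝ) :
    ∫ p, (v (p + toCylinder d L (EuclideanSpace.single i t)) - v p) ^ 2 ≤ t ^ 2 * ∫ p, g p ^ 2 := by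
  set q : ℝ → Cylinder d L := fun t => toCylinder d L (EuclideanSpace.single i t) with hq
  have hqc : Continuous q := continuous_toCylinder.comp (continuous_single i)
  have hq0 : q 0 = 0 := by simp [hq, single_zero_eq]
  set G := Real.sqrt (∫ p, g p ^ 2) with hG
  have hG2 : G ^ 2 = ∫ p, g p ^ 2 := Real.sq_sqrt (integral_nonneg fun p => sq_nonneg _)
  have hG0 : 0 ≤ G := Real.sqrt_nonneg _
  rw [← hG2, ← mul_pow, ← sq_abs (t * G)]
  refine integral_sq_le_of_test ((memLp_comp_add hv (q t)).sub hv) (abs_nonneg _) fun φ hφ => ?_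
  set A := Real.sqrt (∫ p, φ p ^ 2) with hA
  have hA2 : A ^ 2 = ∫ p, φ p ^ 2 := Real.sq_sqrt (integral_nonneg fun p => sq_nonneg _)
  have hA0 : 0 ≤ A := Real.sqrt_nonneg _
  obtain ⟨C, hC⟩ := (hφ.partialDeriv i).2.exists_bound_of_continuous (hφ.partialDeriv i).continuous
  have hd : ∀ s : ℝ, HasDerivAt (fun s => ∫ p, v p * φ (p - q s))
      (∫ p, g p * φ (p - q s)) s := by
    intro s
    let S : Set (Cylinder d L) := tsupport (partialDeriv i φ) + q '' Metric.closedBall s 1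
    have hSc : IsCompact S :=
      (hφ.partialDeriv i).2.isCompact.add ((isCompact_closedBall s 1).image hqc)
    have hS0 : ∀ p, ∀ t ∈ Metric.ball s 1, p ∉ S → partialDeriv i φ (p - q t) = 0 := by
      intro p t ht hp
      by_contra hc
      apply hp
      rw [← sub_add_cancel p (q t)]
      exact Set.add_mem_add (subset_tsupport _ hc) ⟨t, Metric.ball_subset_closedBall ht, rfl⟩
    have hbm : MemLp (S.indicator fun _ => C) 2 (volume : Measure (Cylinder d L)) :=
      memLp_indicator_const 2 hSc.measurableSet C (Or.inr hSc.measure_lt_top.ne)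
    have key := hasDerivAt_integral_of_dominated_loc_of_deriv_le
      (μ := (volume : Measure (Cylinder d L)))
      (F := fun (t : ℝ) p => v p * φ (p - q t))
      (F' := fun (t : ℝ) p => v p * -partialDeriv i φ (p - q t)) (x₀ := s)
      (s := Metric.ball s 1) (bound := fun p => ‖v p‖ * S.indicator (fun _ => C) p)
      (Metric.ball_mem_nhds s one_pos)
      (Eventually.of_forall fun t =>
        hv.1.mul (hφ.comp_sub (q t)).continuous.aestronglyMeasurable)
      (integrable_fun_mul hv (hφ.comp_sub (q s)).memLp)
      (hv.1.mul ((hφ.partialDeriv i).comp_sub (q s)).continuous.neg.aestronglyMeasurable)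
      (Eventually.of_forall fun p t ht => by
        rw [norm_mul, norm_neg]
        gcongr
        by_cases hp : p ∈ S
        · rw [indicator_of_mem hp]; exact hC _
        · rw [indicator_of_notMem hp, hS0 p t ht hp, norm_zero])
      (integrable_fun_mul hv.norm hbm)
      (Eventually.of_forall fun p t _ => by
        have h1 := (hasDerivAt_line hφ.differentiable i p (-t)).scomp t (hasDerivAt_neg t)
        have e : ∀ t : ℝ, p + toCylinder d L (EuclideanSpace.single i (-t)) = p - q t := by
          intro t
          rw [hq, sub_eq_add_neg, ← toCylinder_neg]
          congr 2
          ext j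
          by_cases hj : j = i <;> simp [hj]
        simp only [Function.comp_def, e, smul_eq_mul, neg_mul, one_mul] at h1
        exact h1.const_mul (v p))
    have e1 : ∫ p, g p * φ (p - q s) = ∫ p, v p * -partialDeriv i φ (p - q s) := by
      have := (hasWeakDeriv_one_iff.1 h) _ (hφ.comp_sub (q s))
      simp_rw [partialDeriv_comp_sub] at this
      simp only [mul_neg, integral_neg]
      linarith
    rw [e1]
    exact key.2
  have hb : ∀ s : ℝ, ‖∫ p, g p * φ (p - q s)‖ ≤ G * A := by
    intro s
    have h1 := sq_integral_mul_le hg (hφ.comp_sub (q s)).memLp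
    rw [integral_comp_sub (fun p => φ p ^ 2) (q s), ← hG2, ← hA2, ← mul_pow] at h1
    rw [Real.norm_eq_abs]
    exact abs_le_of_sq_le_sq h1 (by positivity)
  have hmv := convex_univ.norm_image_sub_le_of_norm_hasDerivWithin_le
    (fun s _ => (hd s).hasDerivWithinAt) (fun s _ => hb s) (mem_univ 0) (mem_univ t)
  have e2 : ∫ p, ((fun p => v (p + q t)) - v) p * φ p =
      (∫ p, v p * φ (p - q t)) - ∫ p, v p * φ (p - q 0) := by
    rw [← integral_comp_add (fun p => v p * φ (p - q t)) (q t)]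
    simp only [add_sub_cancel_right, hq0, sub_zero]
    rw [← integral_sub (integrable_fun_mul (memLp_comp_add hv (q t)) hφ.memLp)
      (integrable_fun_mul hv hφ.memLp)]
    congr 1; ext p; simp only [Pi.sub_apply]; ring
  rw [e2, ← hA2, ← mul_pow, ← sq_abs]
  gcongr
  rw [Real.norm_eq_abs, sub_zero, Real.norm_eq_abs] at hmv
  refine hmv.trans_eq ?_
  rw [abs_mul, abs_of_nonneg hG0]
  ring

/-- Translations are controlled by the weak gradient. -/
theorem integral_sub_translate_sq_le {g : Fin (d + 1) → Cylinder d L → ℝ} (hv : MemLp v 2 volume)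
    (hg : ∀ i, MemLp (g i) 2 volume) (h : ∀ i, HasWeakDeriv (Pi.single i 1) v (g i))
    (w : Space d) :
    ∫ p, (v (p + toCylinder d L w) - v p) ^ 2 ≤
      2 ^ (d + 1) * ‖w‖ ^ 2 * ∑ i, ∫ p, g i p ^ 2 := by
  have hI : ∀ i, 0 ≤ ∫ p, g i p ^ 2 := fun i => integral_nonneg fun p => sq_nonneg _
  have key : ∀ S : Finset (Fin (d + 1)),
      ∫ p, (v (p + toCylinder d L (∑ i ∈ S, EuclideanSpace.single i (w i))) - v p) ^ 2 ≤
        2 ^ S.card * ∑ i ∈ S, w i ^ 2 * ∫ p, g i p ^ 2 := by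
    intro S
    induction S using Finset.induction_on with
    | empty => simp
    | insert j S hj ih =>
      rw [Finset.sum_insert hj, Finset.sum_insert hj, Finset.card_insert_of_notMem hj]
      set a := toCylinder d L (EuclideanSpace.single j (w j)) with ha
      set b := toCylinder d L (∑ i ∈ S, EuclideanSpace.single i (w i)) with hb
      have h1 := integral_sub_translate_single_sq_le hv (hg j) (h j) (w j)
      rw [← ha, ← integral_comp_add _ b] at h1
      have m1 : MemLp (fun p => v (p + b + a) - v (p + b)) 2 volume :=
        memLp_comp_add ((memLp_comp_add hv a).sub hv) b
      have m2 : MemLp (fun p => v (p + b) - v p) 2 volume := (memLp_comp_add hv b).sub hv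
      have h2 : ∫ p, (v (p + toCylinder d L (EuclideanSpace.single j (w j) +
          ∑ i ∈ S, EuclideanSpace.single i (w i))) - v p) ^ 2 ≤
          ∫ p, (2 * (v (p + b + a) - v (p + b)) ^ 2 + 2 * (v (p + b) - v p) ^ 2) := by
        refine integral_mono_of_nonneg (Eventually.of_forall fun p => sq_nonneg _)
          ((m1.integrable_sq.const_mul 2).add (m2.integrable_sq.const_mul 2))
          (Eventually.of_forall fun p => ?_)
        simp only [toCylinder_add, ← ha, ← hb]
        have : p + (a + b) = p + b + a := by abel
        rw [this]
        nlinarith [sq_nonneg ((v (p + b + a) - v (p + b)) - (v (p + b) - v p))]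
      rw [integral_add (m1.integrable_sq.const_mul 2) (m2.integrable_sq.const_mul 2),
        integral_const_mul, integral_const_mul] at h2
      have hs : 0 ≤ ∑ i ∈ S, w i ^ 2 * ∫ p, g i p ^ 2 :=
        Finset.sum_nonneg fun i _ => mul_nonneg (sq_nonneg _) (hI i)
      have h3 : (1 : ℝ) ≤ 2 ^ S.card := one_le_pow₀ (by norm_num)
      have h4 : 0 ≤ w j ^ 2 * ∫ p, g j p ^ 2 := mul_nonneg (sq_nonneg _) (hI j)
      rw [pow_succ]
      nlinarith [mul_le_mul_of_nonneg_right h3 h4]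
  have hw : ∑ i, EuclideanSpace.single i (w i) = w := by
    ext j
    simp [Finset.sum_apply]
  have h1 := key Finset.univ
  rw [hw, Finset.card_univ, Fintype.card_fin] at h1
  refine h1.trans ?_
  rw [mul_assoc]
  refine mul_le_mul_of_nonneg_left ?_ (by positivity)
  rw [Finset.mul_sum]
  refine Finset.sum_le_sum fun i _ => mul_le_mul_of_nonneg_right ?_ (hI i)
  · rw [EuclideanSpace.real_norm_sq_eq]
    exact Finset.single_le_sum (f := fun i => w i ^ 2) (fun i _ => sq_nonneg _) (Finset.mem_univ i)

end Duality

/-! ### One-dimensional mollifiers whose dyadic differences are high order derivatives -/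

section Mollifiers

/-- A smooth function vanishing on the negative axis and equal to `x ^ m / m!` for `x ≥ 1`. -/
def smoothMonomial (m : ℕ) (x : ℝ) : ℝ := Real.smoothTransition x * ((m.factorial : ℝ)⁻¹ * x ^ m)

theorem contDiff_smoothMonomial (m : ℕ) : ContDiff ℝ ∞ (smoothMonomial m) :=
  Real.smoothTransition.contDiff.mul (contDiff_const.mul (contDiff_id.pow m))

theorem smoothMonomial_of_nonpos {m : ℕ} {x : ℝ} (hx : x ≤ 0) : smoothMonomial m x = 0 := by
  simp [smoothMonomial, Real.smoothTransition.zero_of_nonpos hx]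

theorem smoothMonomial_of_one_le {m : ℕ} {x : ℝ} (hx : 1 ≤ x) :
    smoothMonomial m x = (m.factorial : ℝ)⁻¹ * x ^ m := by
  simp [smoothMonomial, Real.smoothTransition.one_of_one_le hx]

theorem iteratedDeriv_smoothMonomial_of_neg {m n : ℕ} {x : ℝ} (hx : x < 0) :
    iteratedDeriv n (smoothMonomial m) x = 0 := by
  have : smoothMonomial m =ᶠ[𝓝 x] fun _ => 0 := by
    filter_upwards [Iio_mem_nhds hx] with y hy using smoothMonomial_of_nonpos (le_of_lt hy)
  rw [this.iteratedDeriv_eq]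
  simp

theorem iteratedDeriv_smoothMonomial_of_one_lt {m n : ℕ} {x : ℝ} (hx : 1 < x) :
    iteratedDeriv n (smoothMonomial m) x =
      (m.factorial : ℝ)⁻¹ * ((m.descFactorial n : ℝ) * x ^ (m - n)) := by
  have : smoothMonomial m =ᶠ[𝓝 x] fun y => (m.factorial : ℝ)⁻¹ * y ^ m := by
    filter_upwards [Ioi_mem_nhds hx] with y hy using smoothMonomial_of_one_le (le_of_lt hy)
  rw [this.iteratedDeriv_eq, iteratedDeriv_const_mul_field, iteratedDeriv_pow]

theorem exists_mollifier {k : ℕ} (hk : 1 ≤ k) :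
    ∃ η θ : ℝ → ℝ, ContDiff ℝ ∞ η ∧ ContDiff ℝ ∞ θ ∧ (∀ x, η x ≠ 0 → x ∈ Icc (0 : ℝ) 1) ∧
      (∀ x, θ x ≠ 0 → x ∈ Icc (0 : ℝ) 1) ∧ ∫ x, η x = 1 ∧
      ∀ x, iteratedDeriv k θ x = 2 * η (2 * x) - η x := by
  obtain ⟨m, rfl⟩ : ∃ m, k = m + 1 := ⟨k - 1, by omega⟩
  have hH := contDiff_smoothMonomial m
  have hHn : ∀ n, ContDiff ℝ ∞ (iteratedDeriv n (smoothMonomial m)) := fun n => by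
    rw [iteratedDeriv_eq_iterate]; exact hH.iterate_deriv n
  have hsupp : ∀ x, iteratedDeriv (m + 1) (smoothMonomial m) x ≠ 0 → x ∈ Icc (0 : ℝ) 1 := by
    intro x hx
    by_contra hc
    apply hx
    rw [mem_Icc, not_and_or, not_le, not_le] at hc
    rcases hc with hc | hc
    · exact iteratedDeriv_smoothMonomial_of_neg hc
    · rw [iteratedDeriv_smoothMonomial_of_one_lt hc, Nat.descFactorial_of_lt (by omega)]
      simp
  refine ⟨iteratedDeriv (m + 1) (smoothMonomial m),
    fun x => (1 / 2) ^ m * smoothMonomial m (2 * x) - smoothMonomial m x, hHn _, ?_, hsupp, ?_, ?_,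
    ?_⟩
  · exact (contDiff_const.mul (hH.comp (contDiff_const.mul contDiff_id))).sub hH
  · intro x hx
    by_contra hc
    apply hx
    beta_reduce
    rw [mem_Icc, not_and_or, not_le, not_le] at hc
    rcases hc with hc | hc
    · rw [smoothMonomial_of_nonpos (by linarith), smoothMonomial_of_nonpos hc.le]; simp
    · rw [smoothMonomial_of_one_le (by linarith), smoothMonomial_of_one_le hc.le, mul_pow]
      have : (1 / 2 : ℝ) ^ m * 2 ^ m = 1 := by rw [← mul_pow]; norm_num
      linear_combination ((m.factorial : ℝ)⁻¹ * x ^ m) * this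
  · have h1 : Function.support (iteratedDeriv (m + 1) (smoothMonomial m)) ⊆ Ioc (-1) 2 := by
      intro x hx
      have := hsupp x hx
      exact ⟨by linarith [this.1], by linarith [this.2]⟩
    rw [← intervalIntegral.integral_eq_integral_of_support_subset h1, iteratedDeriv_succ,
      intervalIntegral.integral_deriv_eq_sub
        (fun x _ => ((hHn m).differentiable (by simp)).differentiableAt)
        ((((contDiff_infty_iff_deriv.1 (hHn m)).2).continuous).intervalIntegrable _ _),
      iteratedDeriv_smoothMonomial_of_neg (x := -1) (by norm_num),
      iteratedDeriv_smoothMonomial_of_one_lt (x := 2) (by norm_num), Nat.descFactorial_self]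
    have : (m.factorial : ℝ) ≠ 0 := by positivity
    simp [this]
  · intro x
    have hc : ContDiff ℝ (m + 1 : ℕ) (smoothMonomial m) := hH.of_le (by exact_mod_cast le_top)
    have h2 : ContDiff ℝ (m + 1 : ℕ) fun x => (1 / 2) ^ m * smoothMonomial m (2 * x) :=
      contDiff_const.mul (hc.comp (contDiff_const.mul contDiff_id))
    have h3 := iteratedDeriv_sub (n := m + 1) (h2.contDiffAt (x := x)) (hc.contDiffAt (x := x))
    have h4 := congrFun (iteratedDeriv_comp_const_mul hc 2) x
    refine h3.trans ?_
    rw [iteratedDeriv_const_mul_field, h4, pow_succ]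
    have : (1 / 2 : ℝ) ^ m * 2 ^ m = 1 := by rw [← mul_pow]; norm_num
    linear_combination (2 * iteratedDeriv (m + 1) (smoothMonomial m) (2 * x)) * this

end Mollifiers

/-! ### Tensor product kernels -/

section Tensor

variable {d : ℕ} {L : ℝ}

/-- The tensor product of functions of one variable. -/
def tensorKernel (f : Fin (d + 1) → ℝ → ℝ) (z : Space d) : ℝ := ∏ i, f i (z i)

/-- The cube `[0, R]^D`. -/
def cube (d : ℕ) (R : ℝ) : Set (Space d) := {z | ∀ i, z i ∈ Icc 0 R}

theorem cube_eq_preimage (R : ℝ) :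
    cube d R = WithLp.ofLp ⁻¹' (univ.pi fun _ : Fin (d + 1) => Icc (0 : ℝ) R) := by
  ext z; simp only [cube, mem_ofPred_eq, mem_preimage, mem_univ_pi]

theorem isCompact_cube (R : ℝ) : IsCompact (cube d R) := by
  have h1 : IsCompact (univ.pi fun _ : Fin (d + 1) => Icc (0 : ℝ) R) :=
    isCompact_univ_pi fun _ => isCompact_Icc
  have h2 : cube d R = WithLp.toLp 2 '' (univ.pi fun _ : Fin (d + 1) => Icc (0 : ℝ) R) := by
    rw [cube_eq_preimage]
    ext z
    constructor
    · intro hz; exact ⟨_, hz, rfl⟩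
    · rintro ⟨y, hy, rfl⟩; exact hy
  rw [h2]
  exact h1.image (PiLp.continuous_toLp 2 _)

theorem volume_cube {R : ℝ} (hR : 0 ≤ R) : volume (cube d R) = ENNReal.ofReal (R ^ (d + 1)) := by
  rw [cube_eq_preimage, (PiLp.volume_preserving_ofLp (Fin (d + 1))).measure_preimage
    (MeasurableSet.univ_pi fun _ => measurableSet_Icc).nullMeasurableSet, volume_pi, Measure.pi_pi]
  simp [ENNReal.ofReal_pow hR]

theorem norm_le_of_mem_cube {R : ℝ} {z : Space d} (hz : z ∈ cube d R) :
    ‖z‖ ≤ (d + 1) * R := by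
  have hR : 0 ≤ R := (hz 0).1.trans (hz 0).2
  refine abs_le_of_sq_le_sq' ?_ (by positivity) |>.2
  rw [EuclideanSpace.real_norm_sq_eq]
  calc ∑ i, z i ^ 2 ≤ ∑ _i : Fin (d + 1), R ^ 2 :=
        Finset.sum_le_sum fun i _ => pow_le_pow_left₀ (hz i).1 (hz i).2 2
    _ = (d + 1) * R ^ 2 := by simp
    _ ≤ ((d + 1) * R) ^ 2 := by
        have : (0 : ℝ) ≤ d := d.cast_nonneg
        nlinarith [sq_nonneg R, mul_nonneg this (sq_nonneg R), mul_nonneg this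
          (mul_nonneg this (sq_nonneg R))]

theorem tensorKernel_ne_zero {f : Fin (d + 1) → ℝ → ℝ} {R : ℝ}
    (hf : ∀ i x, f i x ≠ 0 → x ∈ Icc 0 R) {z : Space d} (hz : tensorKernel f z ≠ 0) :
    z ∈ cube d R := fun i => hf i _ ((Finset.prod_ne_zero_iff.1 hz) i (Finset.mem_univ i))

theorem isSmoothKernel_tensorKernel {f : Fin (d + 1) → ℝ → ℝ} {R : ℝ}
    (hf : ∀ i x, f i x ≠ 0 → x ∈ Icc 0 R) (hs : ∀ i, ContDiff ℝ ∞ (f i)) :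
    IsSmoothKernel (tensorKernel f) := by
  constructor
  · exact contDiff_prod fun i _ => (hs i).comp (by fun_prop)
  · refine HasCompactSupport.intro (isCompact_cube R) fun z hz => ?_
    by_contra hc
    exact hz (tensorKernel_ne_zero hf hc)

theorem kernelDeriv_tensorKernel {f : Fin (d + 1) → ℝ → ℝ} (hs : ∀ i, ContDiff ℝ ∞ (f i))
    (j : Fin (d + 1)) :
    kernelDeriv j (tensorKernel f) = tensorKernel (Function.update f j (deriv (f j))) := by
  ext z
  have hd : Differentiable ℝ (tensorKernel f) := by
    have : ContDiff ℝ ∞ (tensorKernel f) := contDiff_prod fun i _ => (hs i).comp (by fun_prop)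
    exact this.differentiable (by simp)
  have h1 : HasDerivAt (fun t : ℝ => z + t • (EuclideanSpace.single j 1 : Space d))
      (EuclideanSpace.single j 1) 0 := by
    simpa using ((hasDerivAt_id (0 : ℝ)).smul_const
      (EuclideanSpace.single j 1 : Space d)).const_add z
  have h2 := (hd (z + (0 : ℝ) • (EuclideanSpace.single j 1 : Space d))).hasFDerivAt.comp_hasDerivAt
    (0 : ℝ) h1
  have h3 : (tensorKernel f ∘ fun t : ℝ => z + t • (EuclideanSpace.single j 1 : Space d)) =
      fun t => f j (z j + t) * ∏ i ∈ Finset.univ.erase j, f i (z i) := by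
    ext t
    simp only [Function.comp_apply, tensorKernel]
    rw [← Finset.mul_prod_erase _ _ (Finset.mem_univ j)]
    congr 1
    · simp
    · refine Finset.prod_congr rfl fun i hi => ?_
      simp [Finset.ne_of_mem_erase hi]
  have h4 : HasDerivAt (fun t => f j (z j + t) * ∏ i ∈ Finset.univ.erase j, f i (z i))
      (deriv (f j) (z j) * ∏ i ∈ Finset.univ.erase j, f i (z i)) 0 := by
    refine HasDerivAt.mul_const ?_ _
    have := (((hs j).differentiable (by simp)) (z j + 0)).hasDerivAt.scomp (0 : ℝ)
      ((hasDerivAt_id (0 : ℝ)).const_add (z j))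
    simpa [Function.comp_def] using this
  rw [h3] at h2
  have h5 := h2.unique h4
  simp only [zero_smul, add_zero] at h5
  rw [kernelDeriv, h5, tensorKernel, ← Finset.mul_prod_erase _ _ (Finset.mem_univ j)]
  congr 1
  · simp
  · refine Finset.prod_congr rfl fun i hi => ?_
    rw [Function.update_of_ne (Finset.ne_of_mem_erase hi)]

theorem iterate_kernelDeriv_tensorKernel {f : Fin (d + 1) → ℝ → ℝ}
    (hs : ∀ i, ContDiff ℝ ∞ (f i)) (j : Fin (d + 1)) (k : ℕ) :
    (kernelDeriv j)^[k] (tensorKernel f) =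
      tensorKernel (Function.update f j (iteratedDeriv k (f j))) := by
  induction k with
  | zero => simp
  | succ k ih =>
    rw [Function.iterate_succ_apply', ih, kernelDeriv_tensorKernel]
    · simp [iteratedDeriv_succ]
    · intro i
      by_cases hi : i = j
      · subst hi
        simp only [Function.update_self]
        rw [iteratedDeriv_eq_iterate]
        exact (hs i).iterate_deriv k
      · rw [Function.update_of_ne hi]; exact hs i

theorem integral_tensorKernel (f : Fin (d + 1) → ℝ → ℝ) :
    ∫ z, tensorKernel f z = ∏ i, ∫ x, f i x := by
  rw [← integral_fintype_prod_volume_eq_prod f]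
  exact (PiLp.volume_preserving_ofLp (Fin (d + 1))).integral_comp
    (MeasurableEquiv.toLp 2 (Fin (d + 1) → ℝ)).symm.measurableEmbedding
    (fun y : Fin (d + 1) → ℝ => ∏ i, f i (y i))

theorem abs_tensorKernel_le {f : Fin (d + 1) → ℝ → ℝ} {j : Fin (d + 1)} {A B : ℝ}
    (hj : ∀ x, |f j x| ≤ B) (hf : ∀ i, i ≠ j → ∀ x, |f i x| ≤ A) (z : Space d) :
    |tensorKernel f z| ≤ B * A ^ d := by
  have hB : 0 ≤ B := (abs_nonneg _).trans (hj 0)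
  rw [tensorKernel, Finset.abs_prod, ← Finset.mul_prod_erase _ _ (Finset.mem_univ j)]
  gcongr
  · exact hj _
  · refine (Finset.prod_le_prod (fun i _ => abs_nonneg _)
      fun i hi => hf i (Finset.ne_of_mem_erase hi) _).trans_eq ?_
    simp

variable [Fact (0 < L)]

/-- Pointwise bound for the convolution with a bounded kernel supported in a small cube. -/
theorem abs_cylConv_le_of_cube {K : Space d → ℝ} {M R : ℝ} (hM : 0 ≤ M) (hR : 0 ≤ R)
    (hRL : 2 * R ≤ L) (hK : ∀ z, |K z| ≤ M) (hKR : ∀ z, K z ≠ 0 → z ∈ cube d R)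
    {g : Cylinder d L → ℝ} (hg : MemLp g 2 volume) (p : Cylinder d L) :
    cylConv K g p ^ 2 ≤ M ^ 2 * R ^ (d + 1) * ∫ q, g q ^ 2 := by
  have hI : 0 ≤ ∫ q, g q ^ 2 := integral_nonneg fun p => sq_nonneg _
  have hL : 0 < L := Fact.out
  have hsub : cube d R ⊆ strip d L fun _ => -(L / 2) := by
    intro z hz j
    have := hz j.succ
    constructor <;> linarith [this.1, this.2]
  have hcube := (isCompact_cube (d := d) R).measurableSet
  have hgm : AEMeasurable (fun z : Space d => ‖g (p - toCylinder d L z)‖ₑ) volume :=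
    (hg.1.comp_quasiMeasurePreserving (quasiMeasurePreserving_sub_toCylinder p)).enorm
  have h1 : ‖cylConv K g p‖ₑ ≤ ENNReal.ofReal M *
      ∫⁻ z in cube d R, 1 * ‖g (p - toCylinder d L z)‖ₑ := by
    refine (enorm_cylConv_le K g p).trans ?_
    rw [← lintegral_const_mul'' _ (by simpa using hgm.restrict), ← lintegral_indicator hcube]
    refine lintegral_mono fun z => ?_
    by_cases hz : K z = 0
    · simp [hz]
    · rw [indicator_of_mem (hKR z hz), one_mul]
      gcongr
      rw [← ofReal_norm]
      exact ENNReal.ofReal_le_ofReal (hK z)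
  have h2 := ENNReal_sq_lintegral_mul_le (μ := volume.restrict (cube d R)) (f := fun _ => 1)
    aemeasurable_const hgm.restrict
  have h3 : ∫⁻ z in cube d R, ‖g (p - toCylinder d L z)‖ₑ ^ 2 ≤ ∫⁻ q, ‖g q‖ₑ ^ 2 := by
    rw [← lintegral_strip_sub (fun _ => -(L / 2)) p (g := fun q => ‖g q‖ₑ ^ 2)
      (hg.1.enorm.pow_const 2)]
    exact lintegral_mono_set hsub
  have h4 : ‖cylConv K g p‖ₑ ^ 2 ≤ ENNReal.ofReal (M ^ 2 * R ^ (d + 1) * ∫ q, g q ^ 2) := by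
    calc ‖cylConv K g p‖ₑ ^ 2
        ≤ (ENNReal.ofReal M * ∫⁻ z in cube d R, 1 * ‖g (p - toCylinder d L z)‖ₑ) ^ 2 := by gcongr
      _ ≤ ENNReal.ofReal M ^ 2 * ((∫⁻ _z in cube d R, 1 ^ 2) *
            ∫⁻ z in cube d R, ‖g (p - toCylinder d L z)‖ₑ ^ 2) := by
          rw [mul_pow]; gcongr
      _ ≤ ENNReal.ofReal M ^ 2 * (ENNReal.ofReal (R ^ (d + 1)) * ∫⁻ q, ‖g q‖ₑ ^ 2) := by
          gcongr
          simp [volume_cube hR]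
      _ = _ := by
          rw [← ofReal_integral_sq hg, ENNReal.ofReal_mul (by positivity),
            ENNReal.ofReal_mul (by positivity), ENNReal.ofReal_pow hM, mul_assoc]
  rw [← ofReal_norm, ← ENNReal.ofReal_pow (norm_nonneg _),
    ENNReal.ofReal_le_ofReal_iff (by positivity)] at h4
  simpa using h4

end Tensor

/-! ### The Sobolev embedding -/

section Sobolev

variable {d : ℕ} {L : ℝ}

theorem tensorKernel_sub_tensorKernel (a b θ : ℝ → ℝ) (z : Space d) :
    tensorKernel (fun _ => b) z - tensorKernel (fun _ => a) z =
      ∑ j, tensorKernel (Function.update (fun i => if i < j then b else if i = j then θ else a) j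
        (fun x => b x - a x)) z := by
  have h := Finset.prod_sub_ordered (Finset.univ : Finset (Fin (d + 1))) (fun i => a (z i))
    (fun i => a (z i) - b (z i))
  simp only [sub_sub_cancel] at h
  simp only [tensorKernel]
  rw [h, sub_sub_cancel_left, ← Finset.sum_neg_distrib]
  refine Finset.sum_congr rfl fun j _ => ?_
  rw [Finset.prod_filter, Finset.prod_filter, ← neg_mul, ← neg_mul, neg_sub]
  have e : b (z j) - a (z j) = ∏ i, if i = j then b (z i) - a (z i) else 1 := by
    rw [Finset.prod_ite_eq' Finset.univ j]; simp
  rw [e, ← Finset.prod_mul_distrib, ← Finset.prod_mul_distrib]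
  refine Finset.prod_congr rfl fun i _ => ?_
  rcases lt_trichotomy i j with hij | hij | hij
  · rw [Function.update_of_ne hij.ne]; simp [hij, hij.ne, hij.not_gt]
  · subst hij; simp
  · rw [Function.update_of_ne hij.ne']; simp [hij, hij.ne', hij.not_gt]

variable [Fact (0 < L)]

/-- Functions whose pure derivatives of high order are square integrable are bounded. -/
theorem exists_sobolev_bound {k : ℕ} (hk : d + 3 ≤ 2 * k) :
    ∃ C : ℝ, 0 ≤ C ∧ ∀ (v : Cylinder d L → ℝ) (g : Fin (d + 1) → Cylinder d L → ℝ),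
      MemLp v 2 volume → (∀ j, MemLp (g j) 2 volume) →
      (∀ j, HasWeakDeriv (Pi.single j k) v (g j)) →
      ∀ᵐ p, |v p| ≤ C * ((eLpNorm v 2 volume).toReal + ∑ j, (eLpNorm (g j) 2 volume).toReal) := by
  have hL : 0 < L := Fact.out
  obtain ⟨η, θ, hη, hθ, hηs, hθs, hη1, hD⟩ := exists_mollifier (k := k) (by omega)
  obtain ⟨C₀, hC1, hηC, hθC⟩ : ∃ C₀ : ℝ, 1 ≤ C₀ ∧ (∀ x, |η x| ≤ C₀) ∧ ∀ x, |θ x| ≤ C₀ := by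
    have hcs : ∀ f : ℝ → ℝ, (∀ x, f x ≠ 0 → x ∈ Icc (0 : ℝ) 1) → HasCompactSupport f :=
      fun f hf => HasCompactSupport.intro isCompact_Icc fun x hx => by
        by_contra hc; exact hx (hf x hc)
    obtain ⟨A, hA⟩ := (hcs η hηs).exists_bound_of_continuous hη.continuous
    obtain ⟨B, hB⟩ := (hcs θ hθs).exists_bound_of_continuous hθ.continuous
    exact ⟨max 1 (max A B), le_max_left _ _,
      fun x => (hA x).trans ((le_max_left A B).trans (le_max_right _ _)),
      fun x => (hB x).trans ((le_max_right A B).trans (le_max_right _ _))⟩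
  have hC0 : 0 < C₀ := by linarith
  -- rescaled profiles
  let ηs : ℝ → ℝ → ℝ := fun l x => l * η (l * x)
  let θs : ℝ → ℝ → ℝ := fun l x => (l ^ (k - 1))⁻¹ * θ (l * x)
  have hηss : ∀ l, ContDiff ℝ ∞ (ηs l) := fun l =>
    contDiff_const.mul (hη.comp (contDiff_const.mul contDiff_id))
  have hθss : ∀ l, ContDiff ℝ ∞ (θs l) := fun l =>
    contDiff_const.mul (hθ.comp (contDiff_const.mul contDiff_id))
  have hmem : ∀ {l x : ℝ}, 0 < l → l * x ∈ Icc (0 : ℝ) 1 → x ∈ Icc (0 : ℝ) (1 / l) := by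
    intro l x hl hx
    refine ⟨by by_contra hc; push Not at hc; nlinarith [hx.1], ?_⟩
    rw [le_div_iff₀ hl]; linarith [hx.2]
  have hηsupp : ∀ {l x : ℝ}, 0 < l → ηs l x ≠ 0 → x ∈ Icc (0 : ℝ) (1 / l) := fun hl hx =>
    hmem hl (hηs _ (right_ne_zero_of_mul hx))
  have hθsupp : ∀ {l x : ℝ}, 0 < l → θs l x ≠ 0 → x ∈ Icc (0 : ℝ) (1 / l) := fun hl hx =>
    hmem hl (hθs _ (right_ne_zero_of_mul hx))
  have hDs : ∀ {l : ℝ}, 0 < l → iteratedDeriv k (θs l) = fun x => ηs (2 * l) x - ηs l x := by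
    intro l hl
    ext x
    have hc : ContDiff ℝ k θ := hθ.of_le (by exact_mod_cast le_top)
    have h4 := congrFun (iteratedDeriv_comp_const_mul hc l) x
    simp only [θs, ηs]
    rw [iteratedDeriv_const_mul_field, h4, hD]
    obtain ⟨m, rfl⟩ : ∃ m, k = m + 1 := ⟨k - 1, by omega⟩
    have : (l ^ m)⁻¹ * l ^ m = 1 := inv_mul_cancel₀ (by positivity)
    rw [Nat.add_sub_cancel, pow_succ, ← mul_assoc 2 l x]
    linear_combination (l * (2 * η (2 * l * x) - η (l * x))) * this
  have hηint : ∀ {l : ℝ}, 0 < l → ∫ x, ηs l x = 1 := by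
    intro l hl
    simp only [ηs]
    rw [integral_const_mul, Measure.integral_comp_mul_left η l, hη1, smul_eq_mul, mul_one,
      abs_of_pos (by positivity), mul_inv_cancel₀ hl.ne']
  have hηb : ∀ {l : ℝ}, 0 < l → ∀ x, |ηs l x| ≤ l * C₀ := by
    intro l hl x
    simp only [ηs]
    rw [abs_mul, abs_of_pos hl]
    gcongr
    exact hηC _
  have hθb : ∀ {l : ℝ}, 0 < l → ∀ x, |θs l x| ≤ (l ^ (k - 1))⁻¹ * C₀ := by
    intro l hl x
    simp only [θs]
    rw [abs_mul, abs_of_pos (by positivity)]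
    gcongr
    exact hθC _
  -- the scales
  let l0 : ℝ := max 1 (2 / L)
  have hl01 : 1 ≤ l0 := le_max_left _ _
  have hl0 : 0 < l0 := by linarith
  have hl0L : 2 * (1 / l0) ≤ L := by
    have : 2 / L ≤ l0 := le_max_right _ _
    rw [div_le_iff₀ hL] at this
    rw [mul_one_div, div_le_iff₀ hl0]; linarith
  let l : ℕ → ℝ := fun n => l0 * 2 ^ n
  have hl : ∀ n, 0 < l n := fun n => by positivity
  have hl2 : ∀ n, (2 : ℝ) ^ n ≤ l n := fun n => le_mul_of_one_le_left (by positivity) hl01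
  have hl0n : ∀ n, l0 ≤ l n := fun n => le_mul_of_one_le_right hl0.le (one_le_pow₀ (by norm_num))
  have hlL : ∀ n, 2 * (1 / l n) ≤ L := fun n =>
    le_trans (by gcongr; exact hl0n n) hl0L
  have hls : ∀ n, l (n + 1) = 2 * l n := fun n => by simp only [l]; ring
  let ρ : ℕ → Space d → ℝ := fun n => tensorKernel fun _ => ηs (l n)
  let F : ℕ → Fin (d + 1) → Fin (d + 1) → ℝ → ℝ := fun n j i =>
    if i < j then ηs (l (n + 1)) else if i = j then θs (l n) else ηs (l n)
  have hFs : ∀ n j i, ContDiff ℝ ∞ (F n j i) := by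
    intro n j i
    simp only [F]
    split_ifs
    exacts [hηss _, hθss _, hηss _]
  have hFsupp : ∀ n j i x, F n j i x ≠ 0 → x ∈ Icc (0 : ℝ) (1 / l n) := by
    intro n j i x
    simp only [F]
    split_ifs
    · intro hx
      have := hηsupp (hl (n + 1)) hx
      refine ⟨this.1, this.2.trans ?_⟩
      rw [hls]
      gcongr
      linarith [hl n]
    exacts [hθsupp (hl n), hηsupp (hl n)]
  have hρsupp : ∀ n z, ρ n z ≠ 0 → z ∈ cube d (1 / l n) := fun n z hz =>
    tensorKernel_ne_zero (fun _ _ h => hηsupp (hl n) h) hz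
  have hρsm : ∀ n, IsSmoothKernel (ρ n) := fun n =>
    isSmoothKernel_tensorKernel (fun _ _ h => hηsupp (hl n) h) fun _ => hηss _
  have hΘsm : ∀ n j, IsSmoothKernel (tensorKernel (F n j)) := fun n j =>
    isSmoothKernel_tensorKernel (hFsupp n j) (hFs n j)
  have hρb : ∀ n z, |ρ n z| ≤ (l n * C₀) ^ (d + 1) := by
    intro n z
    refine (abs_tensorKernel_le (j := 0) (hηb (hl n)) (fun _ _ => hηb (hl n)) z).trans_eq ?_
    ring
  have hΘb : ∀ n j z, |tensorKernel (F n j) z| ≤ (l n ^ (k - 1))⁻¹ * C₀ * (2 * l n * C₀) ^ d := by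
    intro n j z
    have h0 := hl n
    refine abs_tensorKernel_le (j := j) ?_ ?_ z
    · simpa [F] using hθb (hl n)
    · intro i hi x
      simp only [F, hi, if_false]
      split_ifs
      · have := hηb (hl (n + 1)) x
        rwa [hls] at this ⊢
      · refine (hηb (hl n) x).trans ?_
        gcongr; linarith
  have htel : ∀ n z, ρ (n + 1) z = ρ n z + ∑ j, (kernelDeriv j)^[k] (tensorKernel (F n j)) z := by
    intro n z
    have h1 := tensorKernel_sub_tensorKernel (ηs (l n)) (ηs (l (n + 1))) (θs (l n)) z
    rw [sub_eq_iff_eq_add'] at h1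
    simp only [ρ]
    rw [h1]
    congr 1
    refine Finset.sum_congr rfl fun j _ => ?_
    rw [iterate_kernelDeriv_tensorKernel (hFs n j)]
    have : iteratedDeriv k (F n j j) = fun x => ηs (l (n + 1)) x - ηs (l n) x := by
      simp only [F, lt_irrefl, if_false, if_true]
      rw [hDs (hl n), hls]
    rw [this]
  -- the constants
  set A : ℝ := C₀ * (2 * C₀) ^ d with hA
  have hA0 : 0 ≤ A := by positivity
  refine ⟨(l0 * C₀) ^ (d + 1) + 2 * A, by positivity, fun v g hv hg hw => ?_⟩
  set N : (Cylinder d L → ℝ) → ℝ := fun g => (eLpNorm g 2 volume).toReal with hN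
  have hN0 : ∀ g, 0 ≤ N g := fun g => ENNReal.toReal_nonneg
  have hbase : ∀ p, |cylConv (ρ 0) v p| ≤ (l0 * C₀) ^ (d + 1) * N v := by
    intro p
    have h1 := abs_cylConv_le_of_cube (M := (l0 * C₀) ^ (d + 1)) (R := 1 / l0) (by positivity)
      (by positivity) hl0L (by simpa [l] using hρb 0) (by simpa [l] using hρsupp 0) hv p
    refine abs_le_of_sq_le_sq (h1.trans ?_) (by have := hN0 v; positivity)
    rw [mul_pow _ (N v), hN]
    beta_reduce
    rw [eLpNorm_toReal_sq hv]
    refine mul_le_mul_of_nonneg_right ?_ (integral_nonneg fun p => sq_nonneg _)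
    refine mul_le_of_le_one_right (by positivity) (pow_le_one₀ (by positivity) ?_)
    rw [div_le_one hl0]; exact hl01
  have hstep : ∀ n j p, |cylConv (tensorKernel (F n j)) (g j) p| ≤ A * (1 / 2) ^ n * N (g j) := by
    intro n j p
    have h0 := hl n
    have h1 := abs_cylConv_le_of_cube (by positivity) (by positivity) (hlL n) (hΘb n j)
      (fun z hz => tensorKernel_ne_zero (hFsupp n j) hz) (hg j) p
    refine abs_le_of_sq_le_sq (h1.trans ?_) (by have := hN0 (g j); positivity)
    rw [mul_pow _ (N (g j)), hN]
    beta_reduce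
    rw [eLpNorm_toReal_sq (hg j)]
    refine mul_le_mul_of_nonneg_right ?_ (integral_nonneg fun p => sq_nonneg _)
    have h1n : 1 ≤ l n := hl01.trans (hl0n n)
    have e1 : ((l n ^ (k - 1))⁻¹ * C₀ * (2 * l n * C₀) ^ d) ^ 2 * (1 / l n) ^ (d + 1) =
        A ^ 2 * (l n ^ (2 * d) / (l n ^ (2 * (k - 1)) * l n ^ (d + 1))) := by
      rw [hA, show 2 * l n * C₀ = (2 * C₀) * l n by ring, mul_pow (2 * C₀) (l n) d, one_div,
        inv_pow, pow_mul' (l n) 2 d, pow_mul' (l n) 2 (k - 1)]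
      field_simp
    rw [e1, mul_pow A]
    refine mul_le_mul_of_nonneg_left ?_ (sq_nonneg A)
    rw [div_le_iff₀ (by positivity), ← pow_add]
    have e2 : (2 : ℝ) ^ n * 2 ^ n * l n ^ (2 * d) ≤ l n ^ (2 * (k - 1) + (d + 1)) := by
      calc (2 : ℝ) ^ n * 2 ^ n * l n ^ (2 * d) ≤ l n * l n * l n ^ (2 * d) := by
            gcongr <;> exact hl2 n
        _ = l n ^ (2 * d + 2) := by ring
        _ ≤ _ := pow_le_pow_right₀ h1n (by omega)
    have e3 : ((1 / 2 : ℝ) ^ n) ^ 2 * (2 ^ n * 2 ^ n) = 1 := by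
      rw [sq, mul_mul_mul_comm, ← mul_pow]; norm_num
    calc l n ^ (2 * d) = ((1 / 2 : ℝ) ^ n) ^ 2 * (2 ^ n * 2 ^ n * l n ^ (2 * d)) := by
          rw [← mul_assoc, e3, one_mul]
      _ ≤ _ := by gcongr
  have hrec : ∀ᵐ p, ∀ n, cylConv (ρ (n + 1)) v p =
      cylConv (ρ n) v p + ∑ j, cylConv (tensorKernel (F n j)) (g j) p := by
    rw [ae_all_iff]
    intro n
    have hik : ∀ j, Integrable ((kernelDeriv j)^[k] (tensorKernel (F n j))) := fun j =>
      (iterate_kernelDeriv_isSmoothKernel (hΘsm n j) j k).integrable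
    have h1 : ∀ᵐ p, ∀ j, cylConv ((kernelDeriv j)^[k] (tensorKernel (F n j))) v p =
        cylConv (tensorKernel (F n j)) (g j) p :=
      ae_all_iff.2 fun j => cylConv_iterate_kernelDeriv (hΘsm n j) hv (hg j) (hw j)
    have h2 : ∀ᵐ p : Cylinder d L, ∀ j, Integrable fun z =>
        (kernelDeriv j)^[k] (tensorKernel (F n j)) z * v (p - toCylinder d L z) :=
      ae_all_iff.2 fun j => ae_integrable_cylConv (hik j) hv
    filter_upwards [h1, h2, ae_integrable_cylConv (hρsm n).integrable hv] with p h1 h2 h3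
    rw [← Finset.sum_congr rfl fun j _ => h1 j]
    simp only [cylConv]
    rw [← integral_finsetSum _ fun j _ => h2 j, ← integral_add h3
      (integrable_finsetSum _ fun j _ => h2 j)]
    congr 1; ext z
    rw [htel, add_mul, Finset.sum_mul]
  have hbound : ∀ᵐ p, ∀ n, |cylConv (ρ n) v p| ≤
      ((l0 * C₀) ^ (d + 1) + 2 * A) * (N v + ∑ j, N (g j)) := by
    filter_upwards [hrec] with p hp n
    have hS : 0 ≤ ∑ j, N (g j) := Finset.sum_nonneg fun j _ => hN0 _
    have h1 : |cylConv (ρ n) v p| ≤ (l0 * C₀) ^ (d + 1) * N v +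
        A * (2 - 2 * (1 / 2) ^ n) * ∑ j, N (g j) := by
      induction n with
      | zero => simpa using hbase p
      | succ n ih =>
        rw [hp n]
        have h2 : |∑ j, cylConv (tensorKernel (F n j)) (g j) p| ≤
            A * (1 / 2) ^ n * ∑ j, N (g j) := by
          refine (Finset.abs_sum_le_sum_abs _ _).trans ?_
          rw [Finset.mul_sum]
          exact Finset.sum_le_sum fun j _ => hstep n j p
        refine (abs_add_le _ _).trans ((add_le_add ih h2).trans_eq ?_)
        ring
    have h3 : A * (2 - 2 * (1 / 2) ^ n) * ∑ j, N (g j) ≤ A * 2 * ∑ j, N (g j) := by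
      gcongr
      have : (0 : ℝ) ≤ (1 / 2) ^ n := by positivity
      linarith
    have h4 : 0 ≤ (l0 * C₀) ^ (d + 1) * ∑ j, N (g j) := by positivity
    have h5 : 0 ≤ A * N v := mul_nonneg hA0 (hN0 v)
    linarith
  have hlim := tendsto_cylConv hv (ρ := ρ) (fun n => (hρsm n).integrable)
    (fun n => by
      simp only [ρ]
      rw [integral_tensorKernel]
      simp [hηint (hl n)])
    (C := ENNReal.ofReal (C₀ ^ (d + 1))) (by simp)
    (fun n => by
      have h0 := hl n
      calc ∫⁻ z, ‖ρ n z‖ₑ ≤ ∫⁻ z, (cube d (1 / l n)).indicator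
            (fun _ => ENNReal.ofReal ((l n * C₀) ^ (d + 1))) z := by
            refine lintegral_mono fun z => ?_
            by_cases hz : ρ n z = 0
            · simp [hz]
            · rw [indicator_of_mem (hρsupp n z hz), ← ofReal_norm]
              exact ENNReal.ofReal_le_ofReal (hρb n z)
        _ = ENNReal.ofReal (C₀ ^ (d + 1)) := by
            rw [lintegral_indicator_const (isCompact_cube _).measurableSet,
              volume_cube (by positivity), ← ENNReal.ofReal_mul (by positivity), ← mul_pow]
            congr 2
            field_simp
        _ ≤ _ := le_rfl)
    (r := fun n => (d + 1) * (1 / l n))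
    (by
      have h1 : Tendsto (fun n : ℕ => ((d : ℝ) + 1) * (1 / l0) * (1 / 2 : ℝ) ^ n) atTop
          (𝓝 (((d : ℝ) + 1) * (1 / l0) * 0)) :=
        (tendsto_pow_atTop_nhds_zero_of_lt_one (by norm_num) (by norm_num)).const_mul _
      rw [mul_zero] at h1
      refine h1.congr fun n => ?_
      simp only [l, one_div, mul_inv, inv_pow]
      ring)
    (fun n z hz => norm_le_of_mem_cube (hρsupp n z hz))
  have hlim2 : Tendsto (fun n => eLpNorm (fun p => cylConv (ρ n) v p - v p) 2 volume) atTop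
      (𝓝 0) := by
    have h1 : Tendsto (fun n => (∫⁻ p, ‖cylConv (ρ n) v p - v p‖ₑ ^ 2) ^ (1 / 2 : ℝ)) atTop
        (𝓝 (0 ^ (1 / 2 : ℝ))) := (ENNReal.continuous_rpow_const.tendsto _).comp hlim
    rw [ENNReal.zero_rpow_of_pos (by norm_num)] at h1
    refine h1.congr fun n => ?_
    rw [lintegral_enorm_sq_eq, ← ENNReal.rpow_natCast, ← ENNReal.rpow_mul]
    norm_num
  obtain ⟨ns, -, hns⟩ := (tendstoInMeasure_of_tendsto_eLpNorm (by norm_num)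
    (fun n => (memLp_cylConv (hρsm n).integrable hv).1) hv.1 hlim2).exists_seq_tendsto_ae
  filter_upwards [hns, hbound] with p h1 h2
  exact le_of_tendsto h1.abs (Eventually.of_forall fun i => h2 (ns i))

end Sobolev

/-! ### The projected kernel -/

section Kernel

variable {d : ℕ} {J : Space d → ℝ}

theorem IsKernel.isSmoothKernel (hJ : IsKernel J) : IsSmoothKernel J :=
  ⟨hJ.smooth, hJ.compactSupport⟩

theorem IsKernel.even (hJ : IsKernel J) (z : Space d) : J (-z) = J z :=
  hJ.radial _ _ (norm_neg z)

theorem IsKernel.exists_radius (hJ : IsKernel J) :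
    ∃ R : ℝ, 0 < R ∧ ∀ z, J z ≠ 0 → ‖z‖ ≤ R := by
  obtain ⟨R, hR⟩ := hJ.compactSupport.isCompact.isBounded.exists_norm_le
  exact ⟨max R 1, by positivity, fun z hz => (hR z (subset_tsupport _ hz)).trans (le_max_left _ _)⟩

theorem projKernel_eq (x : ℝ) : projKernel J x = ∫ y, J ((splitEquiv d).symm (x, y)) := by
  simp only [projKernel, splitEquiv_symm_apply]

theorem norm_snd_le (x : ℝ) (y : Fin d → ℝ) : ‖y‖ ≤ ‖(splitEquiv d).symm (x, y)‖ := by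
  rw [pi_norm_le_iff_of_nonneg (norm_nonneg _)]
  intro j
  have := PiLp.norm_apply_le ((splitEquiv d).symm (x, y)) j.succ
  rwa [splitEquiv_symm_apply] at this ⊢

theorem abs_fst_le (x : ℝ) (y : Fin d → ℝ) : |x| ≤ ‖(splitEquiv d).symm (x, y)‖ := by
  have := PiLp.norm_apply_le ((splitEquiv d).symm (x, y)) 0
  rwa [splitEquiv_symm_apply] at this ⊢

theorem continuous_splitEquiv_symm : Continuous (splitEquiv d).symm := by
  have : ⇑(splitEquiv d).symm =
      fun q : ℝ × (Fin d → ℝ) => WithLp.toLp 2 (Fin.cons q.1 q.2 : Fin (d + 1) → ℝ) :=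
    funext fun q => splitEquiv_symm_apply q.1 q.2
  rw [this]
  exact (PiLp.continuous_toLp 2 _).comp (Continuous.finCons continuous_fst continuous_snd)

theorem IsKernel.projKernel_nonneg (hJ : IsKernel J) (x : ℝ) : 0 ≤ projKernel J x :=
  integral_nonneg fun _ => hJ.nonneg _

theorem IsKernel.projKernel_even (hJ : IsKernel J) (x : ℝ) :
    projKernel J (-x) = projKernel J x := by
  simp only [projKernel]
  congr 1; ext y
  refine hJ.radial _ _ ?_
  rw [EuclideanSpace.norm_eq, EuclideanSpace.norm_eq, Fin.sum_univ_succ, Fin.sum_univ_succ]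
  simp

theorem IsKernel.projKernel_eq_zero {R : ℝ} (hR : ∀ z, J z ≠ 0 → ‖z‖ ≤ R) {x : ℝ} (hx : R < |x|) :
    projKernel J x = 0 := by
  rw [projKernel_eq]
  refine integral_eq_zero_of_ae (Eventually.of_forall fun y => ?_)
  by_contra hc
  exact absurd ((abs_fst_le x y).trans (hR _ hc)) (not_le.2 hx)

theorem IsKernel.exists_bound (hJ : IsKernel J) : ∃ C, 0 ≤ C ∧ ∀ z, J z ≤ C := by
  obtain ⟨C, hC⟩ := hJ.compactSupport.exists_bound_of_continuous hJ.smooth.continuous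
  exact ⟨C, (norm_nonneg _).trans (hC 0), fun z => (le_abs_self _).trans (hC z)⟩

theorem IsKernel.exists_slice_bound (hJ : IsKernel J) :
    ∃ b : (Fin d → ℝ) → ℝ, Integrable b ∧ ∀ x y, ‖J ((splitEquiv d).symm (x, y))‖ ≤ b y := by
  obtain ⟨R, -, hR⟩ := hJ.exists_radius
  obtain ⟨C, hC0, hC⟩ := hJ.exists_bound
  refine ⟨(Metric.closedBall 0 R).indicator fun _ => C, ?_, fun x y => ?_⟩
  · exact (integrable_indicator_iff measurableSet_closedBall).2
      (integrableOn_const (isCompact_closedBall _ _).measure_lt_top.ne)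
  · rw [Real.norm_of_nonneg (hJ.nonneg _)]
    by_cases h : J ((splitEquiv d).symm (x, y)) = 0
    · rw [h]; exact indicator_nonneg (fun _ _ => hC0) _
    · rw [indicator_of_mem]
      · exact hC _
      · simpa using (norm_snd_le x y).trans (hR _ h)

theorem IsKernel.continuous_projKernel (hJ : IsKernel J) : Continuous (projKernel J) := by
  obtain ⟨b, hb, hbd⟩ := hJ.exists_slice_bound
  have : projKernel J = fun x => ∫ y, J ((splitEquiv d).symm (x, y)) := funext projKernel_eq
  rw [this]
  refine continuous_of_dominated (fun x => ?_) (fun x => Eventually.of_forall (hbd x)) hb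
    (Eventually.of_forall fun y => ?_)
  · exact (hJ.smooth.continuous.comp (continuous_splitEquiv_symm.comp
      (continuous_const.prodMk continuous_id))).aestronglyMeasurable
  · exact hJ.smooth.continuous.comp (continuous_splitEquiv_symm.comp
      (continuous_id.prodMk continuous_const))

theorem IsKernel.hasCompactSupport_projKernel (hJ : IsKernel J) :
    HasCompactSupport (projKernel J) := by
  obtain ⟨R, -, hR⟩ := hJ.exists_radius
  refine HasCompactSupport.intro (isCompact_closedBall (0 : ℝ) R) fun x hx => ?_
  exact IsKernel.projKernel_eq_zero hR (by simpa using hx)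

theorem IsKernel.integrable_projKernel (hJ : IsKernel J) : Integrable (projKernel J) :=
  hJ.continuous_projKernel.integrable_of_hasCompactSupport hJ.hasCompactSupport_projKernel

/-- Integrals of functions of the longitudinal coordinate against `J`. -/
theorem integral_kernel_mul_fst {h : ℝ → ℝ}
    (hh : Integrable fun z : Space d => J z * h (z 0)) :
    ∫ z : Space d, J z * h (z 0) = ∫ x, projKernel J x * h x := by
  have mp := (measurePreserving_splitEquiv (d := d)).symm
  have h1 : Integrable (fun q : ℝ × (Fin d → ℝ) => J ((splitEquiv d).symm q) * h q.1)
      (volume.prod volume) := by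
    have := (mp.integrable_comp_emb (splitEquiv d).symm.measurableEmbedding).2 hh
    refine this.congr (Eventually.of_forall fun q => ?_)
    simp [splitEquiv_symm_apply q.1 q.2]
  rw [← mp.integral_comp (splitEquiv d).symm.measurableEmbedding]
  have e : ∀ q : ℝ × (Fin d → ℝ), J ((splitEquiv d).symm q) * h (((splitEquiv d).symm q) 0) =
      J ((splitEquiv d).symm q) * h q.1 := fun q => by simp [splitEquiv_symm_apply q.1 q.2]
  simp_rw [e]
  rw [Measure.volume_eq_prod, integral_prod _ h1]
  simp only [integral_mul_const, ← projKernel_eq]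

theorem IsKernel.integrable_mul_fst (hJ : IsKernel J) {h : ℝ → ℝ} (hm : Measurable h) {C : ℝ}
    (hC : ∀ x, |h x| ≤ C) : Integrable fun z : Space d => J z * h (z 0) :=
  hJ.isSmoothKernel.integrable.mul_bdd (c := C)
    (hm.comp (by fun_prop : Measurable fun z : Space d => z 0)).aestronglyMeasurable
    (Eventually.of_forall fun z => hC _)

end Kernel

/-! ### Admissible profiles and the free energy -/

section Energy

variable {d : ℕ} {J : Space d → ℝ} {β mβ : ℝ}

theorem isAdmissible_iff {m : ℝ → ℝ} : IsAdmissible m ↔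
    Measurable m ∧ (∀ x, m x ∈ Icc (-1 : ℝ) 1) ∧ (∀ x, 0 < x → 0 ≤ m x) ∧
      (∀ x, x < 0 → m x ≤ 0) ∧ (∃ l, 0 < l ∧ Tendsto m atTop (𝓝 l)) ∧
      ∃ l, 0 < l ∧ Tendsto m atBot (𝓝 (-l)) := by
  have hT : ∀ l, Tendsto (fun x => Real.sign x * m x) atTop (𝓝 l) ↔ Tendsto m atTop (𝓝 l) :=
    fun l => tendsto_congr' (by
      filter_upwards [eventually_gt_atTop 0] with x hx
      rw [Real.sign_of_pos hx, one_mul])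
  have hB : ∀ l, Tendsto (fun x => Real.sign x * m x) atBot (𝓝 l) ↔ Tendsto m atBot (𝓝 (-l)) := by
    intro l
    have : (fun x => Real.sign x * m x) =ᶠ[atBot] fun x => -m x := by
      filter_upwards [eventually_lt_atBot 0] with x hx
      rw [Real.sign_of_neg hx, neg_one_mul]
    rw [tendsto_congr' this]
    constructor
    · intro h; simpa using h.neg
    · intro h; simpa using h.neg
  constructor
  · rintro ⟨h1, h2, h3, h4, h5⟩
    refine ⟨h1, h2, fun x hx => ?_, fun x hx => ?_, ?_, ?_⟩
    · simpa [Real.sign_of_pos hx] using h3 x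
    · simpa [Real.sign_of_neg hx] using h3 x
    · simpa only [hT] using h4
    · simpa only [hB] using h5
  · rintro ⟨h1, h2, h3, h3', h4, h5⟩
    refine ⟨h1, h2, fun x => ?_, by simpa only [hT] using h4, by simpa only [hB] using h5⟩
    rcases lt_trichotomy x 0 with hx | hx | hx
    · simpa [Real.sign_of_neg hx] using h3' x hx
    · simp [hx]
    · simpa [Real.sign_of_pos hx] using h3 x hx

theorem continuous_potential (β : ℝ) : Continuous (potential β) := by
  have h : Continuous fun x : ℝ => x * Real.log x := Real.continuous_mul_log
  have h1 : Continuous fun m : ℝ => (1 + m) / 2 * Real.log ((1 + m) / 2) :=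
    h.comp (by fun_prop : Continuous fun m : ℝ => (1 + m) / 2)
  have h2 : Continuous fun m : ℝ => (1 - m) / 2 * Real.log ((1 - m) / 2) :=
    h.comp (by fun_prop : Continuous fun m : ℝ => (1 - m) / 2)
  unfold potential
  fun_prop

theorem potential_neg (β m : ℝ) : potential β (-m) = potential β m := by
  unfold potential
  rw [sub_neg_eq_add, ← sub_eq_add_neg]
  ring

theorem freeEnergy_comp_add (m : ℝ → ℝ) (t : ℝ) :
    freeEnergy β mβ J (fun x => m (x + t)) = freeEnergy β mβ J m := by
  unfold freeEnergy
  congr 1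
  · exact lintegral_add_right_eq_self
      (fun x => ENNReal.ofReal (potential β (m x) - potential β mβ)) t
  · congr 1
    rw [← lintegral_add_right_eq_self (fun x => ∫⁻ y, ENNReal.ofReal
      (projKernel J (x - y) * (m x - m y) ^ 2)) t]
    refine lintegral_congr fun x => ?_
    rw [← lintegral_add_right_eq_self (fun y => ENNReal.ofReal
      (projKernel J (x + t - y) * (m (x + t) - m y) ^ 2)) t]
    simp

theorem freeEnergy_reflect (hJ : IsKernel J) (m : ℝ → ℝ) :
    freeEnergy β mβ J (fun x => -m (-x)) = freeEnergy β mβ J m := by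
  unfold freeEnergy
  congr 1
  · simp only [potential_neg]
    exact lintegral_neg_eq_self (fun x => ENNReal.ofReal (potential β (m x) - potential β mβ))
  · congr 1
    rw [← lintegral_neg_eq_self (fun x => ∫⁻ y, ENNReal.ofReal
      (projKernel J (x - y) * (m x - m y) ^ 2))]
    refine lintegral_congr fun x => ?_
    rw [← lintegral_neg_eq_self (fun y => ENNReal.ofReal
      (projKernel J (-x - y) * (m (-x) - m y) ^ 2))]
    refine lintegral_congr fun y => ?_
    rw [← hJ.projKernel_even (-x - -y)]
    congr 2
    · congr 1; ring
    · ring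

theorem measurable_potential_comp {m : ℝ → ℝ} (hm : Measurable m) :
    Measurable fun x => ENNReal.ofReal (potential β (m x) - potential β mβ) :=
  (((continuous_potential β).measurable.comp hm).sub_const _).ennreal_ofReal

theorem measurable_interaction (hJ : IsKernel J) {m : ℝ → ℝ} (hm : Measurable m) :
    Measurable fun q : ℝ × ℝ => ENNReal.ofReal (projKernel J (q.1 - q.2) * (m q.1 - m q.2) ^ 2) :=
  (((hJ.continuous_projKernel.measurable.comp (measurable_fst.sub measurable_snd)).mul
    (((hm.comp measurable_fst).sub (hm.comp measurable_snd)).pow_const 2))).ennreal_ofReal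

theorem sq_max_sub_add_sq_min_sub_le (a b a' b' : ℝ) :
    (max a b - max a' b') ^ 2 + (min a b - min a' b') ^ 2 ≤ (a - a') ^ 2 + (b - b') ^ 2 := by
  rcases le_total a b with h | h <;> rcases le_total a' b' with h' | h' <;>
    simp only [max_eq_left, max_eq_right, min_eq_left, min_eq_right, h, h'] <;>
    nlinarith [mul_nonneg (sub_nonneg.2 h) (sub_nonneg.2 h')]

/-- The free energy is submodular. -/
theorem freeEnergy_max_add_freeEnergy_min_le (hJ : IsKernel J) {a b : ℝ → ℝ} (ha : Measurable a)
    (hb : Measurable b) :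
    freeEnergy β mβ J (fun x => max (a x) (b x)) + freeEnergy β mβ J (fun x => min (a x) (b x)) ≤
      freeEnergy β mβ J a + freeEnergy β mβ J b := by
  have hmax : Measurable fun x => max (a x) (b x) := ha.max hb
  have hmin : Measurable fun x => min (a x) (b x) := ha.min hb
  unfold freeEnergy
  rw [add_add_add_comm, add_add_add_comm (∫⁻ x, ENNReal.ofReal (potential β (a x) - _))]
  refine add_le_add (le_of_eq ?_) ?_
  · rw [← lintegral_add_left (measurable_potential_comp hmax),
      ← lintegral_add_left (measurable_potential_comp ha)]
    refine lintegral_congr fun x => ?_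
    rcases le_total (a x) (b x) with h | h
    · simp only [max_eq_right h, min_eq_left h]; rw [add_comm]
    · simp only [max_eq_left h, min_eq_right h]
  · rw [← mul_add, ← mul_add]
    refine mul_le_mul_right ?_ _
    have hi := fun {m : ℝ → ℝ} (hm : Measurable m) => (measurable_interaction hJ hm)
    rw [← lintegral_add_left (hi hmax).lintegral_prod_right',
      ← lintegral_add_left (hi ha).lintegral_prod_right']
    refine lintegral_mono fun x => ?_
    have hx : ∀ {m : ℝ → ℝ}, Measurable m → Measurable fun y =>
        ENNReal.ofReal (projKernel J (x - y) * (m x - m y) ^ 2) :=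
      fun hm => (hi hm).comp measurable_prodMk_left
    dsimp only
    rw [← lintegral_add_left (hx hmax), ← lintegral_add_left (hx ha)]
    refine lintegral_mono fun y => ?_
    have hk := hJ.projKernel_nonneg (x - y)
    rw [← ENNReal.ofReal_add (by positivity) (by positivity),
      ← ENNReal.ofReal_add (by positivity) (by positivity)]
    refine ENNReal.ofReal_le_ofReal ?_
    rw [← mul_add, ← mul_add]
    exact mul_le_mul_of_nonneg_left (sq_max_sub_add_sq_min_sub_le _ _ _ _) hk

theorem ENNReal_liminf_add_le (u v : ℕ → ℝ≥0∞) :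
    liminf u atTop + liminf v atTop ≤ liminf (fun n => u n + v n) atTop := by
  simp only [liminf_eq_iSup_iInf_of_nat]
  rw [ENNReal.iSup_add_iSup_of_monotone]
  · refine iSup_mono fun n => le_iInf₂ fun i hi => add_le_add ?_ ?_
    · exact iInf₂_le i hi
    · exact iInf₂_le i hi
  · exact fun a b hab => le_iInf₂ fun i hi => iInf₂_le i (hab.trans hi)
  · exact fun a b hab => le_iInf₂ fun i hi => iInf₂_le i (hab.trans hi)

/-- The free energy is lower semicontinuous under pointwise convergence. -/
theorem freeEnergy_le_of_tendsto (hJ : IsKernel J) {m : ℕ → ℝ → ℝ} {n : ℝ → ℝ}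
    (hm : ∀ k, Measurable (m k)) (hlim : ∀ x, Tendsto (fun k => m k x) atTop (𝓝 (n x)))
    {E : ℝ≥0∞} (hE : ∀ k, freeEnergy β mβ J (m k) ≤ E) : freeEnergy β mβ J n ≤ E := by
  have hp : ∫⁻ x, ENNReal.ofReal (potential β (n x) - potential β mβ) ≤
      liminf (fun k => ∫⁻ x, ENNReal.ofReal (potential β (m k x) - potential β mβ)) atTop := by
    refine le_trans (le_of_eq ?_) (lintegral_liminf_le fun k => measurable_potential_comp (hm k))
    refine lintegral_congr fun x => ?_
    refine (Tendsto.liminf_eq ?_).symm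
    exact (ENNReal.continuous_ofReal.tendsto _).comp
      ((((continuous_potential β).tendsto _).comp (hlim x)).sub_const _)
  have hi : ∫⁻ x, ∫⁻ y, ENNReal.ofReal (projKernel J (x - y) * (n x - n y) ^ 2) ≤
      liminf (fun k => ∫⁻ x, ∫⁻ y, ENNReal.ofReal (projKernel J (x - y) * (m k x - m k y) ^ 2))
        atTop := by
    refine le_trans (lintegral_mono fun x => ?_)
      (lintegral_liminf_le fun k => (measurable_interaction hJ (hm k)).lintegral_prod_right')
    refine le_trans (le_of_eq ?_) (lintegral_liminf_le fun k =>
      (measurable_interaction hJ (hm k)).comp measurable_prodMk_left)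
    refine lintegral_congr fun y => ?_
    refine (Tendsto.liminf_eq ?_).symm
    exact (ENNReal.continuous_ofReal.tendsto _).comp
      ((((hlim x).sub (hlim y)).pow 2).const_mul _)
  have hmul : ∀ u : ℕ → ℝ≥0∞, ENNReal.ofReal (1 / 4) * liminf u atTop ≤
      liminf (fun k => ENNReal.ofReal (1 / 4) * u k) atTop := by
    intro u
    simp only [liminf_eq_iSup_iInf_of_nat, ENNReal.mul_iSup]
    refine iSup_mono fun n => le_iInf₂ fun i hi => ?_
    gcongr
    exact iInf₂_le i hi
  calc freeEnergy β mβ J n ≤ _ :=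
        add_le_add hp ((mul_le_mul_right hi (ENNReal.ofReal (1 / 4))).trans (hmul _))
    _ ≤ liminf (fun k => freeEnergy β mβ J (m k)) atTop := ENNReal_liminf_add_le _ _
    _ ≤ E := liminf_le_of_le (by isBoundedDefault) fun b hb => by
        obtain ⟨k, hk⟩ := hb.exists
        exact hk.trans (hE k)

end Energy

section Lattice

variable {d : ℕ} {J : Space d → ℝ} {β mβ : ℝ} {m N : ℝ → ℝ}

theorem IsPosMinimizer.isAdmissible_step (h : IsPosMinimizer β mβ) :
    IsAdmissible fun x : ℝ => if 0 < x then mβ else -mβ := by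
  have h1 := h.2.1.2
  have h0 := h.1
  refine isAdmissible_iff.2 ⟨Measurable.ite measurableSet_Ioi measurable_const measurable_const,
    fun x => ?_, fun x hx => ?_, fun x hx => ?_, ⟨mβ, h.1, ?_⟩, ⟨mβ, h.1, ?_⟩⟩
  · split_ifs <;> constructor <;> linarith
  · simpa [hx] using h0.le
  · simpa [not_lt.2 hx.le] using h0.le
  · refine tendsto_const_nhds.congr' ?_
    filter_upwards [eventually_gt_atTop 0] with x hx
    rw [if_pos hx]
  · refine tendsto_const_nhds.congr' ?_
    filter_upwards [eventually_lt_atBot 0] with x hx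
    rw [if_neg (not_lt.2 hx.le)]

theorem freeEnergy_step_lt_top (hJ : IsKernel J) :
    freeEnergy β mβ J (fun x : ℝ => if 0 < x then mβ else -mβ) < ⊤ := by
  obtain ⟨R, hR0, hR⟩ := hJ.exists_radius
  obtain ⟨C, hC⟩ := hJ.hasCompactSupport_projKernel.exists_bound_of_continuous
    hJ.continuous_projKernel
  have hb : ∀ x y : ℝ, ENNReal.ofReal (projKernel J (x - y) *
      ((if 0 < x then mβ else -mβ) - (if 0 < y then mβ else -mβ)) ^ 2) ≤
      (Icc (-R) R).indicator (fun _ => (Icc (-R) R).indicator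
        (fun _ => ENNReal.ofReal (C * (2 * mβ) ^ 2)) y) x := by
    intro x y
    by_cases hk : R < |x - y|
    · simp [IsKernel.projKernel_eq_zero hR hk]
    · have hk' := abs_le.1 (not_lt.1 hk)
      by_cases hx : 0 < x <;> by_cases hy : 0 < y
      · simp [hx, hy]
      · rw [indicator_of_mem (by constructor <;> linarith),
          indicator_of_mem (by constructor <;> linarith), if_pos hx, if_neg hy]
        refine ENNReal.ofReal_le_ofReal ?_
        rw [sub_neg_eq_add, ← two_mul]
        exact mul_le_mul_of_nonneg_right ((le_abs_self _).trans (hC _)) (sq_nonneg _)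
      · rw [indicator_of_mem (by constructor <;> linarith),
          indicator_of_mem (by constructor <;> linarith), if_pos hy, if_neg hx]
        refine ENNReal.ofReal_le_ofReal ?_
        rw [show (-mβ - mβ) ^ 2 = (2 * mβ) ^ 2 by ring]
        exact mul_le_mul_of_nonneg_right ((le_abs_self _).trans (hC _)) (sq_nonneg _)
      · simp [hx, hy]
  have hp : ∀ x : ℝ, potential β (if 0 < x then mβ else -mβ) - potential β mβ = 0 := by
    intro x
    split_ifs <;> simp [potential_neg]
  unfold freeEnergy
  simp only [hp, ENNReal.ofReal_zero, lintegral_zero, zero_add]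
  refine ENNReal.mul_lt_top ENNReal.ofReal_lt_top ?_
  refine (lintegral_mono fun x => lintegral_mono fun y => hb x y).trans_lt ?_
  have : ∀ x : ℝ, ∫⁻ y, (Icc (-R) R).indicator (fun _ => (Icc (-R) R).indicator
        (fun _ => ENNReal.ofReal (C * (2 * mβ) ^ 2)) y) x =
      (Icc (-R) R).indicator
          (fun _ => ENNReal.ofReal (C * (2 * mβ) ^ 2) * volume (Icc (-R) R)) x := by
    intro x
    by_cases hx : x ∈ Icc (-R) R
    · simp only [indicator_of_mem hx]
      rw [lintegral_indicator measurableSet_Icc, setLIntegral_const]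
    · simp only [indicator_of_notMem hx, lintegral_zero]
  simp only [this]
  rw [lintegral_indicator measurableSet_Icc, setLIntegral_const]
  exact ENNReal.mul_lt_top (ENNReal.mul_lt_top ENNReal.ofReal_lt_top (by simp)) (by simp)

theorem IsFront.freeEnergy_lt_top (hm : IsFront β mβ J m) (h : IsPosMinimizer β mβ)
    (hJ : IsKernel J) : freeEnergy β mβ J m < ⊤ :=
  (hm.minimizes _ h.isAdmissible_step).trans_lt (freeEnergy_step_lt_top hJ)

theorem IsAdmissible.reflect (hm : IsAdmissible m) : IsAdmissible fun x => -m (-x) := by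
  obtain ⟨h1, h2, h3, h4, ⟨l, hl, h5⟩, ⟨l', hl', h6⟩⟩ := isAdmissible_iff.1 hm
  refine isAdmissible_iff.2 ⟨(h1.comp measurable_neg).neg, fun x => ?_, fun x hx => ?_,
    fun x hx => ?_, ⟨l', hl', ?_⟩, ⟨l, hl, ?_⟩⟩
  · have := h2 (-x)
    constructor <;> linarith [this.1, this.2]
  · linarith [h4 (-x) (by linarith)]
  · linarith [h3 (-x) (by linarith)]
  · simpa using (h6.comp tendsto_neg_atTop_atBot).neg
  · exact (h5.comp tendsto_neg_atBot_atTop).neg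

theorem IsFront.reflect (hm : IsFront β mβ J m) (hJ : IsKernel J) :
    IsFront β mβ J fun x => -m (-x) where
  admissible := hm.admissible.reflect
  continuous := (hm.continuous.comp continuous_neg).neg
  minimizes n hn := by
    rw [freeEnergy_reflect hJ]
    exact hm.minimizes n hn

theorem tendsto_comp_add_const {l : ℝ} (h : Tendsto m atTop (𝓝 l)) (t : ℝ) :
    Tendsto (fun x => m (x + t)) atTop (𝓝 l) :=
  h.comp (tendsto_atTop_add_const_right _ t tendsto_id)

theorem tendsto_comp_add_const_atBot {l : ℝ} (h : Tendsto m atBot (𝓝 l)) (t : ℝ) :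
    Tendsto (fun x => m (x + t)) atBot (𝓝 l) :=
  h.comp (tendsto_atBot_add_const_right _ t tendsto_id)

/-- Taking the minimum with a forward translate of the front does not raise the energy. -/
theorem IsFront.min_translate (hm : IsFront β mβ J m) (h : IsPosMinimizer β mβ) (hJ : IsKernel J)
    (hN : IsAdmissible N) (hNE : freeEnergy β mβ J N ≤ freeEnergy β mβ J m)
    {t : ℝ} (ht : 0 ≤ t) :
    IsAdmissible (fun x => min (N x) (m (x + t))) ∧
      freeEnergy β mβ J (fun x => min (N x) (m (x + t))) ≤ freeEnergy β mβ J m := by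
  obtain ⟨a1, a2, a3, a4, ⟨l, hl, a5⟩, ⟨l', hl', a6⟩⟩ := isAdmissible_iff.1 hm.admissible
  obtain ⟨b1, b2, b3, b4, ⟨k, hk, b5⟩, ⟨k', hk', b6⟩⟩ := isAdmissible_iff.1 hN
  have hmt : Measurable fun x => m (x + t) := a1.comp (measurable_add_const t)
  constructor
  · refine isAdmissible_iff.2 ⟨b1.min hmt, fun x => ?_, fun x hx => ?_, fun x hx => ?_,
      ⟨min k l, lt_min hk hl, b5.min (tendsto_comp_add_const a5 t)⟩,
      ⟨max k' l', lt_max_of_lt_left hk', ?_⟩⟩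
    · exact ⟨le_min (b2 x).1 (a2 _).1, min_le_of_left_le (b2 x).2⟩
    · exact le_min (b3 x hx) (a3 _ (by linarith))
    · exact min_le_of_left_le (b4 x hx)
    · rw [← min_neg_neg]
      exact b6.min (tendsto_comp_add_const_atBot a6 t)
  · have hM : IsAdmissible fun x => max (N (x + -t)) (m (x + -t + t)) := by
      refine isAdmissible_iff.2 ⟨(b1.max hmt).comp (measurable_add_const (-t)), fun x => ?_,
        fun x hx => ?_, fun x hx => ?_,
        ⟨max k l, lt_max_of_lt_left hk, (tendsto_comp_add_const (b5.max
          (tendsto_comp_add_const a5 t)) (-t))⟩, ⟨min k' l', lt_min hk' hl', ?_⟩⟩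
      · exact ⟨le_max_of_le_left (b2 _).1, max_le (b2 _).2 (a2 _).2⟩
      · rw [neg_add_cancel_right]
        exact le_max_of_le_right (a3 x hx)
      · rw [neg_add_cancel_right]
        exact max_le (b4 _ (by linarith)) (a4 x hx)
      · rw [← max_neg_neg]
        exact tendsto_comp_add_const_atBot (b6.max (tendsto_comp_add_const_atBot a6 t)) (-t)
    have h1 := hm.minimizes _ hM
    rw [freeEnergy_comp_add (fun x => max (N x) (m (x + t))) (-t)] at h1
    have h2 := freeEnergy_max_add_freeEnergy_min_le (β := β) (mβ := mβ) hJ b1 hmt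
    rw [freeEnergy_comp_add m t] at h2
    refine (ENNReal.add_le_add_iff_left (hm.freeEnergy_lt_top h hJ).ne).1 ?_
    exact (add_le_add_left h1 _).trans (h2.trans (add_le_add_left hNE _))

/-- The largest monotone minorant of a front is a front. -/
theorem IsFront.exists_minorant (hm : IsFront β mβ J m) (h : IsPosMinimizer β mβ)
    (hJ : IsKernel J) :
    ∃ n : ℝ → ℝ, IsFront β mβ J n ∧ Monotone n ∧ ∀ x, n x ≤ m x := by
  obtain ⟨a1, a2, a3, a4, ⟨l, hl, a5⟩, ⟨l', hl', a6⟩⟩ := isAdmissible_iff.1 hm.admissible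
  let t : ℕ → ℝ := fun k => |TopologicalSpace.denseSeq ℝ k|
  let N : ℕ → ℝ → ℝ := fun k => Nat.rec m (fun k u x => min (u x) (m (x + t k))) k
  have N0 : N 0 = m := rfl
  have NS : ∀ k, N (k + 1) = fun x => min (N k x) (m (x + t k)) := fun k => rfl
  have hN : ∀ k, IsAdmissible (N k) ∧ freeEnergy β mβ J (N k) ≤ freeEnergy β mβ J m := by
    intro k
    induction k with
    | zero => exact ⟨hm.admissible, le_rfl⟩
    | succ k ih => exact hm.min_translate h hJ ih.1 ih.2 (abs_nonneg _)
  have hanti : ∀ x, Antitone fun k => N k x := fun x =>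
    antitone_nat_of_succ_le fun k => by rw [NS]; exact min_le_left _ _
  have hlow : ∀ c x, (∀ y, x ≤ y → c ≤ m y) → ∀ k, c ≤ N k x := by
    intro c x hc k
    induction k with
    | zero => exact hc x le_rfl
    | succ k ih => exact le_min ih (hc _ (by linarith [abs_nonneg (TopologicalSpace.denseSeq ℝ k)]))
  have hbdd : ∀ x, BddBelow (range fun k => N k x) := fun x =>
    ⟨-1, by rintro _ ⟨k, rfl⟩; exact ((hN k).1.mem_Icc x).1⟩
  let n : ℝ → ℝ := fun x => ⨅ k, N k x
  have hlim : ∀ x, Tendsto (fun k => N k x) atTop (𝓝 (n x)) := fun x =>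
    tendsto_atTop_ciInf (hanti x) (hbdd x)
  have hle : ∀ x y, x ≤ y → n x ≤ m y := by
    intro x y hxy
    have hcl : IsClosed {s : ℝ | n x ≤ m (x + |s|)} :=
      isClosed_le continuous_const (hm.continuous.comp (continuous_const.add continuous_abs))
    have hall : {s : ℝ | n x ≤ m (x + |s|)} = univ := by
      rw [← hcl.closure_eq]
      refine ((TopologicalSpace.denseRange_denseSeq ℝ).mono ?_).closure_eq
      rintro _ ⟨k, rfl⟩
      refine (ciInf_le (hbdd x) (k + 1)).trans ?_
      rw [NS]
      exact min_le_right _ _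
    have : y - x ∈ {s : ℝ | n x ≤ m (x + |s|)} := hall ▸ mem_univ _
    simpa [abs_of_nonneg (sub_nonneg.2 hxy)] using this
  have hge : ∀ c x, (∀ y, x ≤ y → c ≤ m y) → c ≤ n x := fun c x hc =>
    le_ciInf fun k => hlow c x hc k
  have hmono : Monotone n := fun x y hxy => hge _ _ fun z hz => hle _ _ (hxy.trans hz)
  have hcont : Continuous n := by
    rw [Metric.continuous_iff]
    intro x ε hε
    obtain ⟨δ, hδ, hc⟩ := Metric.continuous_iff.1 hm.continuous x (ε / 4) (by positivity)
    have key : ∀ a b, a ≤ b → dist a x < δ → dist b x < δ → n b ≤ n a + ε / 2 := by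
      intro a b hab ha hb
      rw [← sub_le_iff_le_add]
      refine hge _ _ fun z hz => ?_
      rcases le_total b z with hbz | hbz
      · linarith [hle b z hbz]
      · have hzx : dist z x < δ := by
          rw [Real.dist_eq, abs_lt] at *
          constructor <;> linarith [ha.1, hb.2]
        have h1 := hc z hzx
        have h2 := hc b hb
        have h3 := hle b b le_rfl
        rw [Real.dist_eq, abs_lt] at h1 h2
        linarith
    refine ⟨δ, hδ, fun y hy => ?_⟩
    have hxx : dist x x < δ := by simpa
    rw [Real.dist_eq, abs_lt]
    rcases le_total x y with hxy | hxy
    · have := key x y hxy hxx hy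
      have := hmono hxy
      constructor <;> linarith
    · have := key y x hxy hy hxx
      have := hmono hxy
      constructor <;> linarith
  have hnb : ∀ x, -1 ≤ n x := fun x => hge _ _ fun y _ => (a2 y).1
  have hadm : IsAdmissible n := by
    refine isAdmissible_iff.2 ⟨hcont.measurable, fun x => ⟨hnb x, (hle x x le_rfl).trans (a2 x).2⟩,
      fun x hx => hge _ _ fun y hy => a3 y (hx.trans_le hy),
      fun x hx => (hle x x le_rfl).trans (a4 x hx), ⟨l, hl, ?_⟩, ⟨-⨅ x, n x, ?_, ?_⟩⟩
    · refine tendsto_order.2 ⟨fun a ha => ?_, fun a ha => ?_⟩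
      · obtain ⟨b, hab, hbl⟩ := exists_between ha
        obtain ⟨X, hX⟩ := eventually_atTop.1 (a5.eventually_const_lt hbl)
        filter_upwards [eventually_ge_atTop X] with x hx
        exact hab.trans_le (hge _ _ fun y hy => (hX y (hx.trans hy)).le)
      · filter_upwards [a5.eventually_lt_const ha] with x hx
        exact (hle x x le_rfl).trans_lt hx
    · have hT := tendsto_atBot_ciInf hmono ⟨-1, by rintro _ ⟨x, rfl⟩; exact hnb x⟩
      have := le_of_tendsto_of_tendsto' hT a6 fun x => hle x x le_rfl
      linarith
    · rw [neg_neg]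
      exact tendsto_atBot_ciInf hmono ⟨-1, by rintro _ ⟨x, rfl⟩; exact hnb x⟩
  have hE : freeEnergy β mβ J n ≤ freeEnergy β mβ J m :=
    freeEnergy_le_of_tendsto hJ (fun k => (hN k).1.measurable) hlim fun k => (hN k).2
  exact ⟨n, ⟨hadm, hcont, fun w hw => hE.trans (hm.minimizes w hw)⟩, hmono,
    fun x => hle x x le_rfl⟩

end Lattice

section Average

variable {d : ℕ} {J : Space d → ℝ} {h k : ℝ → ℝ}

/-- The average `∫ J(z) h(x - z₁) dz` of a function of the longitudinal coordinate. -/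
def avg (J : Space d → ℝ) (h : ℝ → ℝ) (x : ℝ) : ℝ := ∫ z, J z * h (x - z 0)

theorem IsKernel.integrable_avg (hJ : IsKernel J) (hm : Measurable h) {C : ℝ}
    (hC : ∀ x, |h x| ≤ C) (x : ℝ) : Integrable fun z : Space d => J z * h (x - z 0) :=
  hJ.integrable_mul_fst (h := fun t => h (x - t)) (hm.comp (measurable_const.sub measurable_id))
    fun _ => hC _

theorem IsKernel.continuous_avg (hJ : IsKernel J) (hc : Continuous h) {C : ℝ}
    (hC : ∀ x, |h x| ≤ C) : Continuous (avg J h) := by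
  refine continuous_of_dominated (bound := fun z => J z * C)
    (fun x => (hJ.integrable_avg hc.measurable hC x).aestronglyMeasurable)
    (fun x => Eventually.of_forall fun z => ?_) (hJ.isSmoothKernel.integrable.mul_const C)
    (Eventually.of_forall fun z => ?_)
  · rw [norm_mul, Real.norm_of_nonneg (hJ.nonneg z)]
    exact mul_le_mul_of_nonneg_left (hC _) (hJ.nonneg z)
  · fun_prop

theorem avg_comp_add (h : ℝ → ℝ) (t x : ℝ) : avg J (fun y => h (y + t)) x = avg J h (x + t) := by
  simp only [avg, sub_add_eq_add_sub]

theorem IsKernel.avg_reflect (hJ : IsKernel J) (h : ℝ → ℝ) (x : ℝ) :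
    avg J (fun y => -h (-y)) x = -avg J h (-x) := by
  simp only [avg]
  rw [← integral_neg, ← integral_neg_eq_self]
  congr 1; ext z
  rw [hJ.even, PiLp.neg_apply, show -(x - -z 0) = -x - z 0 by ring]
  ring

theorem IsKernel.avg_sub (hJ : IsKernel J) (hm : Measurable h) (km : Measurable k) {C : ℝ}
    (hC : ∀ x, |h x| ≤ C) (kC : ∀ x, |k x| ≤ C) (x : ℝ) :
    avg J (fun y => h y - k y) x = avg J h x - avg J k x := by
  simp only [avg, mul_sub]
  exact integral_sub (hJ.integrable_avg hm hC x) (hJ.integrable_avg km kC x)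

theorem IsKernel.eq_zero_of_avg_eq_zero (hJ : IsKernel J) (hc : Continuous h)
    (h0 : ∀ x, 0 ≤ h x) {x : ℝ} (hx : avg J h x = 0) (z : Space d) (hz : J z ≠ 0) :
    h (x - z 0) = 0 := by
  have hcont : Continuous fun z : Space d => J z * h (x - z 0) :=
    hJ.smooth.continuous.mul (hc.comp (by fun_prop))
  have hae := (integral_eq_zero_iff_of_nonneg (fun z => mul_nonneg (hJ.nonneg z) (h0 _))
    (hcont.integrable_of_hasCompactSupport hJ.compactSupport.mul_right)).1 hx
  have := (hcont.ae_eq_iff_eq volume (g := fun _ => 0) continuous_const).1 hae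
  exact (mul_eq_zero.1 (congrFun this z)).resolve_left hz

theorem IsKernel.exists_ball (hJ : IsKernel J) :
    ∃ (z₀ : Space d) (r κ : ℝ), 0 < r ∧ 0 < κ ∧ ∀ z, ‖z - z₀‖ < r → κ ≤ J z := by
  obtain ⟨z₀, hz₀⟩ : ∃ z₀, J z₀ ≠ 0 := by
    by_contra! hc
    have := hJ.integral_eq_one
    simp [hc] at this
  have hpos : 0 < J z₀ := (hJ.nonneg z₀).lt_of_ne' hz₀
  obtain ⟨r, hr, hb⟩ := Metric.eventually_nhds_iff.1
    (hJ.smooth.continuous.continuousAt.eventually_const_le (half_lt_self hpos) :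
      ∀ᶠ z in 𝓝 z₀, J z₀ / 2 ≤ J z)
  exact ⟨z₀, r, J z₀ / 2, hr, half_pos hpos, fun z hz => hb (by rwa [dist_eq_norm])⟩

/-- Strong maximum principle: the zero set of a nonnegative function spreads under averaging. -/
theorem IsKernel.eq_zero_of_spread (hJ : IsKernel J) (hc : Continuous h)
    (h0 : ∀ x, 0 ≤ h x) (hs : ∀ x, h x = 0 → avg J h x = 0) {x₀ : ℝ} (hx₀ : h x₀ = 0) (x : ℝ) :
    h x = 0 := by
  obtain ⟨z₀, r, κ, hr, hκ, hb⟩ := hJ.exists_ball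
  have hopen : IsOpen {x | h x = 0} := by
    rw [Metric.isOpen_iff]
    intro x hx
    refine ⟨r, hr, fun y hy => ?_⟩
    have h1 : h (x + z₀ 0) = 0 := by
      have := hJ.eq_zero_of_avg_eq_zero hc h0 (hs x hx) (-z₀)
        (by rw [hJ.even]; exact (hκ.trans_le (hb z₀ (by simpa))).ne')
      simpa using this
    have h2 := hJ.eq_zero_of_avg_eq_zero hc h0 (hs _ h1)
      (z₀ + EuclideanSpace.single 0 (x - y)) (hκ.trans_le (hb _ (by
        rw [add_sub_cancel_left, PiLp.norm_single, ← dist_eq_norm, dist_comm]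
        exact hy))).ne'
    rw [← h2]
    congr 1
    simp only [PiLp.add_apply, PiLp.single_apply, if_pos]
    ring
  have hclosed : IsClosed {x | h x = 0} := isClosed_eq hc continuous_const
  have : {x | h x = 0} = univ := IsClopen.eq_univ ⟨hclosed, hopen⟩ ⟨x₀, hx₀⟩
  exact this.ge (mem_univ x)

end Average

/-! ### The entropy -/

/-- The entropy part of the double-well potential. -/
def entropy (m : ℝ) : ℝ :=
  (1 + m) / 2 * Real.log ((1 + m) / 2) + (1 - m) / 2 * Real.log ((1 - m) / 2)

theorem potential_eq (β m : ℝ) : potential β m = -(1 / 2) * m ^ 2 + 1 / β * entropy m := rfl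

theorem mul_log_lt {p q : ℝ} (hp : 0 ≤ p) (hq : 0 < q) (hne : p ≠ q) :
    p * Real.log q + (p - q) < p * Real.log p := by
  rcases hp.eq_or_lt with rfl | hp
  · simpa using hq
  · have h1 := Real.log_lt_sub_one_of_pos (div_pos hq hp) (by
      rw [Ne, div_eq_one_iff_eq hp.ne']; exact hne.symm)
    rw [Real.log_div hq.ne' hp.ne'] at h1
    have h2 := mul_lt_mul_of_pos_left h1 hp
    have : p * (q / p - 1) = q - p := by field_simp
    rw [this] at h2
    linarith

theorem one_add_tanh_half (s : ℝ) :
    (1 + Real.tanh s) / 2 = Real.exp s / (2 * Real.cosh s) := by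
  have := (Real.cosh_pos s).ne'
  rw [Real.tanh_eq_sinh_div_cosh, ← Real.cosh_add_sinh s]
  field_simp

theorem one_sub_tanh_half (s : ℝ) :
    (1 - Real.tanh s) / 2 = Real.exp (-s) / (2 * Real.cosh s) := by
  have := one_add_tanh_half (-s)
  rwa [Real.tanh_neg, Real.cosh_neg, ← sub_eq_add_neg] at this

/-- The Gibbs variational principle. -/
theorem entropy_tanh_lt {m s : ℝ} (hm : m ∈ Icc (-1 : ℝ) 1) (hne : m ≠ Real.tanh s) :
    entropy (Real.tanh s) - Real.tanh s * s < entropy m - m * s := by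
  set T := Real.tanh s with hT
  have hc := Real.cosh_pos s
  have hq1 : 0 < (1 + T) / 2 := by rw [one_add_tanh_half]; positivity
  have hq2 : 0 < (1 - T) / 2 := by rw [one_sub_tanh_half]; positivity
  have h1 := mul_log_lt (p := (1 + m) / 2) (by linarith [hm.1]) hq1 (fun h => hne (by linarith))
  have h2 := mul_log_lt (p := (1 - m) / 2) (by linarith [hm.2]) hq2 (fun h => hne (by linarith))
  have e1 : Real.log ((1 + T) / 2) = s - Real.log (2 * Real.cosh s) := by
    rw [one_add_tanh_half, Real.log_div (Real.exp_pos _).ne' (by positivity), Real.log_exp]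
  have e2 : Real.log ((1 - T) / 2) = -s - Real.log (2 * Real.cosh s) := by
    rw [one_sub_tanh_half, Real.log_div (Real.exp_pos _).ne' (by positivity), Real.log_exp]
  unfold entropy
  rw [e1] at h1 ⊢
  rw [e2] at h2 ⊢
  linarith

theorem tanh_mem_Icc (s : ℝ) : Real.tanh s ∈ Icc (-1 : ℝ) 1 :=
  ⟨(Real.neg_one_lt_tanh s).le, (Real.tanh_lt_one s).le⟩

section EulerLagrange

variable {d : ℕ} {J : Space d → ℝ} {β mβ : ℝ} {m : ℝ → ℝ}

/-- The interaction energy between two regions. -/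
def interact (J : Space d → ℝ) (m : ℝ → ℝ) (A B : Set ℝ) : ℝ≥0∞ :=
  ∫⁻ x in A, ∫⁻ y in B, ENNReal.ofReal (projKernel J (x - y) * (m x - m y) ^ 2)

theorem interact_comm (hJ : IsKernel J) (hm : Measurable m) (A B : Set ℝ) :
    interact J m A B = interact J m B A := by
  unfold interact
  rw [lintegral_lintegral_swap (measurable_interaction hJ hm).aemeasurable]
  refine lintegral_congr fun y => lintegral_congr fun x => ?_
  rw [← hJ.projKernel_even, neg_sub, ← neg_sub (m y), neg_sq]

theorem interact_add_compl (m : ℝ → ℝ) {A : Set ℝ} (hA : MeasurableSet A) (hJ : IsKernel J)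
    (hm : Measurable m) (B : Set ℝ) :
    interact J m B A + interact J m B Aᶜ = interact J m B univ := by
  unfold interact
  have hx : ∀ C : Set ℝ, Measurable fun x => ∫⁻ y in C,
      ENNReal.ofReal (projKernel J (x - y) * (m x - m y) ^ 2) := fun C =>
    (measurable_interaction hJ hm).lintegral_prod_right'
  rw [← lintegral_add_left (hx A)]
  refine lintegral_congr fun x => ?_
  rw [lintegral_add_compl _ hA, Measure.restrict_univ]

theorem freeEnergy_eq_split (hJ : IsKernel J) (hm : Measurable m) {A : Set ℝ}
    (hA : MeasurableSet A) :
    freeEnergy β mβ J m =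
      (∫⁻ x in Aᶜ, ENNReal.ofReal (potential β (m x) - potential β mβ)) +
        ENNReal.ofReal (1 / 4) * interact J m Aᶜ Aᶜ +
      ((∫⁻ x in A, ENNReal.ofReal (potential β (m x) - potential β mβ)) +
        ENNReal.ofReal (1 / 4) * (interact J m A A + 2 * interact J m A Aᶜ)) := by
  have h1 : ∫⁻ x, ∫⁻ y, ENNReal.ofReal (projKernel J (x - y) * (m x - m y) ^ 2) =
      interact J m A A + 2 * interact J m A Aᶜ + interact J m Aᶜ Aᶜ := by
    have : ∫⁻ x, ∫⁻ y, ENNReal.ofReal (projKernel J (x - y) * (m x - m y) ^ 2) =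
        interact J m A univ + interact J m Aᶜ univ := by
      unfold interact
      rw [Measure.restrict_univ, lintegral_add_compl _ hA]
    rw [this, ← interact_add_compl m hA hJ hm A, ← interact_add_compl m hA hJ hm Aᶜ,
      interact_comm hJ hm Aᶜ A]
    ring
  unfold freeEnergy
  rw [h1, ← lintegral_add_compl _ hA]
  ring

/-- The energy density of the value `c` in the field of the profile `m`. -/
def localEnergy (β mβ : ℝ) (J : Space d → ℝ) (m : ℝ → ℝ) (x c : ℝ) : ℝ :=
  potential β c - potential β mβ +
    1 / 2 * (c ^ 2 - 2 * c * avg J m x + avg J (fun y => m y ^ 2) x)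

theorem integrable_sq_sub_avg (hJ : IsKernel J) (hm : Measurable m) {C : ℝ}
    (hC : ∀ x, |m x| ≤ C) (x c : ℝ) :
    Integrable (fun z : Space d => J z * (c - m (x - z 0)) ^ 2) ∧
      ∫ z : Space d, J z * (c - m (x - z 0)) ^ 2 =
        c ^ 2 - 2 * c * avg J m x + avg J (fun y => m y ^ 2) x := by
  have hC2 : ∀ y, |m y ^ 2| ≤ C ^ 2 := fun y => by
    rw [abs_of_nonneg (sq_nonneg _)]
    exact sq_le_sq.2 ((hC y).trans (le_abs_self C))
  have i1 := hJ.integrable_avg hm hC x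
  have i2 := hJ.integrable_avg (hm.pow_const 2) hC2 x
  have i0 := hJ.isSmoothKernel.integrable.mul_const (c ^ 2)
  have e : ∀ z : Space d, J z * (c - m (x - z 0)) ^ 2 =
      J z * c ^ 2 - 2 * c * (J z * m (x - z 0)) + J z * m (x - z 0) ^ 2 := fun z => by ring
  have i01 : Integrable fun z : Space d => J z * c ^ 2 - 2 * c * (J z * m (x - z 0)) :=
    i0.sub (i1.const_mul _)
  simp only [e]
  refine ⟨i01.add i2, ?_⟩
  rw [integral_add i01 i2, integral_sub i0 (i1.const_mul _), integral_mul_const,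
    integral_const_mul, hJ.integral_eq_one, one_mul]
  rfl

theorem field_nonneg (hJ : IsKernel J) (hm : Measurable m) {C : ℝ} (hC : ∀ x, |m x| ≤ C)
    (x c : ℝ) : 0 ≤ c ^ 2 - 2 * c * avg J m x + avg J (fun y => m y ^ 2) x := by
  rw [← (integrable_sq_sub_avg hJ hm hC x c).2]
  exact integral_nonneg fun z => mul_nonneg (hJ.nonneg z) (sq_nonneg _)

theorem lintegral_interaction_eq (hJ : IsKernel J) (hm : Measurable m) {C : ℝ}
    (hC : ∀ x, |m x| ≤ C) (x c : ℝ) :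
    ∫⁻ y, ENNReal.ofReal (projKernel J (x - y) * (c - m y) ^ 2) =
      ENNReal.ofReal (c ^ 2 - 2 * c * avg J m x + avg J (fun y => m y ^ 2) x) := by
  obtain ⟨i3, i3'⟩ := integrable_sq_sub_avg hJ hm hC x c
  have key : ∫ y, projKernel J y * (c - m (x - y)) ^ 2 =
      c ^ 2 - 2 * c * avg J m x + avg J (fun y => m y ^ 2) x := by
    rw [← integral_kernel_mul_fst (h := fun y => (c - m (x - y)) ^ 2) i3, i3']
  have hb : ∀ y, ‖(c - m (x - y)) ^ 2‖ ≤ (|c| + C) ^ 2 := fun y => by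
    rw [norm_pow]
    exact pow_le_pow_left₀ (norm_nonneg _) ((norm_sub_le _ _).trans
      (add_le_add le_rfl (hC _))) 2
  have i4 : Integrable fun y => projKernel J y * (c - m (x - y)) ^ 2 :=
    hJ.integrable_projKernel.mul_bdd (c := (|c| + C) ^ 2)
      ((measurable_const.sub (hm.comp (measurable_const.sub measurable_id))).pow_const
        2).aestronglyMeasurable (Eventually.of_forall hb)
  rw [← lintegral_sub_left_eq_self (fun y => ENNReal.ofReal (projKernel J (x - y) *
    (c - m y) ^ 2)) x]
  simp only [sub_sub_cancel]
  rw [← ofReal_integral_eq_lintegral_ofReal i4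
    (Eventually.of_forall fun y => mul_nonneg (hJ.projKernel_nonneg y) (sq_nonneg _)), key]

theorem ofReal_localEnergy (hJ : IsKernel J) (h : IsPosMinimizer β mβ) (hm : Measurable m)
    (hC : ∀ x, |m x| ≤ 1) (x : ℝ) {c : ℝ} (hc : c ∈ Icc (-1 : ℝ) 1) :
    ENNReal.ofReal (localEnergy β mβ J m x c) =
      ENNReal.ofReal (potential β c - potential β mβ) + ENNReal.ofReal (1 / 2) *
        ∫⁻ y, ENNReal.ofReal (projKernel J (x - y) * (c - m y) ^ 2) := by
  have h2 := field_nonneg hJ hm hC x c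
  rw [lintegral_interaction_eq hJ hm hC, ← ENNReal.ofReal_mul (by norm_num),
    ← ENNReal.ofReal_add (sub_nonneg.2 (h.2.2 hc)) (by positivity)]
  rfl

theorem IsFront.abs_le_one (hm : IsFront β mβ J m) (x : ℝ) : |m x| ≤ 1 :=
  abs_le.2 (hm.admissible.mem_Icc x)

/-- Comparison of the front with its modification on a short interval. -/
theorem IsFront.setLIntegral_localEnergy_le (hm : IsFront β mβ J m) (h : IsPosMinimizer β mβ)
    (hJ : IsKernel J) {x₀ c η : ℝ} (hx₀ : 0 ≤ x₀) (hc : c ∈ Icc (0 : ℝ) 1) :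
    ∫⁻ x in Ioo x₀ (x₀ + η), ENNReal.ofReal (localEnergy β mβ J m x (m x)) ≤
      (∫⁻ x in Ioo x₀ (x₀ + η), ENNReal.ofReal (localEnergy β mβ J m x c)) +
        ENNReal.ofReal (1 / 4) * interact J m (Ioo x₀ (x₀ + η)) (Ioo x₀ (x₀ + η)) := by
  obtain ⟨a1, a2, a3, a4, ⟨l, hl, a5⟩, ⟨l', hl', a6⟩⟩ := isAdmissible_iff.1 hm.admissible
  have hc' : c ∈ Icc (-1 : ℝ) 1 := ⟨by linarith [hc.1], hc.2⟩
  set A := Ioo x₀ (x₀ + η) with hAdef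
  have hA : MeasurableSet A := measurableSet_Ioo
  classical
  set m' : ℝ → ℝ := A.piecewise (fun _ => c) m with hm'
  have hin : ∀ x ∈ A, m' x = c := fun x hx => piecewise_eq_of_mem _ _ _ hx
  have hout : ∀ x ∈ Aᶜ, m' x = m x := fun x hx => piecewise_eq_of_notMem _ _ _ hx
  have m'm : Measurable m' := Measurable.piecewise hA measurable_const a1
  have hadm : IsAdmissible m' := by
    refine isAdmissible_iff.2 ⟨m'm, fun x => ?_, fun x hx => ?_, fun x hx => ?_, ⟨l, hl, ?_⟩,
      ⟨l', hl', ?_⟩⟩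
    · by_cases hxA : x ∈ A
      · rw [hin x hxA]; exact hc'
      · rw [hout x hxA]; exact a2 x
    · by_cases hxA : x ∈ A
      · rw [hin x hxA]; exact hc.1
      · rw [hout x hxA]; exact a3 x hx
    · rw [hout x fun hxA => by linarith [hxA.1]]
      exact a4 x hx
    · refine a5.congr' ?_
      filter_upwards [eventually_gt_atTop (x₀ + η)] with x hx
      exact (hout x fun hxA => by linarith [hxA.2]).symm
    · refine a6.congr' ?_
      filter_upwards [eventually_lt_atBot x₀] with x hx
      exact (hout x fun hxA => by linarith [hxA.1]).symm
  have hE := hm.minimizes m' hadm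
  have htop := hm.freeEnergy_lt_top h hJ
  rw [freeEnergy_eq_split hJ a1 hA] at hE htop
  rw [freeEnergy_eq_split hJ m'm hA] at hE
  have c1 : ∫⁻ x in Aᶜ, ENNReal.ofReal (potential β (m' x) - potential β mβ) =
      ∫⁻ x in Aᶜ, ENNReal.ofReal (potential β (m x) - potential β mβ) :=
    setLIntegral_congr_fun hA.compl fun x hx => by simp only [hout x hx]
  have c2 : interact J m' Aᶜ Aᶜ = interact J m Aᶜ Aᶜ :=
    setLIntegral_congr_fun hA.compl fun x hx =>
      setLIntegral_congr_fun hA.compl fun y hy => by simp only [hout x hx, hout y hy]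
  have c3 : interact J m' A A = 0 := by
    unfold interact
    rw [setLIntegral_congr_fun (g := fun _ => 0) hA fun x hx => ?_, lintegral_zero]
    dsimp only
    rw [setLIntegral_congr_fun (g := fun _ => 0) hA fun y hy => ?_, lintegral_zero]
    simp only [hin x hx, hin y hy]
    simp
  have c4 : ∫⁻ x in A, ENNReal.ofReal (potential β (m' x) - potential β mβ) =
      ∫⁻ x in A, ENNReal.ofReal (potential β c - potential β mβ) :=
    setLIntegral_congr_fun hA fun x hx => by simp only [hin x hx]
  have c5 : interact J m' A Aᶜ ≤
      ∫⁻ x in A, ∫⁻ y, ENNReal.ofReal (projKernel J (x - y) * (c - m y) ^ 2) := by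
    unfold interact
    refine setLIntegral_mono' hA fun x hx => ?_
    refine le_trans (le_of_eq ?_) (setLIntegral_le_lintegral Aᶜ _)
    exact setLIntegral_congr_fun hA.compl fun y hy => by simp only [hin x hx, hout y hy]
  rw [c1, c2, c3, zero_add, c4] at hE
  have hE := (ENNReal.add_le_add_iff_left (ENNReal.add_lt_top.1 htop).1.ne).1 hE
  have hdens : ∀ u : ℝ → ℝ, Measurable u → (∀ x, u x ∈ Icc (-1 : ℝ) 1) →
      ∫⁻ x in A, ENNReal.ofReal (localEnergy β mβ J m x (u x)) =
      (∫⁻ x in A, ENNReal.ofReal (potential β (u x) - potential β mβ)) + ENNReal.ofReal (1 / 2) *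
        ∫⁻ x in A, ∫⁻ y, ENNReal.ofReal (projKernel J (x - y) * (u x - m y) ^ 2) := by
    intro u hu hu1
    rw [← lintegral_const_mul' _ _ ENNReal.ofReal_ne_top,
      ← lintegral_add_left (measurable_potential_comp hu)]
    exact lintegral_congr fun x => ofReal_localEnergy hJ h a1 hm.abs_le_one x (hu1 x)
  have hquarter : ENNReal.ofReal (1 / 2) = ENNReal.ofReal (1 / 4) * 2 := by
    rw [show (2 : ℝ≥0∞) = ENNReal.ofReal 2 by simp, ← ENNReal.ofReal_mul (by norm_num)]
    norm_num
  rw [hdens m a1 a2, hdens (fun _ => c) measurable_const fun _ => hc']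
  have hfull : ∫⁻ x in A, ∫⁻ y, ENNReal.ofReal (projKernel J (x - y) * (m x - m y) ^ 2) =
      interact J m A A + interact J m A Aᶜ := by
    rw [interact_add_compl m hA hJ a1 A]
    simp only [interact, Measure.restrict_univ]
  rw [hfull]
  calc _ = (∫⁻ x in A, ENNReal.ofReal (potential β (m x) - potential β mβ)) +
        ENNReal.ofReal (1 / 4) * (interact J m A A + 2 * interact J m A Aᶜ) +
        ENNReal.ofReal (1 / 4) * interact J m A A := by rw [hquarter]; ring
    _ ≤ _ := by
        refine add_le_add (hE.trans ?_) le_rfl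
        refine add_le_add le_rfl ?_
        rw [hquarter, mul_assoc]
        gcongr

/-- The one-sided variational inequality satisfied by a front. -/
theorem IsFront.entropy_le (hm : IsFront β mβ J m) (h : IsPosMinimizer β mβ)
    (hJ : IsKernel J) (hβ : 0 < β) {x₀ c : ℝ} (hx₀ : 0 ≤ x₀) (hc : c ∈ Icc (0 : ℝ) 1) :
    entropy (m x₀) - m x₀ * (β * avg J m x₀) ≤ entropy c - c * (β * avg J m x₀) := by
  have a1 := hm.admissible.measurable
  have hS := hJ.continuous_avg hm.continuous hm.abs_le_one
  have hQ : Continuous (avg J fun y => m y ^ 2) :=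
    hJ.continuous_avg (hm.continuous.pow 2) (C := 1) fun y => by
      rw [abs_of_nonneg (sq_nonneg _), sq_le_one_iff_abs_le_one]
      exact hm.abs_le_one y
  have hcont : ∀ u : ℝ → ℝ, Continuous u → Continuous fun x => localEnergy β mβ J m x (u x) := by
    intro u hu
    have := (continuous_potential β).comp hu
    unfold localEnergy
    fun_prop
  suffices hle : localEnergy β mβ J m x₀ (m x₀) ≤ localEnergy β mβ J m x₀ c by
    simp only [localEnergy, potential_eq] at hle
    have : 1 / β * (entropy (m x₀) - m x₀ * (β * avg J m x₀)) ≤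
        1 / β * (entropy c - c * (β * avg J m x₀)) := by
      have e : ∀ a b S : ℝ, 1 / β * (a - b * (β * S)) = 1 / β * a - b * S := fun a b S => by
        field_simp
      rw [e, e]
      linarith
    exact le_of_mul_le_mul_left this (by positivity)
  by_contra! hlt
  obtain ⟨K, hK⟩ := hJ.hasCompactSupport_projKernel.exists_bound_of_continuous
    hJ.continuous_projKernel
  have hK0 : 0 ≤ K := (norm_nonneg _).trans (hK 0)
  obtain ⟨b, hb1, hb2⟩ := exists_between hlt
  obtain ⟨a, ha1, ha2⟩ := exists_between hb2
  obtain ⟨δ₁, hδ₁, n1⟩ := Metric.eventually_nhds_iff.1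
    ((hcont m hm.continuous).continuousAt.eventually_const_le ha2 :
      ∀ᶠ x in 𝓝 x₀, a ≤ localEnergy β mβ J m x (m x))
  obtain ⟨δ₂, hδ₂, n2⟩ := Metric.eventually_nhds_iff.1
    ((hcont (fun _ => c) continuous_const).continuousAt.eventually_le_const hb1 :
      ∀ᶠ x in 𝓝 x₀, localEnergy β mβ J m x c ≤ b)
  have hb0 : 0 ≤ b := by
    have hc' : c ∈ Icc (-1 : ℝ) 1 := ⟨by linarith [hc.1], hc.2⟩
    have hp := h.2.2 hc'
    have hQ0 := field_nonneg hJ a1 hm.abs_le_one x₀ c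
    refine le_trans ?_ hb1.le
    unfold localEnergy
    have : 0 ≤ potential β c - potential β mβ := sub_nonneg.2 hp
    positivity
  set η := min (min (δ₁ / 2) (δ₂ / 2)) ((a - b) / (2 * (K + 1)))
  have hη : 0 < η := by
    refine lt_min (lt_min (by positivity) (by positivity)) ?_
    exact div_pos (by linarith) (by positivity)
  have hη1 : η < δ₁ := lt_of_le_of_lt ((min_le_left _ _).trans (min_le_left _ _)) (by linarith)
  have hη2 : η < δ₂ := lt_of_le_of_lt ((min_le_left _ _).trans (min_le_right _ _)) (by linarith)
  have hη3 : η * (2 * (K + 1)) ≤ a - b := (le_div_iff₀ (by positivity)).1 (min_le_right _ _)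
  have key := hm.setLIntegral_localEnergy_le h hJ (η := η) hx₀ hc
  have hd : ∀ x ∈ Ioo x₀ (x₀ + η), dist x x₀ < η := fun x hx => by
    rw [Real.dist_eq, abs_of_pos (by linarith [hx.1])]
    linarith [hx.2]
  have hvol : volume (Ioo x₀ (x₀ + η)) = ENNReal.ofReal η := by simp
  have l1 : ENNReal.ofReal a * ENNReal.ofReal η ≤
      ∫⁻ x in Ioo x₀ (x₀ + η), ENNReal.ofReal (localEnergy β mβ J m x (m x)) := by
    rw [← hvol, ← setLIntegral_const]
    exact setLIntegral_mono' measurableSet_Ioo fun x hx =>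
      ENNReal.ofReal_le_ofReal (n1 ((hd x hx).trans hη1))
  have l2 : ∫⁻ x in Ioo x₀ (x₀ + η), ENNReal.ofReal (localEnergy β mβ J m x c) ≤
      ENNReal.ofReal b * ENNReal.ofReal η := by
    rw [← hvol, ← setLIntegral_const]
    exact setLIntegral_mono' measurableSet_Ioo fun x hx =>
      ENNReal.ofReal_le_ofReal (n2 ((hd x hx).trans hη2))
  have l3 : interact J m (Ioo x₀ (x₀ + η)) (Ioo x₀ (x₀ + η)) ≤
      ENNReal.ofReal (4 * K) * ENNReal.ofReal η * ENNReal.ofReal η := by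
    unfold interact
    rw [← hvol, ← setLIntegral_const, ← setLIntegral_const]
    refine lintegral_mono fun x => lintegral_mono fun y => ENNReal.ofReal_le_ofReal ?_
    have hmm : (m x - m y) ^ 2 ≤ 4 := by
      have h1 := abs_le.1 (hm.abs_le_one x)
      have h2 := abs_le.1 (hm.abs_le_one y)
      nlinarith
    calc projKernel J (x - y) * (m x - m y) ^ 2 ≤ K * 4 :=
          mul_le_mul ((le_abs_self _).trans (hK _)) hmm (sq_nonneg _) hK0
      _ = 4 * K := mul_comm _ _
  have hfin := l1.trans (key.trans (add_le_add l2 (mul_le_mul_right l3 (ENNReal.ofReal (1 / 4)))))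
  have ha0 : 0 ≤ a := hb0.trans ha1.le
  rw [← ENNReal.ofReal_mul ha0, ← ENNReal.ofReal_mul hb0, ← ENNReal.ofReal_mul (by positivity),
    ← ENNReal.ofReal_mul (by positivity), ← ENNReal.ofReal_mul (by norm_num),
    ← ENNReal.ofReal_add (by positivity) (by positivity),
    ENNReal.ofReal_le_ofReal_iff (by positivity)] at hfin
  have : η * a ≤ η * (b + K * η) := by linarith
  have := le_of_mul_le_mul_left this hη
  nlinarith

end EulerLagrange

/-! ### The front solves the mean-field equation -/

section MeanField

variable {d : ℕ} {J : Space d → ℝ} {β mβ : ℝ} {m : ℝ → ℝ}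

theorem IsFront.eq_tanh_of_pos (hm : IsFront β mβ J m) (h : IsPosMinimizer β mβ)
    (hJ : IsKernel J) (hβ : 0 < β) {x : ℝ} (hx : 0 ≤ x) (hpos : 0 < m x ∨ 0 ≤ avg J m x) :
    m x = Real.tanh (β * avg J m x) := by
  have hS : 0 ≤ avg J m x := by
    rcases hpos with hpos | hpos
    · have h1 := hm.entropy_le h hJ hβ hx (c := 0) ⟨le_rfl, zero_le_one⟩
      have h2 := entropy_tanh_lt (m := m x) (s := 0) (hm.admissible.mem_Icc x)
        (by rw [Real.tanh_zero]; exact hpos.ne')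
      rw [Real.tanh_zero] at h2
      have h3 : 0 ≤ (m x * β) * avg J m x := by linarith
      exact nonneg_of_mul_nonneg_right h3 (by positivity)
    · exact hpos
  by_contra hne
  have h0 : 0 ≤ Real.tanh (β * avg J m x) := by
    rw [Real.tanh_eq_sinh_div_cosh]
    exact div_nonneg (Real.sinh_nonneg_iff.2 (by positivity)) (Real.cosh_pos _).le
  have h1 := hm.entropy_le h hJ hβ hx (c := Real.tanh (β * avg J m x)) ⟨h0, (tanh_mem_Icc _).2⟩
  have h2 := entropy_tanh_lt (hm.admissible.mem_Icc x) hne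
  linarith

theorem IsFront.eq_tanh_of_neg (hm : IsFront β mβ J m) (h : IsPosMinimizer β mβ)
    (hJ : IsKernel J) (hβ : 0 < β) {x : ℝ} (hx : x ≤ 0) (hneg : m x < 0 ∨ avg J m x ≤ 0) :
    m x = Real.tanh (β * avg J m x) := by
  have := (hm.reflect hJ).eq_tanh_of_pos h hJ hβ (x := -x) (by linarith) (by
    rw [hJ.avg_reflect, neg_neg]
    simpa using hneg)
  rw [hJ.avg_reflect, neg_neg, mul_neg, Real.tanh_neg] at this
  exact neg_injective this

theorem IsFront.translate (hm : IsFront β mβ J m) (hmono : Monotone m) {x : ℝ} (hx : m x = 0) :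
    IsFront β mβ J fun y => m (y + x) := by
  obtain ⟨a1, a2, a3, a4, ⟨l, hl, a5⟩, ⟨l', hl', a6⟩⟩ := isAdmissible_iff.1 hm.admissible
  refine ⟨isAdmissible_iff.2 ⟨a1.comp (measurable_add_const x), fun _ => a2 _, fun y hy => ?_,
    fun y hy => ?_, ⟨l, hl, tendsto_comp_add_const a5 x⟩,
    ⟨l', hl', tendsto_comp_add_const_atBot a6 x⟩⟩, ?_, fun n hn => ?_⟩
  · rw [← hx]; exact hmono (by linarith)
  · rw [← hx]; exact hmono (by linarith)
  · have := hm.continuous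
    fun_prop
  · rw [freeEnergy_comp_add m x]
    exact hm.minimizes n hn

theorem IsFront.eq_tanh_of_monotone (hm : IsFront β mβ J m) (h : IsPosMinimizer β mβ)
    (hJ : IsKernel J) (hβ : 0 < β) (hmono : Monotone m) (x : ℝ) :
    m x = Real.tanh (β * avg J m x) := by
  obtain ⟨a1, a2, a3, a4, -, -⟩ := isAdmissible_iff.1 hm.admissible
  rcases lt_trichotomy (m x) 0 with hx | hx | hx
  · refine hm.eq_tanh_of_neg h hJ hβ ?_ (Or.inl hx)
    by_contra! hc
    exact absurd (a3 x hc) (not_le.2 hx)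
  · have ht := hm.translate hmono hx
    have hS : avg J (fun y => m (y + x)) 0 = avg J m x := by rw [avg_comp_add, zero_add]
    have key : m (0 + x) = Real.tanh (β * avg J (fun y => m (y + x)) 0) := by
      rcases le_total 0 (avg J m x) with h0 | h0
      · exact ht.eq_tanh_of_pos h hJ hβ le_rfl (Or.inr (by rwa [hS]))
      · exact ht.eq_tanh_of_neg h hJ hβ le_rfl (Or.inr (by rwa [hS]))
    rwa [hS, zero_add] at key
  · refine hm.eq_tanh_of_pos h hJ hβ ?_ (Or.inl hx)
    by_contra! hc
    exact absurd (a4 x hc) (not_le.2 hx)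

theorem IsFront.apply_zero (hm : IsFront β mβ J m) : m 0 = 0 := by
  obtain ⟨a1, a2, a3, a4, -, -⟩ := isAdmissible_iff.1 hm.admissible
  apply le_antisymm
  · exact le_of_tendsto (hm.continuous.continuousAt.tendsto.mono_left nhdsWithin_le_nhds :
      Tendsto m (𝓝[<] 0) _) (by filter_upwards [self_mem_nhdsWithin] with x hx using a4 x hx)
  · exact ge_of_tendsto (hm.continuous.continuousAt.tendsto.mono_left nhdsWithin_le_nhds :
      Tendsto m (𝓝[>] 0) _) (by filter_upwards [self_mem_nhdsWithin] with x hx using a3 x hx)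

theorem IsFront.monotone (hm : IsFront β mβ J m) (h : IsPosMinimizer β mβ)
    (hJ : IsKernel J) (hβ : 0 < β) : Monotone m := by
  obtain ⟨n₁, hn₁, mono₁, le₁⟩ := hm.exists_minorant h hJ
  obtain ⟨n, hn, mono, le⟩ := (hm.reflect hJ).exists_minorant h hJ
  have hn₂ := hn.reflect hJ
  have mono₂ : Monotone fun x => -n (-x) := fun x y hxy => neg_le_neg (mono (neg_le_neg hxy))
  have le₂ : ∀ x, m x ≤ -n (-x) := fun x => by
    have := le (-x)
    rw [neg_neg] at this
    linarith
  have heq : ∀ x, -n (-x) - n₁ x = 0 := by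
    intro x
    refine hJ.eq_zero_of_spread (h := fun x => -n (-x) - n₁ x)
      (hn₂.continuous.sub hn₁.continuous) (fun x => by linarith [le₁ x, le₂ x]) (fun y hy => ?_)
      (x₀ := 0) ?_ x
    · have e1 := hn₁.eq_tanh_of_monotone h hJ hβ mono₁ y
      have e2 := hn₂.eq_tanh_of_monotone h hJ hβ mono₂ y
      have e3 := Real.tanh_injective (e2.symm.trans ((sub_eq_zero.1 hy).trans e1))
      rw [hJ.avg_sub (h := fun x => -n (-x)) hn₂.continuous.measurable hn₁.continuous.measurable
        hn₂.abs_le_one hn₁.abs_le_one, sub_eq_zero]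
      exact mul_left_cancel₀ hβ.ne' e3
    · have := hn₂.apply_zero
      rw [this, hn₁.apply_zero, sub_zero]
  have : m = n₁ := funext fun x => le_antisymm (by linarith [le₂ x, heq x]) (le₁ x)
  rwa [this]

theorem IsFront.eq_tanh (hm : IsFront β mβ J m) (h : IsPosMinimizer β mβ)
    (hJ : IsKernel J) (hβ : 0 < β) (x : ℝ) : m x = Real.tanh (β * avg J m x) :=
  hm.eq_tanh_of_monotone h hJ hβ (hm.monotone h hJ hβ) x

end MeanField

/-! ### Regularity and decay of the front -/

section Profile

variable {d : ℕ} {J : Space d → ℝ} {β mβ : ℝ} {m : ℝ → ℝ}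

/-- The properties of the front that enter the spectral analysis of the operator `B`. -/
structure IsProfile (β : ℝ) (J : Space d → ℝ) (m : ℝ → ℝ) : Prop where
  contDiff : ContDiff ℝ ∞ m
  exists_bound : ∃ ρ < 1, ∀ x, |m x| ≤ ρ
  deriv_pos : ∀ x, 0 < deriv m x
  deriv_eq : ∀ x, deriv m x = β * (1 - m x ^ 2) * avg J (deriv m) x
  deriv_decay : ∃ M γ, 0 < M ∧ 0 < γ ∧ ∀ x, deriv m x ≤ M * Real.exp (-(γ * |x|))
  far : ∃ X δ, 0 ≤ X ∧ 0 < δ ∧ ∀ x, X ≤ |x| → 1 + δ ≤ 1 / (β * (1 - m x ^ 2))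

theorem hasDerivAt_tanh (x : ℝ) : HasDerivAt Real.tanh (1 - Real.tanh x ^ 2) x := by
  have hc := (Real.cosh_pos x).ne'
  have h := (Real.hasDerivAt_sinh x).div (Real.hasDerivAt_cosh x) hc
  have e : Real.tanh = fun x => Real.sinh x / Real.cosh x := funext Real.tanh_eq_sinh_div_cosh
  rw [e]
  refine h.congr_deriv ?_
  dsimp only
  field_simp

theorem contDiff_tanh : ContDiff ℝ ∞ Real.tanh := by
  have e : Real.tanh = fun x => Real.sinh x / Real.cosh x := funext Real.tanh_eq_sinh_div_cosh
  rw [e]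
  exact Real.contDiff_sinh.div Real.contDiff_cosh fun x => (Real.cosh_pos x).ne'

theorem IsKernel.contDiff_avg (hJ : IsKernel J) (hm : Continuous m) :
    ContDiff ℝ ∞ (avg J m) := by
  have h1 : ContDiff ℝ ∞ (convolution J (fun z : Space d => m (z 0))
      (ContinuousLinearMap.lsmul ℝ ℝ) volume) :=
    hJ.compactSupport.contDiff_convolution_left _ hJ.smooth
      (hm.comp (by fun_prop : Continuous fun z : Space d => z 0)).locallyIntegrable
  have h2 : ContDiff ℝ ∞ fun t : ℝ => (EuclideanSpace.single 0 t : Space d) := by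
    rw [funext (single_eq_smul (d := d) 0)]
    exact contDiff_id.smul contDiff_const
  have h3 : avg J m = fun t => convolution J (fun z : Space d => m (z 0))
      (ContinuousLinearMap.lsmul ℝ ℝ) volume (EuclideanSpace.single 0 t) := by
    ext t
    simp [avg, MeasureTheory.convolution]
  rw [h3]
  exact h1.comp h2

theorem IsKernel.hasDerivAt_avg (hJ : IsKernel J) (hm : ContDiff ℝ 1 m) (x : ℝ) :
    HasDerivAt (avg J m) (avg J (deriv m) x) x := by
  obtain ⟨R, hR0, hR⟩ := hJ.exists_radius
  have hd : Continuous (deriv m) := hm.continuous_deriv le_rfl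
  obtain ⟨C, hC⟩ := (isCompact_Icc (a := x - 1 - R) (b := x + 1 + R)).exists_bound_of_continuousOn
    hd.continuousOn
  refine (hasDerivAt_integral_of_dominated_loc_of_deriv_le (μ := volume)
    (F := fun x (z : Space d) => J z * m (x - z 0))
    (F' := fun x (z : Space d) => J z * deriv m (x - z 0)) (bound := fun z => J z * C)
    (s := Metric.ball x 1) (Metric.ball_mem_nhds x one_pos) ?_ ?_ ?_ ?_ ?_ ?_).2
  · refine Eventually.of_forall fun y => ?_
    have := hJ.smooth.continuous
    have := hm.continuous
    exact Continuous.aestronglyMeasurable (by fun_prop)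
  · have h1 : Continuous fun z : Space d => J z * m (x - z 0) := by
      have := hJ.smooth.continuous
      have := hm.continuous
      fun_prop
    exact h1.integrable_of_hasCompactSupport hJ.compactSupport.mul_right
  · have h1 : Continuous fun z : Space d => J z * deriv m (x - z 0) := by
      have := hJ.smooth.continuous
      fun_prop
    exact h1.aestronglyMeasurable
  · refine Eventually.of_forall fun z y hy => ?_
    rw [norm_mul, Real.norm_of_nonneg (hJ.nonneg z)]
    by_cases hz : J z = 0
    · simp [hz]
    · have h1 := abs_le.1 ((PiLp.norm_apply_le z 0).trans (hR z hz))
      rw [Metric.mem_ball, Real.dist_eq, abs_lt] at hy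
      exact mul_le_mul_of_nonneg_left (hC _ ⟨by linarith, by linarith⟩) (hJ.nonneg z)
  · exact hJ.isSmoothKernel.integrable.mul_const C
  · refine Eventually.of_forall fun z y _ => ?_
    have h1 : HasDerivAt m (deriv m (y - z 0)) (y - z 0) :=
      (hm.differentiable one_ne_zero _).hasDerivAt
    have h2 : HasDerivAt (fun y => y - z 0) 1 y := (hasDerivAt_id y).sub_const _
    simpa using (h1.comp y h2).const_mul (J z)

theorem IsKernel.tendsto_avg (hJ : IsKernel J) (hm : Measurable m) {C l : ℝ}
    (hC : ∀ x, |m x| ≤ C) {f : Filter ℝ} [f.IsCountablyGenerated]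
    (hf : ∀ t : ℝ, Tendsto (fun x => x - t) f f)
    (hl : Tendsto m f (𝓝 l)) : Tendsto (avg J m) f (𝓝 l) := by
  have : Tendsto (fun x => ∫ z, J z * m (x - z 0)) f (𝓝 (∫ z, J z * l)) := by
    refine tendsto_integral_filter_of_dominated_convergence (fun z => J z * C)
      (Eventually.of_forall fun x => (hJ.integrable_avg hm hC x).aestronglyMeasurable)
      (Eventually.of_forall fun x => Eventually.of_forall fun z => ?_)
      (hJ.isSmoothKernel.integrable.mul_const C)
      (Eventually.of_forall fun z => (hl.comp (hf (z 0))).const_mul (J z))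
    rw [norm_mul, Real.norm_of_nonneg (hJ.nonneg z)]
    exact mul_le_mul_of_nonneg_left (hC _) (hJ.nonneg z)
  rwa [integral_mul_const, hJ.integral_eq_one, one_mul] at this

theorem mobility_lt_one {l : ℝ} (hl : 0 < l) (hβ : 0 < β) (h : l = Real.tanh (β * l)) :
    β * (1 - l ^ 2) < 1 := by
  set y := β * l with hy
  have hy0 : 0 < y := by positivity
  have hc := Real.cosh_pos y
  have hs : y < Real.sinh y := Real.self_lt_sinh_iff.2 hy0
  have h1 := Real.one_le_cosh y
  have e1 : 1 - l ^ 2 = 1 / Real.cosh y ^ 2 := by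
    rw [h, Real.tanh_eq_sinh_div_cosh]
    field_simp
    linarith [Real.cosh_sq_sub_sinh_sq y]
  have e2 : l = Real.sinh y / Real.cosh y := by rw [← Real.tanh_eq_sinh_div_cosh]; exact h
  have e3 : l * (β * (1 - l ^ 2)) < l * 1 := by
    rw [← mul_assoc, mul_comm l β, ← hy, e1, mul_one, e2, mul_one_div,
      div_lt_div_iff₀ (by positivity) hc]
    nlinarith [mul_pos hc hc, mul_pos hy0 hc]
  exact lt_of_mul_lt_mul_left e3 hl.le

theorem IsFront.exists_limits (hm : IsFront β mβ J m) (h : IsPosMinimizer β mβ)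
    (hJ : IsKernel J) (hβ : 0 < β) : ∃ l l', 0 < l ∧ 0 < l' ∧ Tendsto m atTop (𝓝 l) ∧
      Tendsto m atBot (𝓝 (-l')) ∧ l = Real.tanh (β * l) ∧ l' = Real.tanh (β * l') := by
  obtain ⟨a1, a2, a3, a4, ⟨l, hl, a5⟩, ⟨l', hl', a6⟩⟩ := isAdmissible_iff.1 hm.admissible
  have hcont : Continuous Real.tanh := contDiff_tanh.continuous
  refine ⟨l, l', hl, hl', a5, a6, ?_, ?_⟩
  · have h1 := hJ.tendsto_avg a1 hm.abs_le_one
      (fun t => tendsto_atTop_add_const_right _ (-t) tendsto_id) a5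
    exact tendsto_nhds_unique (a5.congr (hm.eq_tanh h hJ hβ))
      ((hcont.tendsto _).comp (h1.const_mul β))
  · have h1 := hJ.tendsto_avg a1 hm.abs_le_one
      (fun t => tendsto_atBot_add_const_right _ (-t) tendsto_id) a6
    have := tendsto_nhds_unique (a6.congr (hm.eq_tanh h hJ hβ))
      ((hcont.tendsto _).comp (h1.const_mul β))
    rw [mul_neg, Real.tanh_neg] at this
    exact neg_injective this

end Profile

section Profile

variable {d : ℕ} {J : Space d → ℝ} {β mβ : ℝ} {m : ℝ → ℝ}

theorem IsFront.contDiff (hm : IsFront β mβ J m) (h : IsPosMinimizer β mβ)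
    (hJ : IsKernel J) (hβ : 0 < β) : ContDiff ℝ ∞ m := by
  rw [funext (hm.eq_tanh h hJ hβ)]
  exact contDiff_tanh.comp (contDiff_const.mul (hJ.contDiff_avg hm.continuous))

theorem IsFront.deriv_eq (hm : IsFront β mβ J m) (h : IsPosMinimizer β mβ)
    (hJ : IsKernel J) (hβ : 0 < β) (x : ℝ) :
    deriv m x = β * (1 - m x ^ 2) * avg J (deriv m) x := by
  have h1 := (hasDerivAt_tanh (β * avg J m x)).comp x
    ((hJ.hasDerivAt_avg ((hm.contDiff h hJ hβ).of_le (by norm_num)) x).const_mul β)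
  have h2 : Real.tanh ∘ (fun x => β * avg J m x) = m :=
    (funext (hm.eq_tanh h hJ hβ)).symm
  rw [h2, ← hm.eq_tanh h hJ hβ] at h1
  rw [h1.deriv]
  ring

theorem IsFront.exists_bound (hm : IsFront β mβ J m) (h : IsPosMinimizer β mβ)
    (hJ : IsKernel J) (hβ : 0 < β) : ∃ ρ < 1, ∀ x, |m x| ≤ ρ := by
  obtain ⟨l, l', hl, hl', t1, t2, e1, e2⟩ := hm.exists_limits h hJ hβ
  have hmono := hm.monotone h hJ hβ
  refine ⟨max l l', max_lt (by rw [e1]; exact Real.tanh_lt_one _)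
    (by rw [e2]; exact Real.tanh_lt_one _), fun x => abs_le.2 ⟨?_, ?_⟩⟩
  · linarith [hmono.le_of_tendsto t2 x, le_max_right l l']
  · exact (hmono.ge_of_tendsto t1 x).trans (le_max_left _ _)

theorem one_sub_sq_pos_of_bound {a ρ : ℝ} (hρ : ρ < 1) (h : |a| ≤ ρ) :
    1 - ρ ^ 2 ≤ 1 - a ^ 2 ∧ 0 < 1 - ρ ^ 2 := by
  have h0 := (abs_nonneg a).trans h
  have h1 := sq_le_sq' (by linarith [neg_abs_le a]) ((le_abs_self a).trans h)
  constructor <;> nlinarith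

theorem IsFront.deriv_pos (hm : IsFront β mβ J m) (h : IsPosMinimizer β mβ)
    (hJ : IsKernel J) (hβ : 0 < β) (x : ℝ) : 0 < deriv m x := by
  have hmono := hm.monotone h hJ hβ
  have h0 : ∀ x, 0 ≤ deriv m x := fun x => hmono.deriv_nonneg
  refine (h0 x).lt_of_ne' fun hx => ?_
  have hc : Continuous (deriv m) := (hm.contDiff h hJ hβ).continuous_deriv (by simp)
  obtain ⟨ρ, hρ, hb⟩ := hm.exists_bound h hJ hβ
  have hall := hJ.eq_zero_of_spread hc h0 (fun y hy => by
    have := hm.deriv_eq h hJ hβ y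
    rw [hy, eq_comm, mul_eq_zero] at this
    refine this.resolve_left (mul_pos hβ ?_).ne'
    have := one_sub_sq_pos_of_bound hρ (hb y)
    linarith) hx
  have hconst := is_const_of_deriv_eq_zero
    ((hm.contDiff h hJ hβ).differentiable (by simp)) hall
  obtain ⟨l, l', hl, hl', t1, t2, e1, e2⟩ := hm.exists_limits h hJ hβ
  have : m = fun _ => m 0 := funext fun y => hconst y 0
  rw [this] at t1 t2
  have := tendsto_nhds_unique t1 tendsto_const_nhds
  have := tendsto_nhds_unique t2 tendsto_const_nhds
  linarith

theorem IsFront.exists_contraction (hm : IsFront β mβ J m) (h : IsPosMinimizer β mβ)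
    (hJ : IsKernel J) (hβ : 0 < β) :
    ∃ X q, 0 ≤ X ∧ 0 < q ∧ q < 1 ∧ ∀ x, X ≤ |x| → β * (1 - m x ^ 2) ≤ q := by
  obtain ⟨l, l', hl, hl', t1, t2, e1, e2⟩ := hm.exists_limits h hJ hβ
  have g1 : Tendsto (fun x => β * (1 - m x ^ 2)) atTop (𝓝 (β * (1 - l ^ 2))) :=
    ((t1.pow 2).const_sub 1).const_mul β
  have g2 : Tendsto (fun x => β * (1 - m x ^ 2)) atBot (𝓝 (β * (1 - l' ^ 2))) := by
    simpa using ((t2.pow 2).const_sub 1).const_mul β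
  obtain ⟨q, hq1, hq2⟩ := exists_between (max_lt (max_lt (mobility_lt_one hl hβ e1)
    (mobility_lt_one hl' hβ e2)) one_pos)
  obtain ⟨A, hA⟩ := eventually_atTop.1
    (g1.eventually_le_const ((le_max_left _ _).trans (le_max_left _ _) |>.trans_lt hq1))
  obtain ⟨B, hB⟩ := eventually_atBot.1
    (g2.eventually_le_const ((le_max_right _ _).trans (le_max_left _ _) |>.trans_lt hq1))
  refine ⟨max (max A (-B)) 0, q, le_max_right _ _, (le_max_right _ _).trans_lt hq1, hq2,
    fun x hx => ?_⟩
  have h1 : A ≤ |x| := ((le_max_left _ _).trans (le_max_left _ _)).trans hx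
  have h2 : -B ≤ |x| := ((le_max_right _ _).trans (le_max_left _ _)).trans hx
  rcases le_total 0 x with h0 | h0
  · rw [abs_of_nonneg h0] at h1
    exact hA x h1
  · rw [abs_of_nonpos h0] at h2
    exact hB x (by linarith)

theorem IsKernel.avg_le_of_forall (hJ : IsKernel J) {R : ℝ} (hR : ∀ z, J z ≠ 0 → ‖z‖ ≤ R)
    {h : ℝ → ℝ} (hc : Continuous h) {x C : ℝ} (hC : ∀ y, |y - x| ≤ R → h y ≤ C) :
    avg J h x ≤ C := by
  have h1 : avg J h x ≤ ∫ z, J z * C := by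
    have hcont : Continuous fun z : Space d => J z * h (x - z 0) := by
      have := hJ.smooth.continuous
      fun_prop
    refine integral_mono (hcont.integrable_of_hasCompactSupport hJ.compactSupport.mul_right)
      (hJ.isSmoothKernel.integrable.mul_const C) fun z => ?_
    by_cases hz : J z = 0
    · simp [hz]
    · refine mul_le_mul_of_nonneg_left (hC _ ?_) (hJ.nonneg z)
      rw [sub_sub_cancel_left, abs_neg]
      exact (PiLp.norm_apply_le z 0).trans (hR z hz)
  rwa [integral_mul_const, hJ.integral_eq_one, one_mul] at h1

theorem IsFront.exists_deriv_bound (hm : IsFront β mβ J m) (h : IsPosMinimizer β mβ)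
    (hJ : IsKernel J) (hβ : 0 < β) : ∃ M, 0 < M ∧ ∀ x, deriv m x ≤ M := by
  obtain ⟨R, hR0, hR⟩ := hJ.exists_radius
  obtain ⟨K, hK⟩ := hJ.hasCompactSupport_projKernel.exists_bound_of_continuous
    hJ.continuous_projKernel
  have hK0 : 0 ≤ K := (norm_nonneg _).trans (hK 0)
  have hcd := hm.contDiff h hJ hβ
  have hc : Continuous (deriv m) := hcd.continuous_deriv (by simp)
  have hψ := hm.deriv_pos h hJ hβ
  refine ⟨β * (K * 2) + 1, by positivity, fun x => ?_⟩
  have h1 : avg J (deriv m) x ≤ K * 2 := by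
    have hint : Integrable fun z : Space d => J z * deriv m (x - z 0) := by
      have := hJ.smooth.continuous
      have hcont : Continuous fun z : Space d => J z * deriv m (x - z 0) := by fun_prop
      exact hcont.integrable_of_hasCompactSupport hJ.compactSupport.mul_right
    have hii : ∀ a b, IntervalIntegrable (fun y => deriv m (x - y)) volume a b := fun a b =>
      Continuous.intervalIntegrable (by fun_prop) a b
    rw [avg, integral_kernel_mul_fst (h := fun y => deriv m (x - y)) hint]
    calc ∫ y, projKernel J y * deriv m (x - y)
        = ∫ y in Icc (-R) R, projKernel J y * deriv m (x - y) := by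
          refine (setIntegral_eq_integral_of_forall_compl_eq_zero fun y hy => ?_).symm
          rw [IsKernel.projKernel_eq_zero hR, zero_mul]
          by_contra! hc
          exact hy (abs_le.1 hc)
      _ ≤ ∫ y in Icc (-R) R, K * deriv m (x - y) := by
          have := hJ.continuous_projKernel
          refine setIntegral_mono_on (Continuous.integrableOn_Icc (by fun_prop))
            (Continuous.integrableOn_Icc (by fun_prop)) measurableSet_Icc fun y _ => ?_
          exact mul_le_mul_of_nonneg_right ((le_abs_self _).trans (hK _)) (hψ _).le
      _ = K * (m (x + R) - m (x - R)) := by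
          rw [integral_const_mul, integral_Icc_eq_integral_Ioc,
            ← intervalIntegral.integral_of_le (by linarith),
            intervalIntegral.integral_comp_sub_left (fun y => deriv m y),
            intervalIntegral.integral_deriv_eq_sub' m rfl
              (fun y _ => (hcd.differentiable (by simp)) y) hc.continuousOn]
          simp
      _ ≤ K * 2 := by
          have a1 := abs_le.1 (hm.abs_le_one (x + R))
          have a2 := abs_le.1 (hm.abs_le_one (x - R))
          exact mul_le_mul_of_nonneg_left (by linarith) hK0
  rw [hm.deriv_eq h hJ hβ x]
  have a1 := hm.abs_le_one x
  have a2 : 0 ≤ 1 - m x ^ 2 := by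
    have := (sq_le_one_iff_abs_le_one (m x)).2 a1
    linarith
  have a3 : β * (1 - m x ^ 2) ≤ β * 1 := mul_le_mul_of_nonneg_left
    (by linarith [sq_nonneg (m x)]) hβ.le
  have a4 : β * (1 - m x ^ 2) * avg J (deriv m) x ≤ β * (1 - m x ^ 2) * (K * 2) :=
    mul_le_mul_of_nonneg_left h1 (by positivity)
  have a5 : β * (1 - m x ^ 2) * (K * 2) ≤ β * 1 * (K * 2) :=
    mul_le_mul_of_nonneg_right a3 (by positivity)
  linarith

theorem exists_exp_decay {f : ℝ → ℝ} {M X R q : ℝ} (hM : 0 < M) (hR : 0 < R) (hq0 : 0 < q)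
    (hq1 : q < 1) (hf : ∀ (n : ℕ) x, (n = 0 ∨ X + n * R ≤ |x|) → f x ≤ M * q ^ n) :
    ∃ M' γ, 0 < M' ∧ 0 < γ ∧ ∀ x, f x ≤ M' * Real.exp (-(γ * |x|)) := by
  have hlog : 0 < -Real.log q := neg_pos.2 (Real.log_neg hq0 hq1)
  refine ⟨M * Real.exp (-Real.log q / R * (X + R)), -Real.log q / R, by positivity,
    by positivity, fun x => ?_⟩
  have h1 := hf ⌊(|x| - X) / R⌋₊ x (by
    by_cases h0 : ⌊(|x| - X) / R⌋₊ = 0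
    · exact Or.inl h0
    · right
      have hpos : 0 ≤ (|x| - X) / R := by
        by_contra! hneg
        exact h0 (Nat.floor_of_nonpos hneg.le)
      have := Nat.floor_le hpos
      rw [le_div_iff₀ hR] at this
      linarith)
  refine h1.trans ?_
  rw [mul_assoc]
  refine mul_le_mul_of_nonneg_left ?_ hM.le
  rw [← Real.exp_add]
  have h2 := Nat.lt_floor_add_one ((|x| - X) / R)
  set n := ⌊(|x| - X) / R⌋₊
  rw [div_lt_iff₀ hR] at h2
  rw [← Real.exp_log (pow_pos hq0 n), Real.log_pow]
  refine Real.exp_le_exp.2 ?_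
  have h3 : -Real.log q / R * (|x| - X - R) ≤ -Real.log q / R * (n * R) :=
    mul_le_mul_of_nonneg_left (by linarith) (by positivity)
  have h4 : -Real.log q / R * (n * R) = -(n * Real.log q) := by field_simp
  linarith

theorem IsFront.isProfile (hm : IsFront β mβ J m) (h : IsPosMinimizer β mβ)
    (hJ : IsKernel J) (hβ : 0 < β) : IsProfile β J m := by
  obtain ⟨X, q, hX, hq0, hq1, hq⟩ := hm.exists_contraction h hJ hβ
  obtain ⟨M, hM, hψM⟩ := hm.exists_deriv_bound h hJ hβ
  obtain ⟨R, hR0, hR⟩ := hJ.exists_radius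
  obtain ⟨ρ, hρ, hb⟩ := hm.exists_bound h hJ hβ
  have hc : Continuous (deriv m) := (hm.contDiff h hJ hβ).continuous_deriv (by simp)
  have hσ : ∀ x, 0 < β * (1 - m x ^ 2) := fun x => by
    have := one_sub_sq_pos_of_bound hρ (hb x)
    exact mul_pos hβ (by linarith)
  refine ⟨hm.contDiff h hJ hβ, ⟨ρ, hρ, hb⟩, hm.deriv_pos h hJ hβ, hm.deriv_eq h hJ hβ, ?_,
    ⟨X, 1 / q - 1, hX, by linarith [(one_lt_div hq0).2 hq1], fun x hx => ?_⟩⟩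
  · refine exists_exp_decay hM hR0 hq0 hq1 (X := X) fun n => ?_
    induction n with
    | zero => exact fun x _ => by simpa using hψM x
    | succ n ih =>
      intro x hx
      have hx : X + (n + 1) * R ≤ |x| := by simpa using hx
      have hnR : 0 ≤ n * R := by positivity
      rw [hm.deriv_eq h hJ hβ x]
      have h1 : avg J (deriv m) x ≤ M * q ^ n := hJ.avg_le_of_forall hR hc fun y hy => by
        refine ih y (Or.inr ?_)
        have := abs_sub_abs_le_abs_sub x y
        rw [abs_sub_comm] at hy
        linarith
      have h2 := hq x (by linarith)
      calc β * (1 - m x ^ 2) * avg J (deriv m) x ≤ β * (1 - m x ^ 2) * (M * q ^ n) :=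
            mul_le_mul_of_nonneg_left h1 (hσ x).le
        _ ≤ q * (M * q ^ n) := mul_le_mul_of_nonneg_right h2 (by positivity)
        _ = M * q ^ (n + 1) := by ring
  · rw [add_sub_cancel]
    exact one_div_le_one_div_of_le (hσ x) (hq x hx)

end Profile

/-! ### A local Poincaré inequality for the interaction form -/

section LocalForm

variable {d : ℕ} {L : ℝ} [Fact (0 < L)] {J : Space d → ℝ} {φ : Cylinder d L → ℝ}

/-- The part `|x₁| ≤ Y` of the cylinder. -/
def slab (d : ℕ) (L Y : ℝ) : Set (Cylinder d L) := {p | |p.1| ≤ Y}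

theorem measurableSet_slab (Y : ℝ) : MeasurableSet (slab d L Y) :=
  measurableSet_le (measurable_fst.abs) measurable_const

theorem add_mem_slab {p : Cylinder d L} {w : Space d} {Y C : ℝ} (hp : p ∈ slab d L Y)
    (hw : ‖w‖ ≤ C) : p + toCylinder d L w ∈ slab d L (Y + C) :=
  (abs_add_le _ _).trans (add_le_add hp ((PiLp.norm_apply_le w 0).trans hw))

theorem measurable_add_toCylinder_prod :
    Measurable fun q : Cylinder d L × Space d => q.1 + toCylinder d L q.2 :=
  measurable_fst.add (continuous_toCylinder.measurable.comp measurable_snd)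

theorem measurable_sub_toCylinder_prod :
    Measurable fun q : Cylinder d L × Space d => q.1 - toCylinder d L q.2 :=
  measurable_fst.sub (continuous_toCylinder.measurable.comp measurable_snd)

/-- The interaction form of `φ` restricted to a slab. -/
def localForm (J : Space d → ℝ) (φ : Cylinder d L → ℝ) (Y : ℝ) : ℝ≥0∞ :=
  ∫⁻ p in slab d L Y, ∫⁻ z, ENNReal.ofReal (J z * (φ p - φ (p - toCylinder d L z)) ^ 2)

/-- The mean square difference of `φ` and its translate over a slab. -/
def transDiff (φ : Cylinder d L → ℝ) (w : Space d) (Y : ℝ) : ℝ≥0∞ :=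
  ∫⁻ p in slab d L Y, ENNReal.ofReal ((φ (p + toCylinder d L w) - φ p) ^ 2)

theorem slab_mono {Y Y' : ℝ} (h : Y ≤ Y') : slab d L Y ⊆ slab d L Y' :=
  fun _ hp => le_trans hp h

theorem measurable_localForm_integrand (hJ : IsKernel J) (hφ : Measurable φ) :
    Measurable fun q : Cylinder d L × Space d =>
      ENNReal.ofReal (J q.2 * (φ q.1 - φ (q.1 - toCylinder d L q.2)) ^ 2) :=
  ((hJ.smooth.continuous.measurable.comp measurable_snd).mul
    (((hφ.comp measurable_fst).sub
      (hφ.comp measurable_sub_toCylinder_prod)).pow_const 2)).ennreal_ofReal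

theorem measurable_transDiff_integrand (hφ : Measurable φ) (w : Space d) :
    Measurable fun p : Cylinder d L => ENNReal.ofReal ((φ (p + toCylinder d L w) - φ p) ^ 2) :=
  (((hφ.comp (measurable_add_const _)).sub hφ).pow_const 2).ennreal_ofReal

theorem ofReal_sq_add_le (a b : ℝ) :
    ENNReal.ofReal ((a + b) ^ 2) ≤ 2 * ENNReal.ofReal (a ^ 2) + 2 * ENNReal.ofReal (b ^ 2) := by
  rw [show (2 : ℝ≥0∞) = ENNReal.ofReal 2 by simp, ← ENNReal.ofReal_mul (by norm_num),
    ← ENNReal.ofReal_mul (by norm_num), ← ENNReal.ofReal_add (by positivity) (by positivity)]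
  exact ENNReal.ofReal_le_ofReal (by nlinarith [sq_nonneg (a - b)])

theorem lintegral_two_mul_add {α : Type*} [MeasurableSpace α] {μ : Measure α} {f g : α → ℝ≥0∞}
    (hf : Measurable f) (hg : Measurable g) :
    ∫⁻ x, (2 * f x + 2 * g x) ∂μ = 2 * ∫⁻ x, f x ∂μ + 2 * ∫⁻ x, g x ∂μ := by
  rw [lintegral_add_left (hf.const_mul 2), lintegral_const_mul _ hf, lintegral_const_mul _ hg]

theorem setLIntegral_slab_comp_add {g : Cylinder d L → ℝ≥0∞} (hg : Measurable g) {w : Space d}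
    {Y C : ℝ} (hw : ‖w‖ ≤ C) :
    ∫⁻ p in slab d L Y, g (p + toCylinder d L w) ≤ ∫⁻ p in slab d L (Y + C), g p := by
  rw [← lintegral_indicator (measurableSet_slab _), ← lintegral_indicator (measurableSet_slab _),
    ← lintegral_comp_add (toCylinder d L w)
      (hg.indicator (measurableSet_slab (Y + C))).aemeasurable]
  refine lintegral_mono fun p => ?_
  by_cases hp : p ∈ slab d L Y
  · rw [indicator_of_mem hp, indicator_of_mem (add_mem_slab hp hw)]
  · rw [indicator_of_notMem hp]
    exact zero_le

theorem transDiff_add_le (hφ : Measurable φ) (w w' : Space d) {Y C : ℝ} (hw : ‖w'‖ ≤ C) :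
    transDiff φ (w + w') Y ≤ 2 * transDiff φ w (Y + C) + 2 * transDiff φ w' Y := by
  have h1 := setLIntegral_slab_comp_add (Y := Y) (measurable_transDiff_integrand hφ w) hw
  have hm : Measurable fun p : Cylinder d L => ENNReal.ofReal
      ((φ (p + toCylinder d L w' + toCylinder d L w) - φ (p + toCylinder d L w')) ^ 2) :=
    (measurable_transDiff_integrand hφ w).comp (measurable_add_const (toCylinder d L w'))
  calc transDiff φ (w + w') Y
      ≤ ∫⁻ p in slab d L Y, (2 * ENNReal.ofReal ((φ (p + toCylinder d L w' + toCylinder d L w) -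
          φ (p + toCylinder d L w')) ^ 2) +
        2 * ENNReal.ofReal ((φ (p + toCylinder d L w') - φ p) ^ 2)) := by
        refine lintegral_mono fun p => ?_
        refine le_trans (le_of_eq ?_) (ofReal_sq_add_le _ _)
        rw [toCylinder_add, add_comm (toCylinder d L w), ← add_assoc, sub_add_sub_cancel]
    _ = 2 * (∫⁻ p in slab d L Y, ENNReal.ofReal ((φ (p + toCylinder d L w' + toCylinder d L w) -
          φ (p + toCylinder d L w')) ^ 2)) + 2 * transDiff φ w' Y := by
        rw [lintegral_two_mul_add hm (measurable_transDiff_integrand hφ w')]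
        rfl
    _ ≤ _ := add_le_add (mul_le_mul_right h1 2) le_rfl

theorem exists_transDiff_le (hJ : IsKernel J) :
    ∃ ρ : ℝ, 0 < ρ ∧ ∃ C : ℝ≥0∞, C ≠ ⊤ ∧ ∀ φ : Cylinder d L → ℝ, Measurable φ →
      ∀ (Y : ℝ) (w : Space d), ‖w‖ ≤ ρ → transDiff φ w Y ≤ C * localForm J φ (Y + ρ) := by
  obtain ⟨z₀, r, κ, hr, hκ, hb⟩ := hJ.exists_ball
  set B := Metric.ball z₀ (r / 2) with hB
  have hBm : MeasurableSet B := measurableSet_ball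
  have hB0 : volume B ≠ 0 := (Metric.measure_ball_pos _ _ (by positivity)).ne'
  have hBt : volume B ≠ ⊤ := measure_ball_lt_top.ne
  have hκ0 : ENNReal.ofReal κ ≠ 0 := (ENNReal.ofReal_pos.2 hκ).ne'
  refine ⟨r / 2, by positivity, (ENNReal.ofReal κ * volume B)⁻¹ * 4, ?_, fun φ hφ Y w hw => ?_⟩
  · exact ENNReal.mul_ne_top (ENNReal.inv_ne_top.2 (mul_ne_zero hκ0 hB0)) (by simp)
  set F : Cylinder d L × Space d → ℝ≥0∞ := fun q =>
    ENNReal.ofReal (J q.2 * (φ q.1 - φ (q.1 - toCylinder d L q.2)) ^ 2) with hF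
  have hFm : Measurable F := measurable_localForm_integrand hJ hφ
  have hF1 : ∀ z, Measurable fun p => F (p, z) := fun z => hFm.comp measurable_prodMk_right
  have hF2 : ∀ Y', Measurable fun z => ∫⁻ p in slab d L Y', F (p, z) := fun Y' =>
    hFm.lintegral_prod_left'
  have hswap : ∀ Y', ∫⁻ z, ∫⁻ p in slab d L Y', F (p, z) = localForm J φ Y' := fun Y' => by
    rw [localForm, lintegral_lintegral_swap]
    exact (hFm.comp measurable_swap).aemeasurable
  have key : ENNReal.ofReal κ * volume B * transDiff φ w Y ≤ 4 * localForm J φ (Y + r / 2) := by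
    calc ENNReal.ofReal κ * volume B * transDiff φ w Y
        = ∫⁻ z in B, ENNReal.ofReal κ * transDiff φ w Y := by
          rw [setLIntegral_const]; ring
      _ ≤ ∫⁻ z in B, (2 * (∫⁻ p in slab d L (Y + r / 2), F (p, z + w)) +
            2 * ∫⁻ p in slab d L (Y + r / 2), F (p, z)) := by
          refine setLIntegral_mono' hBm fun z hz => ?_
          have hz : ‖z - z₀‖ < r / 2 := by rwa [hB, Metric.mem_ball, dist_eq_norm] at hz
          have k1 : κ ≤ J z := hb z (by linarith)
          have k2 : κ ≤ J (z + w) := hb _ (by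
            rw [add_sub_right_comm]
            exact (norm_add_le _ _).trans_lt (by linarith))
          rw [transDiff, ← lintegral_const_mul _ (measurable_transDiff_integrand hφ w)]
          calc _ ≤ ∫⁻ p in slab d L Y, (2 * F (p + toCylinder d L w, z + w) + 2 * F (p, z)) := by
                refine lintegral_mono fun p => ?_
                have e : φ (p + toCylinder d L w) - φ p = (φ (p + toCylinder d L w) -
                    φ (p + toCylinder d L w - toCylinder d L (z + w))) +
                    -(φ p - φ (p - toCylinder d L z)) := by
                  rw [toCylinder_add, add_sub_add_right_eq_sub]
                  ring
                have h1 := ofReal_sq_add_le (φ (p + toCylinder d L w) -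
                    φ (p + toCylinder d L w - toCylinder d L (z + w)))
                    (-(φ p - φ (p - toCylinder d L z)))
                rw [← e, neg_sq] at h1
                refine (mul_le_mul_right h1 (ENNReal.ofReal κ)).trans ?_
                rw [mul_add, mul_left_comm, mul_left_comm (ENNReal.ofReal κ) 2,
                  ← ENNReal.ofReal_mul hκ.le, ← ENNReal.ofReal_mul hκ.le]
                simp only [hF]
                gcongr
            _ = 2 * (∫⁻ p in slab d L Y, F (p + toCylinder d L w, z + w)) +
                2 * ∫⁻ p in slab d L Y, F (p, z) := by
                have hm : Measurable fun p => F (p + toCylinder d L w, z + w) :=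
                  (hF1 (z + w)).comp (measurable_add_const (toCylinder d L w))
                exact lintegral_two_mul_add hm (hF1 z)
            _ ≤ _ := add_le_add
                (mul_le_mul_right (setLIntegral_slab_comp_add (hF1 (z + w)) hw) 2)
                (mul_le_mul_right (lintegral_mono_set (slab_mono (by linarith))) 2)
      _ ≤ ∫⁻ z, (2 * (∫⁻ p in slab d L (Y + r / 2), F (p, z + w)) +
            2 * ∫⁻ p in slab d L (Y + r / 2), F (p, z)) := setLIntegral_le_lintegral _ _
      _ = 4 * localForm J φ (Y + r / 2) := by
          have hm : Measurable fun z => ∫⁻ p in slab d L (Y + r / 2), F (p, z + w) :=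
            (hF2 (Y + r / 2)).comp (measurable_add_const w)
          rw [lintegral_two_mul_add hm (hF2 _),
            lintegral_add_right_eq_self (fun z => ∫⁻ p in slab d L (Y + r / 2), F (p, z)) w,
            hswap]
          ring
  rw [mul_assoc]
  refine le_trans (le_of_eq ?_) (mul_le_mul_right key _)
  rw [← mul_assoc, ENNReal.inv_mul_cancel (mul_ne_zero hκ0 hB0)
    (ENNReal.mul_ne_top ENNReal.ofReal_ne_top hBt), one_mul]

theorem exists_transDiff_le_of_norm_le (hJ : IsKernel J) (W Y : ℝ) :
    ∃ (Y' : ℝ) (C : ℝ≥0∞), C ≠ ⊤ ∧ ∀ φ : Cylinder d L → ℝ, Measurable φ →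
      ∀ w : Space d, ‖w‖ ≤ W → transDiff φ w Y ≤ C * localForm J φ Y' := by
  obtain ⟨ρ, hρ, C, hC, h⟩ := exists_transDiff_le (L := L) hJ
  have key : ∀ (n : ℕ) (Y : ℝ), ∃ (Y' : ℝ) (C : ℝ≥0∞), C ≠ ⊤ ∧ ∀ φ : Cylinder d L → ℝ,
      Measurable φ → ∀ w : Space d, ‖w‖ ≤ 2 ^ n * ρ →
        transDiff φ w Y ≤ C * localForm J φ Y' := by
    intro n
    induction n with
    | zero => exact fun Y => ⟨Y + ρ, C, hC, fun φ hφ w hw => h φ hφ Y w (by simpa using hw)⟩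
    | succ n ih =>
      intro Y
      obtain ⟨Y', C', hC', h'⟩ := ih (Y + 2 ^ n * ρ)
      refine ⟨Y', 4 * C', ENNReal.mul_ne_top (by simp) hC', fun φ hφ w hw => ?_⟩
      have hw2 : ‖(1 / 2 : ℝ) • w‖ ≤ 2 ^ n * ρ := by
        rw [norm_smul, Real.norm_of_nonneg (by norm_num)]
        rw [pow_succ] at hw
        linarith
      have hww : w = (1 / 2 : ℝ) • w + (1 / 2 : ℝ) • w := by rw [← add_smul]; norm_num
      have hY : transDiff φ ((1 / 2 : ℝ) • w) Y ≤ transDiff φ ((1 / 2 : ℝ) • w) (Y + 2 ^ n * ρ) :=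
        lintegral_mono_set (slab_mono (by have := hρ.le; simp; positivity))
      calc transDiff φ w Y ≤ 2 * transDiff φ ((1 / 2 : ℝ) • w) (Y + 2 ^ n * ρ) +
            2 * transDiff φ ((1 / 2 : ℝ) • w) Y := by
            conv_lhs => rw [hww]
            exact transDiff_add_le hφ _ _ hw2
        _ ≤ 2 * transDiff φ ((1 / 2 : ℝ) • w) (Y + 2 ^ n * ρ) +
            2 * transDiff φ ((1 / 2 : ℝ) • w) (Y + 2 ^ n * ρ) := by gcongr
        _ = 4 * transDiff φ ((1 / 2 : ℝ) • w) (Y + 2 ^ n * ρ) := by ring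
        _ ≤ 4 * (C' * localForm J φ Y') := by gcongr; exact h' φ hφ _ hw2
        _ = _ := by ring
  obtain ⟨n, hn⟩ := pow_unbounded_of_one_lt (W / ρ) one_lt_two
  obtain ⟨Y', C', hC', h'⟩ := key n Y
  refine ⟨Y', C', hC', fun φ hφ w hw => h' φ hφ w (hw.trans ?_)⟩
  rw [div_lt_iff₀ hρ] at hn
  exact hn.le

theorem norm_le_of_mem_strip {w : Space d} (hw : w ∈ strip d L 0) : ‖w‖ ≤ |w 0| + d * L := by
  have hL : 0 < L := Fact.out
  rw [EuclideanSpace.norm_eq]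
  refine Real.sqrt_le_iff.2 ⟨by positivity, ?_⟩
  rw [Fin.sum_univ_succ]
  have h1 : ∑ j : Fin d, ‖w j.succ‖ ^ 2 ≤ d * L ^ 2 := by
    calc ∑ j : Fin d, ‖w j.succ‖ ^ 2 ≤ ∑ _j : Fin d, L ^ 2 := by
          refine Finset.sum_le_sum fun j _ => pow_le_pow_left₀ (norm_nonneg _) ?_ 2
          have := hw j
          simp only [Pi.zero_apply, zero_add] at this
          rw [Real.norm_of_nonneg this.1.le]
          exact this.2
      _ = d * L ^ 2 := by simp
  have h2 : (d : ℝ) ≤ d ^ 2 := by exact_mod_cast Nat.le_self_pow two_ne_zero d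
  have h3 : 0 ≤ |w 0| * (d * L) := by positivity
  have h4 := mul_le_mul_of_nonneg_right h2 (sq_nonneg L)
  rw [Real.norm_eq_abs]
  nlinarith

/-- A Poincaré inequality on slabs. -/
theorem exists_poincare (hJ : IsKernel J) (X : ℝ) :
    ∃ (Y : ℝ) (C : ℝ≥0∞), C ≠ ⊤ ∧ ∀ φ : Cylinder d L → ℝ, Measurable φ →
      ∫⁻ q in slab d L X, ∫⁻ p in slab d L X, ENNReal.ofReal ((φ p - φ q) ^ 2) ≤
        C * localForm J φ Y := by
  obtain ⟨Y, C, hC, h⟩ := exists_transDiff_le_of_norm_le (L := L) hJ (2 * X + d * L) X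
  set S : Set (Space d) := strip d L 0 ∩ {w | |w 0| ≤ 2 * X} with hS
  have hS0 : MeasurableSet {w : Space d | |w 0| ≤ 2 * X} :=
    measurableSet_le (by fun_prop : Measurable fun w : Space d => |w 0|) measurable_const
  have hSm : MeasurableSet S := (measurableSet_strip 0).inter hS0
  have hSn : ∀ w ∈ S, ‖w‖ ≤ 2 * X + d * L := fun w hw =>
    (norm_le_of_mem_strip hw.1).trans (add_le_add hw.2 le_rfl)
  have hSv : volume S ≠ ⊤ := (lt_of_le_of_lt (measure_mono fun w hw =>
    mem_closedBall_zero_iff.2 (hSn w hw)) measure_closedBall_lt_top).ne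
  refine ⟨Y, volume S * C, ENNReal.mul_ne_top hSv hC, fun φ hφ => ?_⟩
  have hm : ∀ q, Measurable ((slab d L X).indicator fun p => ENNReal.ofReal ((φ p - φ q) ^ 2)) :=
    fun q => ((hφ.sub_const _).pow_const 2).ennreal_ofReal.indicator (measurableSet_slab X)
  calc ∫⁻ q in slab d L X, ∫⁻ p in slab d L X, ENNReal.ofReal ((φ p - φ q) ^ 2)
      ≤ ∫⁻ q in slab d L X, ∫⁻ w in S,
          ENNReal.ofReal ((φ (q + toCylinder d L w) - φ q) ^ 2) := by
        refine setLIntegral_mono' (measurableSet_slab X) fun q hq => ?_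
        rw [← lintegral_indicator (measurableSet_slab X),
          ← lintegral_strip_add 0 q (hm q).aemeasurable,
          ← lintegral_indicator (measurableSet_strip 0), ← lintegral_indicator hSm]
        refine lintegral_mono fun w => ?_
        by_cases h1 : w ∈ strip d L 0
        · rw [indicator_of_mem h1]
          by_cases h2 : q + toCylinder d L w ∈ slab d L X
          · rw [indicator_of_mem h2, indicator_of_mem]
            refine ⟨h1, show |w 0| ≤ 2 * X from ?_⟩
            have e1 := abs_le.1 (show |q.1 + w 0| ≤ X from h2)
            have e2 := abs_le.1 (show |q.1| ≤ X from hq)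
            exact abs_le.2 ⟨by linarith, by linarith⟩
          · rw [indicator_of_notMem h2]
            exact zero_le
        · rw [indicator_of_notMem h1]
          exact zero_le
    _ = ∫⁻ w in S, transDiff φ w X := by
        rw [lintegral_lintegral_swap]
        · rfl
        · exact (((hφ.comp measurable_add_toCylinder_prod).sub
            (hφ.comp measurable_fst)).pow_const 2).ennreal_ofReal.aemeasurable
    _ ≤ ∫⁻ w in S, C * localForm J φ Y := setLIntegral_mono' hSm fun w hw => h φ hφ w (hSn w hw)
    _ = _ := by rw [setLIntegral_const]; ring

end LocalForm

/-! ### The linearized operator of a profile -/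

section LinearOperator

variable {d : ℕ} {L : ℝ} [Fact (0 < L)] {J : Space d → ℝ} {β : ℝ} {m : ℝ → ℝ}
  {v w : Cylinder d L → ℝ}

theorem integrable_exp_neg_mul_abs {c : ℝ} (hc : 0 < c) :
    Integrable fun x : ℝ => Real.exp (-(c * |x|)) := by
  refine (integrable_inv_one_add_sq.const_mul (max 1 (2 / c ^ 2))).mono'
    (by fun_prop) (Eventually.of_forall fun x => ?_)
  rw [Real.norm_of_nonneg (Real.exp_pos _).le, Real.exp_neg, ← div_eq_mul_inv,
    inv_eq_one_div, div_le_div_iff₀ (Real.exp_pos _) (by positivity), one_mul]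
  have h1 := Real.quadratic_le_exp_of_nonneg (show 0 ≤ c * |x| by positivity)
  have h2 : 1 + (c * |x|) ^ 2 / 2 ≤ Real.exp (c * |x|) := by
    have : 0 ≤ c * |x| := by positivity
    linarith
  have h3 : 1 + x ^ 2 ≤ max 1 (2 / c ^ 2) * (1 + (c * |x|) ^ 2 / 2) := by
    rw [mul_pow, sq_abs]
    have e : 2 / c ^ 2 * (c ^ 2 * x ^ 2 / 2) = x ^ 2 := by field_simp
    have k1 := le_max_left 1 (2 / c ^ 2)
    have k2 := mul_le_mul_of_nonneg_right (le_max_right 1 (2 / c ^ 2))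
      (show 0 ≤ c ^ 2 * x ^ 2 / 2 by positivity)
    linarith
  exact h3.trans (mul_le_mul_of_nonneg_left h2 (by positivity))

/-- The reciprocal of the mobility along a profile. -/
def invMobility (β : ℝ) (m : ℝ → ℝ) (x : ℝ) : ℝ := 1 / (β * (1 - m x ^ 2))

theorem opB_eq (v : Cylinder d L → ℝ) (p : Cylinder d L) :
    opB β J m v p = invMobility β m p.1 * v p - cylConv J v p := by
  rw [opB, invMobility, one_div_mul_eq_div]

namespace IsProfile

theorem one_sub_sq_pos (hp : IsProfile β J m) (x : ℝ) : 0 < 1 - m x ^ 2 := by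
  obtain ⟨ρ, hρ, hb⟩ := hp.exists_bound
  have := one_sub_sq_pos_of_bound hρ (hb x)
  linarith

theorem continuous (hp : IsProfile β J m) : Continuous m := hp.contDiff.continuous

theorem continuous_deriv (hp : IsProfile β J m) : Continuous (deriv m) :=
  hp.contDiff.continuous_deriv (by simp)

theorem exists_deriv_bound (hp : IsProfile β J m) : ∃ M, 0 < M ∧ ∀ x, deriv m x ≤ M := by
  obtain ⟨M, γ, hM, hγ, h⟩ := hp.deriv_decay
  refine ⟨M, hM, fun x => (h x).trans ?_⟩
  exact mul_le_of_le_one_right hM.le (Real.exp_le_one_iff.2 (by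
    have : 0 ≤ γ * |x| := by positivity
    linarith))

theorem invMobility_pos (hp : IsProfile β J m) (hβ : 0 < β) (x : ℝ) : 0 < invMobility β m x :=
  one_div_pos.2 (mul_pos hβ (hp.one_sub_sq_pos x))

theorem exists_invMobility_le (hp : IsProfile β J m) (hβ : 0 < β) :
    ∃ B, 0 < B ∧ ∀ x, invMobility β m x ≤ B := by
  obtain ⟨ρ, hρ, hb⟩ := hp.exists_bound
  have h0 := (one_sub_sq_pos_of_bound hρ (hb 0)).2
  exact ⟨1 / (β * (1 - ρ ^ 2)), by positivity, fun x =>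
    one_div_le_one_div_of_le (by positivity)
      (mul_le_mul_of_nonneg_left (one_sub_sq_pos_of_bound hρ (hb x)).1 hβ.le)⟩

theorem contDiff_invMobility (hp : IsProfile β J m) (hβ : 0 < β) :
    ContDiff ℝ ∞ (invMobility β m) :=
  contDiff_const.div (contDiff_const.mul (contDiff_const.sub (hp.contDiff.pow 2)))
    fun x => (mul_pos hβ (hp.one_sub_sq_pos x)).ne'

theorem continuous_invMobility (hp : IsProfile β J m) (hβ : 0 < β) :
    Continuous (invMobility β m) := (hp.contDiff_invMobility hβ).continuous

theorem invMobility_mul_deriv (hp : IsProfile β J m) (hβ : 0 < β) (x : ℝ) :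
    invMobility β m x * deriv m x = avg J (deriv m) x := by
  have := (mul_pos hβ (hp.one_sub_sq_pos x)).ne'
  rw [hp.deriv_eq x, invMobility, ← mul_assoc, one_div_mul_cancel this, one_mul]

theorem deriv_invMobility (hp : IsProfile β J m) (hβ : 0 < β) (x : ℝ) :
    deriv (invMobility β m) x = 2 * β * m x * invMobility β m x ^ 2 * deriv m x := by
  have h0 := (mul_pos hβ (hp.one_sub_sq_pos x)).ne'
  have h1 : HasDerivAt m (deriv m x) x := (hp.contDiff.differentiable (by simp) x).hasDerivAt
  have h2 : HasDerivAt (fun x => β * (1 - m x ^ 2)) (β * -(2 * m x * deriv m x)) x := by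
    simpa using ((h1.pow 2).const_sub 1).const_mul β
  have h3 := (h2.inv h0).deriv
  have e : invMobility β m = (fun x => β * (1 - m x ^ 2))⁻¹ := by
    ext y; simp [invMobility]
  rw [e, h3, Pi.inv_apply]
  field_simp

theorem exists_abs_deriv_invMobility_le (hp : IsProfile β J m) (hβ : 0 < β) :
    ∃ C, 0 < C ∧ ∀ x, |deriv (invMobility β m) x| ≤ C * deriv m x := by
  obtain ⟨B, hB, hb⟩ := hp.exists_invMobility_le hβ
  refine ⟨2 * β * 1 * B ^ 2, by positivity, fun x => ?_⟩
  rw [hp.deriv_invMobility hβ, abs_mul, abs_of_pos (hp.deriv_pos x)]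
  refine mul_le_mul_of_nonneg_right ?_ (hp.deriv_pos x).le
  rw [abs_mul, abs_mul, abs_of_pos (by positivity : 0 < 2 * β),
    abs_of_nonneg (sq_nonneg (invMobility β m x))]
  have h1 : |m x| ≤ 1 := by
    rw [← sq_le_one_iff_abs_le_one]
    linarith [hp.one_sub_sq_pos x]
  have h2 := pow_le_pow_left₀ (hp.invMobility_pos hβ x).le (hb x) 2
  exact mul_le_mul (mul_le_mul_of_nonneg_left h1 (by positivity)) h2 (sq_nonneg _) (by positivity)

end IsProfile

theorem memLp_bdd_mul {b : ℝ → ℝ} (hb : Continuous b) {C : ℝ} (hC : ∀ x, |b x| ≤ C)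
    (hv : MemLp v 2 volume) : MemLp (fun p => b p.1 * v p) 2 volume := by
  have h1 : AEStronglyMeasurable (fun p : Cylinder d L => b p.1) volume :=
    (hb.comp continuous_fst).aestronglyMeasurable
  refine MemLp.of_le_mul (c := C) hv (h1.mul hv.1) (Eventually.of_forall fun p => ?_)
  rw [norm_mul]
  exact mul_le_mul_of_nonneg_right (hC _) (norm_nonneg _)

theorem IsProfile.memLp_invMobility_mul (hp : IsProfile β J m) (hβ : 0 < β)
    (hv : MemLp v 2 volume) : MemLp (fun p => invMobility β m p.1 * v p) 2 volume := by
  obtain ⟨B, hB, hb⟩ := hp.exists_invMobility_le hβ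
  exact memLp_bdd_mul (hp.continuous_invMobility hβ) (fun x => by
    rw [abs_of_pos (hp.invMobility_pos hβ x)]
    exact hb x) hv

theorem IsProfile.memLp_opB (hp : IsProfile β J m) (hβ : 0 < β) (hJ : IsKernel J)
    (hv : MemLp v 2 volume) : MemLp (opB β J m v) 2 volume := by
  rw [funext (opB_eq v)]
  exact (hp.memLp_invMobility_mul hβ hv).sub (memLp_cylConv hJ.isSmoothKernel.integrable hv)

theorem IsKernel.integral_cylConv_mul_comm (hJ : IsKernel J) (hv : MemLp v 2 volume)
    (hw : MemLp w 2 volume) : ∫ p, cylConv J v p * w p = ∫ p, v p * cylConv J w p := by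
  rw [integral_cylConv_mul hJ.isSmoothKernel.integrable hv hw]
  simp only [hJ.even]

theorem IsProfile.integral_opB_mul_comm (hp : IsProfile β J m) (hβ : 0 < β) (hJ : IsKernel J)
    (hv : MemLp v 2 volume) (hw : MemLp w 2 volume) :
    ∫ p, opB β J m v p * w p = ∫ p, v p * opB β J m w p := by
  have hK := hJ.isSmoothKernel.integrable
  have i1 := integrable_fun_mul (hp.memLp_invMobility_mul hβ hv) hw
  have i2 := integrable_fun_mul (memLp_cylConv hK hv) hw
  have i3 := integrable_fun_mul hv (hp.memLp_invMobility_mul hβ hw)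
  have i4 := integrable_fun_mul hv (memLp_cylConv hK hw)
  simp only [opB_eq, sub_mul, mul_sub]
  rw [integral_sub i1 i2, integral_sub i3 i4, hJ.integral_cylConv_mul_comm hv hw]
  congr 1
  exact integral_congr_ae (Eventually.of_forall fun p => by ring)

theorem opB_congr_ae (h : v =ᵐ[volume] w) : opB β J m v =ᵐ[volume] opB β J m w := by
  filter_upwards [h] with p hp
  rw [opB_eq, opB_eq, hp, cylConv_congr_ae h]

theorem IsProfile.opB_deriv (hp : IsProfile β J m) (hβ : 0 < β) (p : Cylinder d L) :
    opB β J m (fun q => deriv m q.1) p = 0 := by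
  rw [opB_eq, hp.invMobility_mul_deriv hβ]
  exact sub_self _

theorem IsProfile.memLp_deriv (hp : IsProfile β J m) :
    MemLp (fun p : Cylinder d L => deriv m p.1) 2 volume := by
  obtain ⟨M, γ, hM, hγ, h⟩ := hp.deriv_decay
  have h1 : MemLp (deriv m) 2 volume := by
    refine (memLp_two_iff_integrable_sq hp.continuous_deriv.aestronglyMeasurable).2 ?_
    refine ((integrable_exp_neg_mul_abs (c := 2 * γ) (by positivity)).const_mul (M ^ 2)).mono'
      (by have := hp.continuous_deriv; fun_prop) (Eventually.of_forall fun x => ?_)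
    rw [Real.norm_of_nonneg (sq_nonneg _)]
    refine (pow_le_pow_left₀ (hp.deriv_pos x).le (h x) 2).trans (le_of_eq ?_)
    rw [mul_pow, ← Real.exp_nat_mul]
    congr 2
    push_cast
    ring
  exact h1.comp_fst volume

theorem IsProfile.opB_sub_const_mul_deriv (hp : IsProfile β J m) (hβ : 0 < β) (hJ : IsKernel J)
    (hv : MemLp v 2 volume) (c : ℝ) :
    opB β J m (fun p => v p - c * deriv m p.1) =ᵐ[volume] opB β J m v := by
  have h1 := cylConv_sub (K := J) hJ.isSmoothKernel.integrable hv
    (hp.memLp_deriv.const_mul c)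
  filter_upwards [h1] with p h
  have h2 := hp.opB_deriv (L := L) hβ p
  rw [opB_eq] at h2
  rw [opB_eq, opB_eq, h, cylConv_const_mul]
  linear_combination -c * h2

theorem IsProfile.integral_sub_const_mul_deriv (hp : IsProfile β J m) (hβ : 0 < β)
    (hJ : IsKernel J) (hv : MemLp v 2 volume) (c : ℝ) :
    ∫ p, (v p - c * deriv m p.1) * opB β J m (fun p => v p - c * deriv m p.1) p =
      ∫ p, v p * opB β J m v p := by
  have h1 := hp.opB_sub_const_mul_deriv hβ hJ hv c
  have hB := hp.memLp_opB hβ hJ hv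
  have hψ := hp.memLp_deriv (L := L)
  have h2 : ∫ p, (v p - c * deriv m p.1) * opB β J m (fun p => v p - c * deriv m p.1) p =
      ∫ p, (v p * opB β J m v p - c * (deriv m p.1 * opB β J m v p)) := by
    refine integral_congr_ae ?_
    filter_upwards [h1] with p hp
    rw [hp]; ring
  rw [h2, integral_sub (integrable_fun_mul hv hB) ((integrable_fun_mul hψ hB).const_mul c),
    integral_const_mul, ← hp.integral_opB_mul_comm hβ hJ hψ hv]
  simp [hp.opB_deriv hβ]

theorem IsKernel.integral_mul_cylConv_le (hJ : IsKernel J) (hv : MemLp v 2 volume) :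
    ∫ p, v p * cylConv J v p ≤ ∫ p, v p ^ 2 := by
  have hK := hJ.isSmoothKernel.integrable
  have h1 := sq_integral_mul_le hv (memLp_cylConv hK hv)
  have h2 := integral_cylConv_sq_le hK hv
  have e : ∫ z, |J z| = 1 := by
    rw [← hJ.integral_eq_one]
    simp only [abs_of_nonneg (hJ.nonneg _)]
  rw [e, one_pow, one_mul] at h2
  have h0 : 0 ≤ ∫ p, v p ^ 2 := integral_nonneg fun p => sq_nonneg _
  refine le_of_sq_le_sq ?_ h0
  calc _ ≤ _ := h1
    _ ≤ (∫ p, v p ^ 2) * ∫ p, v p ^ 2 := mul_le_mul_of_nonneg_left h2 h0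
    _ = _ := (sq _).symm

/-- Coercivity of the operator away from the transition layer. -/
theorem IsProfile.exists_far_bound (hp : IsProfile β J m) (hβ : 0 < β) (hJ : IsKernel J) :
    ∃ X δ : ℝ, 0 < X ∧ 0 < δ ∧ ∀ v : Cylinder d L → ℝ, MemLp v 2 volume →
      δ * ∫ p, v p ^ 2 ≤
        (∫ p, v p * opB β J m v p) + (1 + δ) * ∫ p in slab d L X, v p ^ 2 := by
  obtain ⟨X, δ, hX, hδ, hfar⟩ := hp.far
  refine ⟨X + 1, δ, by positivity, hδ, fun v hv => ?_⟩
  have hK := hJ.isSmoothKernel.integrable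
  have hv2 : Integrable fun p => v p ^ 2 := hv.integrable_sq
  have i1 : Integrable fun p => invMobility β m p.1 * v p * v p :=
    integrable_fun_mul (hp.memLp_invMobility_mul hβ hv) hv
  have i2 := integrable_fun_mul hv (memLp_cylConv hK hv)
  have i3 : Integrable ((slab d L (X + 1)).indicator fun p => v p ^ 2) :=
    hv2.indicator (measurableSet_slab _)
  have e1 : ∫ p, v p * opB β J m v p =
      (∫ p, invMobility β m p.1 * v p * v p) - ∫ p, v p * cylConv J v p := by
    rw [← integral_sub i1 i2]
    refine integral_congr_ae (Eventually.of_forall fun p => ?_)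
    simp only [opB_eq]
    ring
  have e2 := hJ.integral_mul_cylConv_le hv
  have e3 : δ * (∫ p, v p ^ 2) + ∫ p, v p ^ 2 ≤ (∫ p, invMobility β m p.1 * v p * v p) +
      (1 + δ) * ∫ p in slab d L (X + 1), v p ^ 2 := by
    rw [← integral_indicator (measurableSet_slab _), ← integral_const_mul, ← integral_const_mul,
      ← integral_add (hv2.const_mul δ) hv2, ← integral_add i1 (i3.const_mul _)]
    refine integral_mono ((hv2.const_mul δ).add hv2) (i1.add (i3.const_mul _)) fun p => ?_
    dsimp only
    have hb := (hp.invMobility_pos hβ p.1).le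
    have hs := sq_nonneg (v p)
    by_cases h : p ∈ slab d L (X + 1)
    · rw [indicator_of_mem h]
      have := mul_nonneg hb hs
      linarith
    · rw [indicator_of_notMem h]
      have h' : X ≤ |p.1| := by
        by_contra! hc
        exact h (show |p.1| ≤ X + 1 by linarith)
      have : (1 + δ) * v p ^ 2 ≤ invMobility β m p.1 * v p ^ 2 :=
        mul_le_mul_of_nonneg_right (hfar _ h') hs
      linarith
  linarith

end LinearOperator

section Gap

variable {d : ℕ} {L : ℝ} [Fact (0 < L)] {J : Space d → ℝ} {β : ℝ} {m : ℝ → ℝ}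
  {v w : Cylinder d L → ℝ}

/-- The involution `(p, z) ↦ (p - z, -z)` preserves the measure. -/
theorem measurePreserving_reflect :
    MeasurePreserving (fun q : Cylinder d L × Space d => (q.1 - toCylinder d L q.2, -q.2))
      (volume.prod volume) (volume.prod volume) := by
  have h1 : MeasurePreserving (fun q : Space d × Cylinder d L =>
      (-q.1, q.2 - toCylinder d L q.1)) (volume.prod volume) (volume.prod volume) :=
    (Measure.measurePreserving_neg (volume : Measure (Space d))).skew_product
      (g := fun z p => p - toCylinder d L z)
      (measurable_sub_toCylinder_prod.comp measurable_swap)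
      (Eventually.of_forall fun z => (measurePreserving_sub_toCylinder (toCylinder d L z)).map_eq)
  exact (Measure.measurePreserving_swap.comp h1).comp Measure.measurePreserving_swap

/-- The first term in the expansion of the quadratic form of `B`. -/
def formDensity (J : Space d → ℝ) (m : ℝ → ℝ) (v : Cylinder d L → ℝ)
    (q : Cylinder d L × Space d) : ℝ :=
  J q.2 * deriv m (q.1.1 - q.2 0) / deriv m q.1.1 * v q.1 ^ 2

theorem measurable_coord (i : Fin (d + 1)) : Measurable fun z : Space d => z i := by fun_prop

theorem IsProfile.integrable_formDensity (hp : IsProfile β J m) (hβ : 0 < β) (hJ : IsKernel J)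
    (hvm : Measurable v) (hv : MemLp v 2 volume) :
    Integrable (formDensity J m v) (volume.prod volume) ∧
      ∫ q, formDensity J m v q ∂(volume.prod volume) =
        ∫ p, invMobility β m p.1 * v p * v p := by
  have hψ := hp.continuous_deriv
  have hmeas : Measurable (formDensity (L := L) J m v) := by
    have h1 : Measurable fun q : Cylinder d L × Space d => deriv m (q.1.1 - q.2 0) :=
      hψ.measurable.comp ((measurable_fst.comp measurable_fst).sub
        ((measurable_coord 0).comp measurable_snd))
    have h2 : Measurable fun q : Cylinder d L × Space d => deriv m q.1.1 :=
      hψ.measurable.comp (measurable_fst.comp measurable_fst)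
    have h3 : Measurable fun q : Cylinder d L × Space d => J q.2 :=
      hJ.smooth.continuous.measurable.comp measurable_snd
    exact ((h3.mul h1).div h2).mul ((hvm.comp measurable_fst).pow_const 2)
  have hnn : ∀ q : Cylinder d L × Space d, 0 ≤ formDensity J m v q := fun q =>
    mul_nonneg (div_nonneg (mul_nonneg (hJ.nonneg _) (hp.deriv_pos _).le) (hp.deriv_pos _).le)
      (sq_nonneg _)
  have hz : ∀ p : Cylinder d L, Integrable fun z : Space d => J z * deriv m (p.1 - z 0) := by
    intro p
    have := hJ.smooth.continuous
    have hc : Continuous fun z : Space d => J z * deriv m (p.1 - z 0) := by fun_prop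
    exact hc.integrable_of_hasCompactSupport hJ.compactSupport.mul_right
  have hint : ∀ p : Cylinder d L, ∫ z, formDensity J m v (p, z) =
      invMobility β m p.1 * v p * v p := by
    intro p
    have e : ∀ z, formDensity J m v (p, z) =
        J z * deriv m (p.1 - z 0) * (v p ^ 2 / deriv m p.1) := fun z => by
      simp only [formDensity]; ring
    simp only [e]
    rw [integral_mul_const]
    change avg J (deriv m) p.1 * _ = _
    rw [← hp.invMobility_mul_deriv hβ]
    have := (hp.deriv_pos p.1).ne'
    field_simp
  have hI : Integrable (formDensity J m v) (volume.prod volume) := by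
    refine (integrable_prod_iff hmeas.aestronglyMeasurable).2
      ⟨Eventually.of_forall fun p => ?_, ?_⟩
    · have e : (fun z => formDensity J m v (p, z)) = fun z =>
          J z * deriv m (p.1 - z 0) * (v p ^ 2 / deriv m p.1) := by
        ext z
        simp only [formDensity]; ring
      rw [e]
      exact (hz p).mul_const _
    · simp only [Real.norm_of_nonneg (hnn _), hint]
      exact integrable_fun_mul (hp.memLp_invMobility_mul hβ hv) hv
  refine ⟨hI, ?_⟩
  rw [integral_prod _ hI]
  simp only [hint]

/-- The ground state representation of the quadratic form of `B`. -/
theorem IsProfile.lintegral_form_eq (hp : IsProfile β J m) (hβ : 0 < β) (hJ : IsKernel J)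
    (hvm : Measurable v) (hv : MemLp v 2 volume) :
    0 ≤ ∫ p, v p * opB β J m v p ∧
    ∫⁻ p : Cylinder d L, ∫⁻ z, ENNReal.ofReal (J z * (deriv m p.1 * deriv m (p.1 - z 0)) *
      (v p / deriv m p.1 - v (p - toCylinder d L z) / deriv m (p.1 - z 0)) ^ 2) =
      ENNReal.ofReal (2 * ∫ p, v p * opB β J m v p) := by
  have hK := hJ.isSmoothKernel.integrable
  obtain ⟨i1, e1⟩ := hp.integrable_formDensity hβ hJ hvm hv
  have hemb := (measurePreserving_reflect (d := d) (L := L))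
  have i2 := hemb.integrable_comp_of_integrable i1
  have e2 : ∫ q, (formDensity J m v ∘ fun q : Cylinder d L × Space d =>
      (q.1 - toCylinder d L q.2, -q.2)) q ∂(volume.prod volume) =
      ∫ q, formDensity J m v q ∂(volume.prod volume) := by
    have h := integral_map (μ := (volume : Measure (Cylinder d L)).prod volume)
      hemb.measurable.aemeasurable (f := formDensity J m v) (by rw [hemb.map_eq]; exact i1.1)
    rw [hemb.map_eq] at h
    exact h.symm
  have i3 := integrable_prod_cylConv hK hv hv
  have e3 : ∫ q : Cylinder d L × Space d, J q.2 * v (q.1 - toCylinder d L q.2) * v q.1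
      ∂(volume.prod volume) = ∫ p, v p * cylConv J v p := by
    rw [integral_prod _ i3]
    refine integral_congr_ae (Eventually.of_forall fun p => ?_)
    dsimp only
    rw [integral_mul_const, mul_comm]
    rfl
  set F : Cylinder d L × Space d → ℝ := fun q => J q.2 * (deriv m q.1.1 * deriv m (q.1.1 - q.2 0)) *
      (v q.1 / deriv m q.1.1 - v (q.1 - toCylinder d L q.2) / deriv m (q.1.1 - q.2 0)) ^ 2 with hF
  have hFe : F = fun q => formDensity J m v q + (formDensity J m v ∘ fun q =>
      (q.1 - toCylinder d L q.2, -q.2)) q -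
      2 * (J q.2 * v (q.1 - toCylinder d L q.2) * v q.1) := by
    ext q
    have h1 := (hp.deriv_pos q.1.1).ne'
    have h2 := (hp.deriv_pos (q.1.1 - q.2 0)).ne'
    have h3 : (q.1 - toCylinder d L q.2).1 = q.1.1 - q.2 0 := rfl
    simp only [hF, formDensity, Function.comp_apply, hJ.even, PiLp.neg_apply, h3,
      sub_neg_eq_add, sub_add_cancel]
    field_simp
    ring
  have hFi : Integrable F (volume.prod volume) := by
    rw [hFe]
    exact (i1.add i2).sub (i3.const_mul 2)
  have hFn : ∀ q, 0 ≤ F q := fun q =>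
    mul_nonneg (mul_nonneg (hJ.nonneg _) (mul_nonneg (hp.deriv_pos _).le (hp.deriv_pos _).le))
      (sq_nonneg _)
  have hFv : ∫ q, F q ∂(volume.prod volume) = 2 * ∫ p, v p * opB β J m v p := by
    have e4 : ∫ p, v p * opB β J m v p =
        (∫ p, invMobility β m p.1 * v p * v p) - ∫ p, v p * cylConv J v p := by
      rw [← integral_sub (integrable_fun_mul (hp.memLp_invMobility_mul hβ hv) hv)
        (integrable_fun_mul hv (memLp_cylConv hK hv))]
      refine integral_congr_ae (Eventually.of_forall fun p => ?_)
      simp only [opB_eq]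
      ring
    have i12 : Integrable (fun q => formDensity J m v q + (formDensity J m v ∘ fun q =>
      (q.1 - toCylinder d L q.2, -q.2)) q) (volume.prod volume) := i1.add i2
    rw [hFe, integral_sub i12 (i3.const_mul 2), integral_add i1 i2, integral_const_mul, e2, e1,
      e3, e4]
    ring
  constructor
  · have : 0 ≤ ∫ q, F q ∂(volume.prod volume) := integral_nonneg fun q => hFn q
    rw [hFv] at this
    linarith
  · rw [← hFv, ofReal_integral_eq_lintegral_ofReal hFi (Eventually.of_forall hFn),
      lintegral_prod _ hFi.1.aemeasurable.ennreal_ofReal]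

theorem IsProfile.exists_localForm_le (hp : IsProfile β J m) (hβ : 0 < β) (hJ : IsKernel J)
    (Y : ℝ) : ∃ C : ℝ≥0∞, C ≠ ⊤ ∧ ∀ v : Cylinder d L → ℝ, Measurable v → MemLp v 2 volume →
      localForm J (fun p => v p / deriv m p.1) Y ≤
        C * ENNReal.ofReal (∫ p, v p * opB β J m v p) := by
  obtain ⟨R, hR0, hR⟩ := hJ.exists_radius
  have hψ := hp.continuous_deriv
  obtain ⟨c, hc, hcb⟩ : ∃ c, 0 < c ∧ ∀ x ∈ Icc (-(Y + R)) (Y + R), c ≤ deriv m x := by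
    rcases (Icc (-(Y + R)) (Y + R)).eq_empty_or_nonempty with h | h
    · exact ⟨1, one_pos, fun x hx => by rw [h] at hx; exact hx.elim⟩
    · obtain ⟨x₀, -, h₀⟩ := isCompact_Icc.exists_isMinOn h hψ.continuousOn
      exact ⟨deriv m x₀, hp.deriv_pos x₀, fun x hx => h₀ hx⟩
  refine ⟨ENNReal.ofReal (1 / c ^ 2) * 2, ENNReal.mul_ne_top ENNReal.ofReal_ne_top (by simp),
    fun v hvm hv => ?_⟩
  obtain ⟨-, hform⟩ := hp.lintegral_form_eq hβ hJ hvm hv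
  rw [mul_assoc, show (2 : ℝ≥0∞) = ENNReal.ofReal 2 by simp, ← ENNReal.ofReal_mul (by norm_num),
    ← hform, ← lintegral_const_mul' _ _ ENNReal.ofReal_ne_top]
  refine le_trans (setLIntegral_mono' (measurableSet_slab Y) fun p hp' => ?_)
    (setLIntegral_le_lintegral (slab d L Y) _)
  rw [← lintegral_const_mul' _ _ ENNReal.ofReal_ne_top]
  refine lintegral_mono fun z => ?_
  rw [← ENNReal.ofReal_mul (by positivity)]
  refine ENNReal.ofReal_le_ofReal ?_
  have h3 : (p - toCylinder d L z).1 = p.1 - z 0 := rfl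
  dsimp only
  rw [h3]
  by_cases hz : J z = 0
  · simp [hz]
  · have hp1 := abs_le.1 (show |p.1| ≤ Y from hp')
    have hz1 := abs_le.1 ((PiLp.norm_apply_le z 0).trans (hR z hz))
    have k1 := hcb p.1 ⟨by linarith, by linarith⟩
    have k2 := hcb (p.1 - z 0) ⟨by linarith, by linarith⟩
    have k3 : 1 ≤ 1 / c ^ 2 * (deriv m p.1 * deriv m (p.1 - z 0)) := by
      rw [one_div_mul_eq_div, one_le_div (by positivity), sq]
      exact mul_le_mul k1 k2 hc.le (hc.le.trans k1)
    have k4 : 0 ≤ J z * (v p / deriv m p.1 -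
        v (p - toCylinder d L z) / deriv m (p.1 - z 0)) ^ 2 :=
      mul_nonneg (hJ.nonneg z) (sq_nonneg _)
    have := mul_le_mul_of_nonneg_right k3 k4
    linarith

theorem volume_slab_ne_top (Y : ℝ) : volume (slab d L Y) ≠ ⊤ := by
  have : slab d L Y ⊆ Icc (-Y) Y ×ˢ univ := fun p hp => ⟨abs_le.1 hp, mem_univ _⟩
  refine (lt_of_le_of_lt (measure_mono this) ?_).ne
  rw [Measure.volume_eq_prod, Measure.prod_prod]
  exact ENNReal.mul_lt_top (by simp) (measure_lt_top _ _)

theorem slab_volume_ne_zero {Y : ℝ} (hY : 0 < Y) : volume (slab d L Y) ≠ 0 := by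
  have h : IsOpen {p : Cylinder d L | |p.1| < Y} :=
    isOpen_lt (by fun_prop) continuous_const
  refine (lt_of_lt_of_le (h.measure_pos volume ⟨0, by simpa using hY⟩)
    (measure_mono fun p (hp : |p.1| < Y) => hp.le)).ne'

/-- The spectral gap of `B` in quadratic form. -/
theorem IsProfile.exists_gap_form (hp : IsProfile β J m) (hβ : 0 < β) (hJ : IsKernel J) :
    ∃ C : ℝ, 0 ≤ C ∧ ∀ v : Cylinder d L → ℝ, MemLp v 2 volume →
      ∫ p, v p * deriv m p.1 = 0 → ∫ p, v p ^ 2 ≤ C * ∫ p, v p * opB β J m v p := by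
  obtain ⟨X, δ, hX, hδ, hfar⟩ := hp.exists_far_bound (L := L) hβ hJ
  obtain ⟨Y, C₁, hC₁, hpoin⟩ := exists_poincare (L := L) hJ X
  obtain ⟨C₂, hC₂, hloc⟩ := hp.exists_localForm_le (L := L) hβ hJ Y
  obtain ⟨M, hM, hψM⟩ := hp.exists_deriv_bound
  set V := volume (slab d L X) with hV
  have hV0 : V ≠ 0 := slab_volume_ne_zero hX
  have hVt : V ≠ ⊤ := volume_slab_ne_top X
  set K : ℝ≥0∞ := 1 + V⁻¹ * (ENNReal.ofReal ((1 + δ) * M ^ 2) * (C₁ * C₂)) with hKdef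
  have hKt : K ≠ ⊤ := by
    refine ENNReal.add_ne_top.2 ⟨by simp, ?_⟩
    exact ENNReal.mul_ne_top (ENNReal.inv_ne_top.2 hV0)
      (ENNReal.mul_ne_top ENNReal.ofReal_ne_top (ENNReal.mul_ne_top hC₁ hC₂))
  suffices hmain : ∀ v : Cylinder d L → ℝ, Measurable v → MemLp v 2 volume →
      ∫ p, v p * deriv m p.1 = 0 → δ * ∫ p, v p ^ 2 ≤ K.toReal * ∫ p, v p * opB β J m v p by
    refine ⟨K.toReal / δ, by positivity, fun v hv hv0 => ?_⟩
    have hae := hv.1.ae_eq_mk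
    have h1 := hmain (hv.1.mk v) hv.1.stronglyMeasurable_mk.measurable (hv.ae_eq hae) (by
      rw [← hv0]
      refine integral_congr_ae ?_
      filter_upwards [hae] with p hp
      rw [hp])
    have e1 : ∫ p, hv.1.mk v p ^ 2 = ∫ p, v p ^ 2 := by
      refine integral_congr_ae ?_
      filter_upwards [hae] with p hp
      rw [hp]
    have e2 : ∫ p, hv.1.mk v p * opB β J m (hv.1.mk v) p = ∫ p, v p * opB β J m v p := by
      refine integral_congr_ae ?_
      filter_upwards [hae, opB_congr_ae (β := β) (J := J) (m := m) hae] with p hp hp'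
      rw [hp, hp']
    rw [e1, e2] at h1
    rw [div_mul_eq_mul_div, le_div_iff₀ hδ, mul_comm]
    exact h1
  intro v hvm hv hv0
  set E := ∫ p, v p * opB β J m v p with hE
  have hE0 : 0 ≤ E := (hp.lintegral_form_eq hβ hJ hvm hv).1
  set φ : Cylinder d L → ℝ := fun p => v p / deriv m p.1 with hφ
  have hφm : Measurable φ := hvm.div (hp.continuous_deriv.measurable.comp measurable_fst)
  have hψ := hp.memLp_deriv (L := L)
  have step : ∀ q : Cylinder d L, ENNReal.ofReal (δ * ∫ p, v p ^ 2) ≤ ENNReal.ofReal E +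
      ENNReal.ofReal ((1 + δ) * M ^ 2) *
        ∫⁻ p in slab d L X, ENNReal.ofReal ((φ p - φ q) ^ 2) := by
    intro q
    have hu : MemLp (fun p => v p - φ q * deriv m p.1) 2 volume := hv.sub (hψ.const_mul _)
    have h1 := hfar _ hu
    rw [hp.integral_sub_const_mul_deriv hβ hJ hv] at h1
    have h2 : ∫ p, v p ^ 2 ≤ ∫ p, (v p - φ q * deriv m p.1) ^ 2 := by
      have i1 := integrable_fun_mul hv hψ
      have i2 : Integrable fun p : Cylinder d L => deriv m p.1 ^ 2 := hψ.integrable_sq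
      have i3 : Integrable fun p => v p ^ 2 := hv.integrable_sq
      have e : ∀ p : Cylinder d L, (v p - φ q * deriv m p.1) ^ 2 = v p ^ 2 -
          2 * φ q * (v p * deriv m p.1) + φ q ^ 2 * deriv m p.1 ^ 2 := fun p => by ring
      have i4 : Integrable fun p => v p ^ 2 - 2 * φ q * (v p * deriv m p.1) :=
        i3.sub (i1.const_mul _)
      simp only [e]
      rw [integral_add i4 (i2.const_mul _), integral_sub i3 (i1.const_mul _),
        integral_const_mul, hv0, integral_const_mul]
      have : 0 ≤ φ q ^ 2 * ∫ p : Cylinder d L, deriv m p.1 ^ 2 :=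
        mul_nonneg (sq_nonneg _) (integral_nonneg fun p => sq_nonneg _)
      linarith
    have h3 := (mul_le_mul_of_nonneg_left h2 hδ.le).trans h1
    have hnn : 0 ≤ ∫ p in slab d L X, (v p - φ q * deriv m p.1) ^ 2 :=
      integral_nonneg fun p => sq_nonneg _
    refine (ENNReal.ofReal_le_ofReal h3).trans ?_
    rw [ENNReal.ofReal_add hE0 (by positivity)]
    refine add_le_add le_rfl ?_
    rw [ENNReal.ofReal_mul (by positivity), ENNReal.ofReal_mul (by positivity), mul_assoc,
      ofReal_integral_eq_lintegral_ofReal hu.integrable_sq.integrableOn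
        (Eventually.of_forall fun p => sq_nonneg _),
      ← lintegral_const_mul' (ENNReal.ofReal (M ^ 2)) _ ENNReal.ofReal_ne_top]
    refine mul_le_mul_right (lintegral_mono fun p => ?_) _
    dsimp only
    rw [← ENNReal.ofReal_mul (by positivity)]
    refine ENNReal.ofReal_le_ofReal ?_
    have e : v p - φ q * deriv m p.1 = deriv m p.1 * (φ p - φ q) := by
      have := (hp.deriv_pos p.1).ne'
      simp only [hφ]
      field_simp
    rw [e, mul_pow]
    exact mul_le_mul_of_nonneg_right (pow_le_pow_left₀ (hp.deriv_pos _).le (hψM _) 2)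
      (sq_nonneg _)
  have havg : V * ENNReal.ofReal (δ * ∫ p, v p ^ 2) ≤ V * ENNReal.ofReal E +
      ENNReal.ofReal ((1 + δ) * M ^ 2) * (C₁ * (C₂ * ENNReal.ofReal E)) := by
    calc V * ENNReal.ofReal (δ * ∫ p, v p ^ 2)
        = ∫⁻ _ in slab d L X, ENNReal.ofReal (δ * ∫ p, v p ^ 2) := by
          rw [setLIntegral_const, mul_comm]
      _ ≤ ∫⁻ q in slab d L X, (ENNReal.ofReal E + ENNReal.ofReal ((1 + δ) * M ^ 2) *
            ∫⁻ p in slab d L X, ENNReal.ofReal ((φ p - φ q) ^ 2)) := lintegral_mono step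
      _ = V * ENNReal.ofReal E + ENNReal.ofReal ((1 + δ) * M ^ 2) * ∫⁻ q in slab d L X,
            ∫⁻ p in slab d L X, ENNReal.ofReal ((φ p - φ q) ^ 2) := by
          rw [lintegral_add_left measurable_const, setLIntegral_const,
            lintegral_const_mul' _ _ ENNReal.ofReal_ne_top, mul_comm V]
      _ ≤ _ := by
          refine add_le_add le_rfl (mul_le_mul_right ?_ _)
          exact (hpoin φ hφm).trans (mul_le_mul_right (hloc v hvm hv) _)
  have hfin : ENNReal.ofReal (δ * ∫ p, v p ^ 2) ≤ K * ENNReal.ofReal E := by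
    have := mul_le_mul_right havg V⁻¹
    rw [← mul_assoc, ENNReal.inv_mul_cancel hV0 hVt, one_mul, mul_add, ← mul_assoc V⁻¹ V,
      ENNReal.inv_mul_cancel hV0 hVt, one_mul] at this
    refine this.trans (le_of_eq ?_)
    rw [hKdef]
    ring
  rw [← ENNReal.ofReal_toReal hKt, ← ENNReal.ofReal_mul ENNReal.toReal_nonneg,
    ENNReal.ofReal_le_ofReal_iff (by positivity)] at hfin
  exact hfin

/-- The spectral gap of `B`. -/
theorem IsProfile.exists_gap (hp : IsProfile β J m) (hβ : 0 < β) (hJ : IsKernel J) :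
    ∃ C : ℝ, 0 ≤ C ∧ ∀ v : Cylinder d L → ℝ, MemLp v 2 volume →
      ∫ p, v p * deriv m p.1 = 0 → ∫ p, v p ^ 2 ≤ C * ∫ p, opB β J m v p ^ 2 := by
  obtain ⟨C, hC, h⟩ := hp.exists_gap_form (L := L) hβ hJ
  refine ⟨C ^ 2, sq_nonneg _, fun v hv hv0 => ?_⟩
  have hB := hp.memLp_opB hβ hJ hv
  have h1 := h v hv hv0
  have h2 := sq_integral_mul_le hv hB
  have ha : 0 ≤ ∫ p, v p ^ 2 := integral_nonneg fun p => sq_nonneg _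
  have hb : 0 ≤ ∫ p, opB β J m v p ^ 2 := integral_nonneg fun p => sq_nonneg _
  rcases ha.eq_or_lt with h0 | h0
  · rw [← h0]; positivity
  · have h3 : (∫ p, v p ^ 2) ^ 2 ≤ C ^ 2 * (∫ p, v p * opB β J m v p) ^ 2 := by
      rw [← mul_pow]
      exact pow_le_pow_left₀ ha h1 2
    have h4 := h3.trans (mul_le_mul_of_nonneg_left h2 (sq_nonneg C))
    nlinarith

end Gap

section WeightedGap

variable {d : ℕ} {L : ℝ} [Fact (0 < L)] {J : Space d → ℝ} {β : ℝ} {m : ℝ → ℝ}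
  {v w : Cylinder d L → ℝ}

/-- An exponential weight in the longitudinal coordinate. -/
def expWeight (γ x : ℝ) : ℝ := Real.exp (-(γ * |x|))

theorem expWeight_pos (γ x : ℝ) : 0 < expWeight γ x := Real.exp_pos _

theorem continuous_expWeight (γ : ℝ) : Continuous (expWeight γ) := by
  unfold expWeight
  fun_prop

theorem abs_expWeight_le {γ : ℝ} (hγ : 0 ≤ γ) (x : ℝ) : |expWeight γ x| ≤ 1 := by
  rw [abs_of_pos (expWeight_pos γ x)]
  refine Real.exp_le_one_iff.2 ?_
  have : 0 ≤ γ * |x| := by positivity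
  linarith

theorem memLp_expWeight_mul {γ : ℝ} (hγ : 0 ≤ γ) (hv : MemLp v 2 volume) :
    MemLp (fun p => expWeight γ p.1 * v p) 2 volume :=
  memLp_bdd_mul (continuous_expWeight γ) (abs_expWeight_le hγ) hv

theorem abs_expWeight_sub_le {γ R x t : ℝ} (hγ : 0 ≤ γ) (ht : |t| ≤ R) (hR : γ * R ≤ 1) :
    |expWeight γ x - expWeight γ (x - t)| ≤ 2 * (γ * R) * expWeight γ (x - t) := by
  have e : expWeight γ x - expWeight γ (x - t) =
      (Real.exp (γ * (|x - t| - |x|)) - 1) * expWeight γ (x - t) := by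
    rw [expWeight, expWeight, sub_mul, ← Real.exp_add, one_mul]
    congr 2
    ring
  have h1 : |γ * (|x - t| - |x|)| ≤ γ * R := by
    rw [abs_mul, abs_of_nonneg hγ]
    refine mul_le_mul_of_nonneg_left ((abs_abs_sub_abs_le _ _).trans ?_) hγ
    simpa using ht
  rw [e, abs_mul, abs_of_pos (expWeight_pos _ _)]
  refine mul_le_mul_of_nonneg_right ?_ (expWeight_pos _ _).le
  exact (Real.abs_exp_sub_one_le (h1.trans hR)).trans (by linarith)

/-- The commutator of `B` with an exponential weight is small. -/
theorem IsProfile.integral_commutator_sq_le (hp : IsProfile β J m) (hβ : 0 < β) (hJ : IsKernel J)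
    {R γ : ℝ} (hR : ∀ z, J z ≠ 0 → ‖z‖ ≤ R) (hγ : 0 ≤ γ) (hγR : γ * R ≤ 1)
    (hv : MemLp v 2 volume) :
    ∫ p, (opB β J m (fun q => expWeight γ q.1 * v q) p - expWeight γ p.1 * opB β J m v p) ^ 2 ≤
      (2 * (γ * R)) ^ 2 * ∫ p, (expWeight γ p.1 * v p) ^ 2 := by
  have hK := hJ.isSmoothKernel.integrable
  have hW := memLp_expWeight_mul hγ hv
  have hWa : MemLp (fun p => |expWeight γ p.1 * v p|) 2 volume := hW.abs
  have hpt : ∀ᵐ p : Cylinder d L, (opB β J m (fun q => expWeight γ q.1 * v q) p -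
      expWeight γ p.1 * opB β J m v p) ^ 2 ≤
        (2 * (γ * R)) ^ 2 * cylConv J (fun q => |expWeight γ q.1 * v q|) p ^ 2 := by
    filter_upwards [ae_integrable_cylConv hK hv, ae_integrable_cylConv hK hW,
      ae_integrable_cylConv hK hWa] with p i1 i2 i3
    have e : opB β J m (fun q => expWeight γ q.1 * v q) p - expWeight γ p.1 * opB β J m v p =
        ∫ z, (expWeight γ p.1 * (J z * v (p - toCylinder d L z)) -
          J z * (expWeight γ (p - toCylinder d L z).1 * v (p - toCylinder d L z))) := by
      rw [integral_sub (i1.const_mul _) i2, integral_const_mul, opB_eq, opB_eq]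
      simp only [cylConv]
      ring
    rw [e, ← mul_pow, ← sq_abs]
    refine pow_le_pow_left₀ (abs_nonneg _) ?_ 2
    rw [← Real.norm_eq_abs, cylConv, ← integral_const_mul]
    refine norm_integral_le_of_norm_le (i3.const_mul _) (Eventually.of_forall fun z => ?_)
    by_cases hz : J z = 0
    · simp [hz]
    · have h1 : (p - toCylinder d L z).1 = p.1 - z 0 := rfl
      have h2 := abs_expWeight_sub_le (x := p.1) hγ ((PiLp.norm_apply_le z 0).trans (hR z hz)) hγR
      rw [h1, abs_mul, abs_of_pos (expWeight_pos _ _), Real.norm_eq_abs,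
        show expWeight γ p.1 * (J z * v (p - toCylinder d L z)) -
          J z * (expWeight γ (p.1 - z 0) * v (p - toCylinder d L z)) =
          (expWeight γ p.1 - expWeight γ (p.1 - z 0)) * (J z * v (p - toCylinder d L z)) by ring,
        abs_mul, abs_mul, abs_of_nonneg (hJ.nonneg z)]
      calc _ ≤ 2 * (γ * R) * expWeight γ (p.1 - z 0) * (J z * |v (p - toCylinder d L z)|) :=
            mul_le_mul_of_nonneg_right h2 (mul_nonneg (hJ.nonneg z) (abs_nonneg _))
        _ = _ := by ring
  have hc : MemLp (cylConv J fun q => |expWeight γ q.1 * v q|) 2 volume := memLp_cylConv hK hWa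
  have hm : MemLp (fun p => opB β J m (fun q => expWeight γ q.1 * v q) p -
      expWeight γ p.1 * opB β J m v p) 2 volume :=
    (hp.memLp_opB hβ hJ hW).sub (memLp_expWeight_mul hγ (hp.memLp_opB hβ hJ hv))
  refine (integral_mono_ae hm.integrable_sq (hc.integrable_sq.const_mul _) hpt).trans ?_
  rw [integral_const_mul]
  refine mul_le_mul_of_nonneg_left ?_ (sq_nonneg _)
  have h := integral_cylConv_sq_le hK hWa
  have e : ∫ z, |J z| = 1 := by
    rw [← hJ.integral_eq_one]
    simp only [abs_of_nonneg (hJ.nonneg _)]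
  rw [e, one_pow, one_mul] at h
  simpa only [sq_abs] using h

theorem integrable_exp_cylinder {c : ℝ} (hc : 0 < c) :
    Integrable fun p : Cylinder d L => Real.exp (-(c * |p.1|)) :=
  (integrable_exp_neg_mul_abs hc).comp_fst volume

/-- A weighted function orthogonal to the translation mode is almost orthogonal to it. -/
theorem IsProfile.exists_overlap_bound (hp : IsProfile β J m) :
    ∃ T γ₀ : ℝ, 0 ≤ T ∧ 0 < γ₀ ∧ ∀ γ, 0 ≤ γ → γ ≤ γ₀ → ∀ v : Cylinder d L → ℝ,
      MemLp v 2 volume → ∫ p, v p * deriv m p.1 = 0 →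
        (∫ p, expWeight γ p.1 * v p * deriv m p.1) ^ 2 ≤
          γ ^ 2 * T * ∫ p, (expWeight γ p.1 * v p) ^ 2 := by
  obtain ⟨M, c, hM, hc, hψ⟩ := hp.deriv_decay
  refine ⟨∫ p : Cylinder d L, (4 * M / c) ^ 2 * Real.exp (-(c / 2 * |p.1|)), c / 2,
    integral_nonneg fun p => by positivity, by positivity, fun γ hγ hγc v hv hv0 => ?_⟩
  have hW := memLp_expWeight_mul hγ hv
  set g : Cylinder d L → ℝ := fun p => (1 - Real.exp (γ * |p.1|)) * deriv m p.1 with hg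
  have hgle : ∀ p, g p ^ 2 ≤ γ ^ 2 * ((4 * M / c) ^ 2 * Real.exp (-(c / 2 * |p.1|))) := by
    intro p
    set x := |p.1| with hx
    have hx0 : 0 ≤ x := abs_nonneg _
    have hy : 0 ≤ γ * x := by positivity
    have h1 : Real.exp (γ * x) - 1 ≤ γ * x * Real.exp (γ * x) := by
      have h := Real.add_one_le_exp (-(γ * x))
      have h' := mul_le_mul_of_nonneg_right h (Real.exp_pos (γ * x)).le
      rw [← Real.exp_add, neg_add_cancel, Real.exp_zero] at h'
      linarith
    have h0 : 0 ≤ Real.exp (γ * x) - 1 := by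
      have := Real.one_le_exp hy
      linarith
    have h2 : x ≤ 4 / c * Real.exp (c / 4 * x) := by
      have := Real.add_one_le_exp (c / 4 * x)
      have h3 : x = 4 / c * (c / 4 * x) := by field_simp
      rw [h3]
      refine mul_le_mul_of_nonneg_left ?_ (by positivity)
      rw [← h3]
      linarith
    have h4 : |g p| ≤ γ * (4 * M / c * Real.exp (-(c / 4 * x))) := by
      rw [hg]
      dsimp only
      rw [abs_mul, abs_sub_comm, abs_of_nonneg h0, abs_of_pos (hp.deriv_pos _)]
      calc (Real.exp (γ * x) - 1) * deriv m p.1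
          ≤ (γ * x * Real.exp (γ * x)) * (M * Real.exp (-(c * x))) :=
            mul_le_mul h1 (hψ _) (hp.deriv_pos _).le (by positivity)
        _ ≤ (γ * (4 / c * Real.exp (c / 4 * x)) * Real.exp (c / 2 * x)) *
              (M * Real.exp (-(c * x))) := by
            gcongr
        _ = γ * (4 * M / c * (Real.exp (c / 4 * x) * Real.exp (c / 2 * x) *
              Real.exp (-(c * x)))) := by ring
        _ = _ := by
            rw [← Real.exp_add, ← Real.exp_add]
            congr 4
            ring
    rw [← sq_abs]
    calc |g p| ^ 2 ≤ (γ * (4 * M / c * Real.exp (-(c / 4 * x)))) ^ 2 :=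
          pow_le_pow_left₀ (abs_nonneg _) h4 2
      _ = _ := by
          rw [mul_pow, mul_pow, ← Real.exp_nat_mul]
          congr 4
          push_cast
          ring
  have hgi : Integrable fun p : Cylinder d L =>
      γ ^ 2 * ((4 * M / c) ^ 2 * Real.exp (-(c / 2 * |p.1|))) :=
    ((integrable_exp_cylinder (by positivity)).const_mul _).const_mul _
  have hgm : AEStronglyMeasurable g volume := by
    have := hp.continuous_deriv
    exact Continuous.aestronglyMeasurable (by fun_prop)
  have hg2 : MemLp g 2 volume := by
    refine (memLp_two_iff_integrable_sq hgm).2 (hgi.mono' (hgm.pow 2)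
      (Eventually.of_forall fun p => ?_))
    rw [Real.norm_of_nonneg (sq_nonneg _)]
    exact hgle p
  have e : ∫ p, expWeight γ p.1 * v p * deriv m p.1 =
      ∫ p, (expWeight γ p.1 * v p) * g p := by
    have e1 : ∀ p : Cylinder d L, (expWeight γ p.1 * v p) * g p =
        expWeight γ p.1 * v p * deriv m p.1 - v p * deriv m p.1 := by
      intro p
      have : expWeight γ p.1 * Real.exp (γ * |p.1|) = 1 := by
        rw [expWeight, ← Real.exp_add, neg_add_cancel, Real.exp_zero]
      simp only [hg]
      linear_combination (-(v p * deriv m p.1)) * this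
    simp only [e1]
    rw [integral_sub (integrable_fun_mul hW hp.memLp_deriv)
      (integrable_fun_mul hv hp.memLp_deriv), hv0, sub_zero]
  rw [e]
  refine (sq_integral_mul_le hW hg2).trans ?_
  rw [mul_comm]
  refine mul_le_mul_of_nonneg_right ?_ (integral_nonneg fun p => sq_nonneg _)
  rw [← integral_const_mul]
  exact integral_mono hg2.integrable_sq hgi hgle

theorem IsProfile.integral_deriv_sq_pos (hp : IsProfile β J m) :
    0 < ∫ p : Cylinder d L, deriv m p.1 ^ 2 := by
  have hi : Integrable fun p : Cylinder d L => deriv m p.1 ^ 2 := hp.memLp_deriv.integrable_sq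
  refine (integral_pos_iff_support_of_nonneg (fun p => sq_nonneg _) hi).2 ?_
  have : Function.support (fun p : Cylinder d L => deriv m p.1 ^ 2) = univ := by
    ext p
    simpa using (hp.deriv_pos p.1).ne'
  rw [this]
  exact isOpen_univ.measure_pos volume univ_nonempty

/-- The spectral gap in exponentially weighted spaces. -/
theorem IsProfile.exists_weighted_gap (hp : IsProfile β J m) (hβ : 0 < β) (hJ : IsKernel J) :
    ∃ γ C M : ℝ, 0 < γ ∧ 0 ≤ C ∧ 0 < M ∧ (∀ x, deriv m x ≤ M * expWeight γ x) ∧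
      ∀ v : Cylinder d L → ℝ, MemLp v 2 volume → ∫ p, v p * deriv m p.1 = 0 →
        ∫ p, (expWeight γ p.1 * v p) ^ 2 ≤ C * ∫ p, (expWeight γ p.1 * opB β J m v p) ^ 2 := by
  obtain ⟨C, hC, hgap⟩ := hp.exists_gap (L := L) hβ hJ
  obtain ⟨R, hR0, hR⟩ := hJ.exists_radius
  obtain ⟨T, γ₀, hT, hγ₀, hover⟩ := hp.exists_overlap_bound (d := d) (L := L)
  obtain ⟨M, c, hM, hc, hψ⟩ := hp.deriv_decay
  have hψ2 := hp.memLp_deriv (L := L)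
  set P := ∫ p : Cylinder d L, deriv m p.1 ^ 2 with hP
  have hP0 : 0 < P := hp.integral_deriv_sq_pos
  set A := 2 * C * (2 * R) ^ 2 + T / P with hA
  have hA0 : 0 ≤ A := by positivity
  obtain ⟨γ, hγ, hγ1, hγ2, hγ3, hγ4⟩ : ∃ γ : ℝ, 0 < γ ∧ γ ≤ γ₀ ∧ γ * R ≤ 1 ∧ γ ≤ c ∧
      γ ^ 2 * A ≤ 1 / 2 := by
    set γ := min (min γ₀ (1 / R)) (min c (min 1 (1 / (2 * (A + 1)))))
    have h0 : 0 < γ := by positivity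
    have h1 : γ ≤ 1 := ((min_le_right _ _).trans (min_le_right _ _)).trans (min_le_left _ _)
    have h2 : γ ≤ 1 / (2 * (A + 1)) :=
      ((min_le_right _ _).trans (min_le_right _ _)).trans (min_le_right _ _)
    refine ⟨γ, h0, (min_le_left _ _).trans (min_le_left _ _),
      (le_div_iff₀ hR0).1 ((min_le_left _ _).trans (min_le_right _ _)),
      (min_le_right _ _).trans (min_le_left _ _), ?_⟩
    rw [le_div_iff₀ (by positivity)] at h2
    nlinarith
  refine ⟨γ, 4 * C, M, hγ, by positivity, hM, fun x => (hψ x).trans ?_, fun v hv hv0 => ?_⟩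
  · refine mul_le_mul_of_nonneg_left (Real.exp_le_exp.2 (neg_le_neg ?_)) hM.le
    exact mul_le_mul_of_nonneg_right hγ3 (abs_nonneg _)
  have hW := memLp_expWeight_mul hγ.le hv
  have hB := hp.memLp_opB hβ hJ hv
  have hWB := memLp_expWeight_mul hγ.le hB
  set I := ∫ p, (expWeight γ p.1 * v p) ^ 2 with hI
  set S := ∫ p, expWeight γ p.1 * v p * deriv m p.1 with hS
  have hI0 : 0 ≤ I := integral_nonneg fun p => sq_nonneg _
  have hsq : ∀ k : ℝ, ∫ p, (expWeight γ p.1 * v p - k * deriv m p.1) ^ 2 =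
      I - 2 * k * S + k ^ 2 * P := by
    intro k
    have i1 := integrable_fun_mul hW hψ2
    have i2 : Integrable fun p : Cylinder d L => deriv m p.1 ^ 2 := hψ2.integrable_sq
    have i3 : Integrable fun p => (expWeight γ p.1 * v p) ^ 2 := hW.integrable_sq
    have e : ∀ p : Cylinder d L, (expWeight γ p.1 * v p - k * deriv m p.1) ^ 2 =
        (expWeight γ p.1 * v p) ^ 2 - 2 * k * (expWeight γ p.1 * v p * deriv m p.1) +
          k ^ 2 * deriv m p.1 ^ 2 := fun p => by ring
    have i4 : Integrable fun p => (expWeight γ p.1 * v p) ^ 2 -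
        2 * k * (expWeight γ p.1 * v p * deriv m p.1) := i3.sub (i1.const_mul _)
    simp only [e]
    rw [integral_add i4 (i2.const_mul _), integral_sub i3 (i1.const_mul _),
      integral_const_mul, integral_const_mul]
  have hu : MemLp (fun p => expWeight γ p.1 * v p - S / P * deriv m p.1) 2 volume :=
    hW.sub (hψ2.const_mul _)
  have h1 := hgap _ hu (by
    have i1 := integrable_fun_mul hW hψ2
    have i2 : Integrable fun p : Cylinder d L => deriv m p.1 ^ 2 := hψ2.integrable_sq
    have e : ∀ p : Cylinder d L, (expWeight γ p.1 * v p - S / P * deriv m p.1) * deriv m p.1 =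
        expWeight γ p.1 * v p * deriv m p.1 - S / P * deriv m p.1 ^ 2 := fun p => by ring
    simp only [e]
    rw [integral_sub i1 (i2.const_mul _), integral_const_mul, ← hP, ← hS,
      div_mul_cancel₀ _ hP0.ne', sub_self])
  have h2 : ∫ p, opB β J m (fun p => expWeight γ p.1 * v p - S / P * deriv m p.1) p ^ 2 =
      ∫ p, opB β J m (fun p => expWeight γ p.1 * v p) p ^ 2 := by
    refine integral_congr_ae ?_
    filter_upwards [hp.opB_sub_const_mul_deriv hβ hJ hW (S / P)] with p h
    rw [h]
  have h3 := hp.integral_commutator_sq_le hβ hJ hR hγ.le hγ2 hv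
  have h4 : ∫ p, opB β J m (fun p => expWeight γ p.1 * v p) p ^ 2 ≤
      2 * (∫ p, (expWeight γ p.1 * opB β J m v p) ^ 2) +
      2 * ∫ p, (opB β J m (fun q => expWeight γ q.1 * v q) p -
        expWeight γ p.1 * opB β J m v p) ^ 2 := by
    have hBW := hp.memLp_opB hβ hJ hW
    have hd : MemLp (fun p => opB β J m (fun q => expWeight γ q.1 * v q) p -
      expWeight γ p.1 * opB β J m v p) 2 volume := hBW.sub hWB
    rw [← integral_const_mul, ← integral_const_mul,
      ← integral_add (hWB.integrable_sq.const_mul 2) (hd.integrable_sq.const_mul 2)]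
    refine integral_mono hBW.integrable_sq ((hWB.integrable_sq.const_mul 2).add
      (hd.integrable_sq.const_mul 2)) fun p => ?_
    dsimp only [Pi.add_apply]
    nlinarith [sq_nonneg (2 * (expWeight γ p.1 * opB β J m v p) -
      opB β J m (fun q => expWeight γ q.1 * v q) p)]
  have h5 := hover γ hγ.le hγ1 v hv hv0
  rw [h2, hsq] at h1
  have e6 : I - 2 * (S / P) * S + (S / P) ^ 2 * P = I - S ^ 2 / P := by
    field_simp
    ring
  rw [e6] at h1
  have h7 : S ^ 2 / P ≤ γ ^ 2 * (T / P) * I := by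
    rw [div_le_iff₀ hP0]
    refine h5.trans (le_of_eq ?_)
    rw [← hI]
    field_simp
  have h8 := mul_le_mul_of_nonneg_left (h4.trans (add_le_add le_rfl
    (mul_le_mul_of_nonneg_left h3 (by norm_num)))) hC
  have h9 := mul_le_mul_of_nonneg_right hγ4 hI0
  have h10 : γ ^ 2 * A * I = 2 * C * (2 * (γ * R)) ^ 2 * I + γ ^ 2 * (T / P) * I := by
    rw [hA]; ring
  linarith

end WeightedGap

section GradientBound

variable {d : ℕ} {L : ℝ} [Fact (0 < L)] {J : Space d → ℝ} {β : ℝ} {m : ℝ → ℝ}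
  {v w u : Cylinder d L → ℝ}

theorem HasWeakDeriv.congr_left {α : Fin (d + 1) → ℕ} {g : Cylinder d L → ℝ}
    (h : HasWeakDeriv α v g) (hvw : v =ᵐ[volume] w) : HasWeakDeriv α w g := by
  intro φ hφ
  rw [← h φ hφ]
  refine integral_congr_ae ?_
  filter_upwards [hvw] with p hp
  rw [hp]

theorem sq_add_mul_exp_le {γ a t : ℝ} (hγ : 0 < γ) (ha : 0 ≤ a) (ht : 0 ≤ t) :
    Real.exp (-(γ * t)) * (t + a) ^ 2 ≤
      8 / γ ^ 2 * Real.exp (γ / 2 * a) * Real.exp (-(γ / 2 * t)) := by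
  have h1 := Real.quadratic_le_exp_of_nonneg (show 0 ≤ γ / 2 * (t + a) by positivity)
  have h2 : (γ / 2 * (t + a)) ^ 2 / 2 ≤ Real.exp (γ / 2 * (t + a)) := by
    have : 0 ≤ γ / 2 * (t + a) := by positivity
    linarith
  have h3 : (t + a) ^ 2 ≤ 8 / γ ^ 2 * Real.exp (γ / 2 * (t + a)) := by
    have e : (t + a) ^ 2 = 8 / γ ^ 2 * ((γ / 2 * (t + a)) ^ 2 / 2) := by
      field_simp
      ring
    rw [e]
    exact mul_le_mul_of_nonneg_left h2 (by positivity)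
  calc Real.exp (-(γ * t)) * (t + a) ^ 2
      ≤ Real.exp (-(γ * t)) * (8 / γ ^ 2 * Real.exp (γ / 2 * (t + a))) :=
        mul_le_mul_of_nonneg_left h3 (Real.exp_pos _).le
    _ = 8 / γ ^ 2 * (Real.exp (-(γ * t)) * Real.exp (γ / 2 * (t + a))) := by ring
    _ = 8 / γ ^ 2 * (Real.exp (γ / 2 * a) * Real.exp (-(γ / 2 * t))) := by
        rw [← Real.exp_add, ← Real.exp_add]
        congr 2
        ring
    _ = _ := by ring

theorem lintegral_strip_exp_lt_top {c : ℝ} (hc : 0 < c) :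
    ∫⁻ z in strip d L 0, ENNReal.ofReal (Real.exp (-(c * |z 0|))) < ⊤ := by
  have hi := integrable_exp_cylinder (d := d) (L := L) hc
  have h := lintegral_strip_add (d := d) (L := L) 0 0
    (g := fun p => ENNReal.ofReal (Real.exp (-(c * |p.1|)))) hi.1.aemeasurable.ennreal_ofReal
  simp only [zero_add] at h
  have e : ∫⁻ z in strip d L 0, ENNReal.ofReal (Real.exp (-(c * |z 0|))) =
      ∫⁻ p : Cylinder d L, ENNReal.ofReal (Real.exp (-(c * |p.1|))) := h
  rw [e, ← ofReal_integral_eq_lintegral_ofReal hi (Eventually.of_forall fun p =>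
    (Real.exp_pos _).le)]
  exact ENNReal.ofReal_lt_top

theorem lintegral_strip_moment_lt_top {γ : ℝ} (hγ : 0 < γ) (A : ℝ) :
    ∫⁻ z in strip d L 0, ENNReal.ofReal (A * (Real.exp (-(γ * |z 0|)) * ‖z‖ ^ 2)) < ⊤ := by
  have hL : 0 < L := Fact.out
  set K := 8 / γ ^ 2 * Real.exp (γ / 2 * (d * L)) with hK
  have hK0 : 0 ≤ K := by positivity
  refine lt_of_le_of_lt (setLIntegral_mono' (measurableSet_strip 0)
    (g := fun z => ENNReal.ofReal (|A| * K) * ENNReal.ofReal (Real.exp (-(γ / 2 * |z 0|))))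
    fun z hz => ?_) ?_
  · rw [← ENNReal.ofReal_mul (by positivity)]
    refine ENNReal.ofReal_le_ofReal ?_
    have h1 : Real.exp (-(γ * |z 0|)) * ‖z‖ ^ 2 ≤ K * Real.exp (-(γ / 2 * |z 0|)) :=
      (mul_le_mul_of_nonneg_left (pow_le_pow_left₀ (norm_nonneg _) (norm_le_of_mem_strip hz) 2)
        (Real.exp_pos _).le).trans (sq_add_mul_exp_le hγ (by positivity) (abs_nonneg _))
    calc A * (Real.exp (-(γ * |z 0|)) * ‖z‖ ^ 2)
        ≤ |A| * (Real.exp (-(γ * |z 0|)) * ‖z‖ ^ 2) :=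
          mul_le_mul_of_nonneg_right (le_abs_self A) (by positivity)
      _ ≤ |A| * (K * Real.exp (-(γ / 2 * |z 0|))) :=
          mul_le_mul_of_nonneg_left h1 (abs_nonneg A)
      _ = _ := by ring
  · rw [lintegral_const_mul' _ _ ENNReal.ofReal_ne_top]
    exact ENNReal.mul_lt_top ENNReal.ofReal_lt_top (lintegral_strip_exp_lt_top (by positivity))

theorem IsProfile.integrable_deriv (hp : IsProfile β J m) :
    Integrable fun p : Cylinder d L => deriv m p.1 := by
  obtain ⟨M, c, hM, hc, hψ⟩ := hp.deriv_decay
  refine ((integrable_exp_cylinder hc).const_mul M).mono'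
    (hp.continuous_deriv.comp continuous_fst).aestronglyMeasurable
    (Eventually.of_forall fun p => ?_)
  rw [Real.norm_of_nonneg (hp.deriv_pos _).le]
  exact hψ _

theorem expWeight_sq_mul_le {γ M : ℝ} (hγ : 0 ≤ γ) (hM : 0 ≤ M) {f : ℝ → ℝ}
    (hf : ∀ x, f x ≤ M * expWeight γ x) (x t : ℝ) :
    expWeight γ x ^ 2 * f (x + t) ≤ M * Real.exp (-(γ * |t|)) := by
  have h1 : expWeight γ x ^ 2 ≤ expWeight γ x := by
    have h := abs_expWeight_le hγ x
    rw [abs_of_pos (expWeight_pos γ x)] at h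
    nlinarith [expWeight_pos γ x]
  have h2 : expWeight γ x * expWeight γ (x + t) ≤ Real.exp (-(γ * |t|)) := by
    rw [expWeight, expWeight, ← Real.exp_add]
    refine Real.exp_le_exp.2 ?_
    have := abs_sub (x + t) x
    rw [add_sub_cancel_left] at this
    nlinarith
  calc expWeight γ x ^ 2 * f (x + t)
      ≤ expWeight γ x ^ 2 * (M * expWeight γ (x + t)) :=
        mul_le_mul_of_nonneg_left (hf _) (sq_nonneg _)
    _ ≤ expWeight γ x * (M * expWeight γ (x + t)) :=
        mul_le_mul_of_nonneg_right h1 (mul_nonneg hM (expWeight_pos _ _).le)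
    _ = M * (expWeight γ x * expWeight γ (x + t)) := by ring
    _ ≤ _ := mul_le_mul_of_nonneg_left h2 hM

/-- Functions orthogonal to the translation mode are controlled in the weighted norm by their
gradient. -/
theorem IsProfile.exists_gradient_bound (hp : IsProfile β J m) {γ M : ℝ}
    (hγ : 0 < γ) (hM : 0 ≤ M) (hψM : ∀ x, deriv m x ≤ M * expWeight γ x) :
    ∃ C : ℝ, 0 ≤ C ∧ ∀ (u : Cylinder d L → ℝ) (h : Fin (d + 1) → Cylinder d L → ℝ),
      MemLp u 2 volume → (∀ i, MemLp (h i) 2 volume) →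
      (∀ i, HasWeakDeriv (Pi.single i 1) u (h i)) → ∫ p, u p * deriv m p.1 = 0 →
        ∫ p, (expWeight γ p.1 * u p) ^ 2 ≤ C * ∑ i, ∫ p, h i p ^ 2 := by
  set Ψ : ℝ≥0∞ := ∫⁻ q : Cylinder d L, ‖deriv m q.1‖ₑ with hΨ
  have hψi := hp.integrable_deriv (d := d) (L := L)
  have hΨt : Ψ ≠ ⊤ := hψi.2.ne
  have hψm : Measurable fun q : Cylinder d L => deriv m q.1 :=
    hp.continuous_deriv.measurable.comp measurable_fst
  have hΨe : Ψ = ENNReal.ofReal (∫ q : Cylinder d L, deriv m q.1) := by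
    rw [hΨ, ofReal_integral_eq_lintegral_ofReal hψi
      (Eventually.of_forall fun p => (hp.deriv_pos _).le)]
    refine lintegral_congr fun q => ?_
    rw [Real.enorm_of_nonneg (hp.deriv_pos _).le]
  have hΨ0 : Ψ ≠ 0 := by
    intro h0
    rw [hΨ, lintegral_eq_zero_iff hψm.enorm] at h0
    have h2 : (univ : Set (Cylinder d L)) ⊆ {q | ¬ ‖deriv m q.1‖ₑ = 0} := fun q _ => by
      simpa using (hp.deriv_pos q.1).ne'
    have h3 : volume {q : Cylinder d L | ¬ ‖deriv m q.1‖ₑ = 0} = 0 := h0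
    exact (isOpen_univ.measure_pos volume univ_nonempty).ne' (measure_mono_null h2 h3)
  set Q : ℝ≥0∞ := ∫⁻ z in strip d L 0,
    ENNReal.ofReal (M * 2 ^ (d + 1) * (Real.exp (-(γ * |z 0|)) * ‖z‖ ^ 2)) with hQ
  have hQt : Q ≠ ⊤ := (lintegral_strip_moment_lt_top hγ _).ne
  have hKt : Ψ⁻¹ * Q ≠ ⊤ := ENNReal.mul_ne_top (ENNReal.inv_ne_top.2 hΨ0) hQt
  refine ⟨(Ψ⁻¹ * Q).toReal, ENNReal.toReal_nonneg, ?_⟩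
  suffices hmain : ∀ (u : Cylinder d L → ℝ) (h : Fin (d + 1) → Cylinder d L → ℝ),
      Measurable u → MemLp u 2 volume → (∀ i, MemLp (h i) 2 volume) →
      (∀ i, HasWeakDeriv (Pi.single i 1) u (h i)) → ∫ p, u p * deriv m p.1 = 0 →
        ∫ p, (expWeight γ p.1 * u p) ^ 2 ≤ (Ψ⁻¹ * Q).toReal * ∑ i, ∫ p, h i p ^ 2 by
    intro u h hu hh hw hu0
    have hae := hu.1.ae_eq_mk
    have h1 := hmain (hu.1.mk u) h hu.1.stronglyMeasurable_mk.measurable (hu.ae_eq hae) hh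
      (fun i => (hw i).congr_left hae) (by
        rw [← hu0]
        refine integral_congr_ae ?_
        filter_upwards [hae] with p hp
        rw [hp])
    refine le_trans (le_of_eq ?_) h1
    refine integral_congr_ae ?_
    filter_upwards [hae] with p hp
    rw [hp]
  intro u h hum hu hh hw hu0
  set G := ∑ i, ∫ p, h i p ^ 2 with hG
  have hG0 : 0 ≤ G := Finset.sum_nonneg fun i _ => integral_nonneg fun p => sq_nonneg _
  have hW := memLp_expWeight_mul hγ.le hu
  refine integral_sq_le_of_lintegral hW (by positivity) ?_
  have hpt : ∀ p : Cylinder d L, ‖u p‖ₑ ^ 2 ≤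
      Ψ⁻¹ * ∫⁻ q, ‖deriv m q.1‖ₑ * ‖u p - u q‖ₑ ^ 2 := by
    intro p
    have i1 : Integrable fun q : Cylinder d L => u q * deriv m q.1 :=
      integrable_fun_mul hu hp.memLp_deriv
    have e1 : ∫ q : Cylinder d L, deriv m q.1 * (u p - u q) =
        (∫ q : Cylinder d L, deriv m q.1) * u p := by
      have e : ∀ q : Cylinder d L, deriv m q.1 * (u p - u q) =
          deriv m q.1 * u p - u q * deriv m q.1 := fun q => by ring
      simp only [e]
      rw [integral_sub (hψi.mul_const _) i1, hu0, sub_zero, integral_mul_const]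
    have e2 : Ψ * ‖u p‖ₑ ≤ ∫⁻ q, ‖deriv m q.1‖ₑ * ‖u p - u q‖ₑ := by
      have h1 := enorm_integral_le_lintegral_enorm (μ := (volume : Measure (Cylinder d L)))
        fun q => deriv m q.1 * (u p - u q)
      rw [e1] at h1
      simp only [enorm_mul] at h1
      rwa [Real.enorm_of_nonneg (integral_nonneg fun q => (hp.deriv_pos _).le), ← hΨe] at h1
    have e3 : (Ψ * ‖u p‖ₑ) ^ 2 ≤ Ψ * ∫⁻ q, ‖deriv m q.1‖ₑ * ‖u p - u q‖ₑ ^ 2 :=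
      (pow_le_pow_left₀ zero_le e2 2).trans
        (sq_lintegral_weight_le hψm.enorm.aemeasurable
          (measurable_const.sub hum).enorm.aemeasurable)
    have e4 := mul_le_mul_right e3 (Ψ⁻¹ * Ψ⁻¹)
    have hc : Ψ⁻¹ * Ψ = 1 := ENNReal.inv_mul_cancel hΨ0 hΨt
    calc ‖u p‖ₑ ^ 2 = (Ψ⁻¹ * Ψ) * (Ψ⁻¹ * Ψ) * ‖u p‖ₑ ^ 2 := by rw [hc, one_mul, one_mul]
      _ = Ψ⁻¹ * Ψ⁻¹ * (Ψ * ‖u p‖ₑ) ^ 2 := by ring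
      _ ≤ Ψ⁻¹ * Ψ⁻¹ * (Ψ * ∫⁻ q, ‖deriv m q.1‖ₑ * ‖u p - u q‖ₑ ^ 2) := e4
      _ = (Ψ⁻¹ * Ψ) * (Ψ⁻¹ * ∫⁻ q, ‖deriv m q.1‖ₑ * ‖u p - u q‖ₑ ^ 2) := by ring
      _ = _ := by rw [hc, one_mul]
  have htrans : ∀ z : Space d, ∫⁻ p : Cylinder d L, ‖u p - u (p + toCylinder d L z)‖ₑ ^ 2 ≤
      ENNReal.ofReal (2 ^ (d + 1) * ‖z‖ ^ 2 * G) := by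
    intro z
    have hd : MemLp (fun p => u (p + toCylinder d L z) - u p) 2 volume :=
      (memLp_comp_add hu _).sub hu
    refine le_trans (le_of_eq ?_)
      (ENNReal.ofReal_le_ofReal (integral_sub_translate_sq_le hu hh hw z))
    rw [ofReal_integral_sq hd]
    refine lintegral_congr fun p => ?_
    rw [← enorm_neg, neg_sub]
  have hWm : Measurable fun p : Cylinder d L => ‖expWeight γ p.1‖ₑ ^ 2 :=
    (((continuous_expWeight γ).measurable.comp measurable_fst).enorm).pow_const 2
  calc ∫⁻ p, ‖expWeight γ p.1 * u p‖ₑ ^ 2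
      ≤ ∫⁻ p, Ψ⁻¹ * ∫⁻ z in strip d L 0, ‖expWeight γ p.1‖ₑ ^ 2 *
          (‖deriv m (p.1 + z 0)‖ₑ * ‖u p - u (p + toCylinder d L z)‖ₑ ^ 2) := by
        refine lintegral_mono fun p => ?_
        rw [enorm_mul, mul_pow, lintegral_const_mul' _ _ (by simp)]
        have e := lintegral_strip_add 0 p (g := fun q => ‖deriv m q.1‖ₑ * ‖u p - u q‖ₑ ^ 2)
          (hψm.enorm.mul ((measurable_const.sub hum).enorm.pow_const 2)).aemeasurable
        have e' : ∫⁻ z in strip d L 0, ‖deriv m (p.1 + z 0)‖ₑ *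
            ‖u p - u (p + toCylinder d L z)‖ₑ ^ 2 =
            ∫⁻ q, ‖deriv m q.1‖ₑ * ‖u p - u q‖ₑ ^ 2 := e
        rw [e', mul_left_comm]
        exact mul_le_mul_right (hpt p) _
    _ = Ψ⁻¹ * ∫⁻ z in strip d L 0, ∫⁻ p : Cylinder d L, ‖expWeight γ p.1‖ₑ ^ 2 *
          (‖deriv m (p.1 + z 0)‖ₑ * ‖u p - u (p + toCylinder d L z)‖ₑ ^ 2) := by
        rw [lintegral_const_mul' _ _ (ENNReal.inv_ne_top.2 hΨ0), lintegral_lintegral_swap]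
        have h1 : Measurable fun q : Cylinder d L × Space d => deriv m (q.1.1 + q.2 0) :=
          hp.continuous_deriv.measurable.comp ((measurable_fst.comp measurable_fst).add
            ((measurable_coord 0).comp measurable_snd))
        have h2 : Measurable fun q : Cylinder d L × Space d =>
            u q.1 - u (q.1 + toCylinder d L q.2) :=
          (hum.comp measurable_fst).sub (hum.comp measurable_add_toCylinder_prod)
        exact ((hWm.comp measurable_fst).mul (h1.enorm.mul (h2.enorm.pow_const 2))).aemeasurable
    _ ≤ Ψ⁻¹ * ∫⁻ z in strip d L 0, ENNReal.ofReal (M * Real.exp (-(γ * |z 0|))) *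
          ∫⁻ p : Cylinder d L, ‖u p - u (p + toCylinder d L z)‖ₑ ^ 2 := by
        refine mul_le_mul_right (lintegral_mono fun z => ?_) _
        rw [← lintegral_const_mul' _ _ ENNReal.ofReal_ne_top]
        refine lintegral_mono fun p => ?_
        rw [← mul_assoc]
        refine mul_le_mul_left ?_ _
        rw [Real.enorm_of_nonneg (expWeight_pos _ _).le, Real.enorm_of_nonneg (hp.deriv_pos _).le,
          ← ENNReal.ofReal_pow (expWeight_pos _ _).le, ← ENNReal.ofReal_mul (sq_nonneg _)]
        exact ENNReal.ofReal_le_ofReal (expWeight_sq_mul_le hγ.le hM hψM _ _)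
    _ ≤ Ψ⁻¹ * ∫⁻ z in strip d L 0, ENNReal.ofReal (M * 2 ^ (d + 1) *
          (Real.exp (-(γ * |z 0|)) * ‖z‖ ^ 2)) * ENNReal.ofReal G := by
        refine mul_le_mul_right (lintegral_mono fun z => ?_) _
        refine (mul_le_mul_right (htrans z) _).trans (le_of_eq ?_)
        rw [← ENNReal.ofReal_mul (by positivity), ← ENNReal.ofReal_mul (by positivity)]
        congr 1
        ring
    _ = Ψ⁻¹ * Q * ENNReal.ofReal G := by
        rw [lintegral_mul_const' _ _ ENNReal.ofReal_ne_top, mul_assoc]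
    _ = _ := by
        rw [ENNReal.ofReal_mul ENNReal.toReal_nonneg, ENNReal.ofReal_toReal hKt]

end GradientBound

section Coercivity

variable {d : ℕ} {L : ℝ} [Fact (0 < L)] {J : Space d → ℝ} {β : ℝ} {m : ℝ → ℝ}
  {v w u g : Cylinder d L → ℝ}

theorem memLp_multiDeriv_single (i : Fin (d + 1)) {φ : Cylinder d L → ℝ} (hφ : IsTestFunction φ) :
    MemLp (multiDeriv (Pi.single i 1) φ) 2 volume := by
  rw [multiDeriv_single]
  exact (hφ.partialDeriv i).memLp

/-- The weak derivatives of `B v`. -/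
theorem IsProfile.hasWeakDeriv_opB (hp : IsProfile β J m) (hβ : 0 < β) (hJ : IsKernel J)
    {i : Fin (d + 1)} (hv : MemLp v 2 volume) (hg : MemLp g 2 volume)
    (h : HasWeakDeriv (Pi.single i 1) v g) :
    MemLp (fun p => opB β J m g p + (if i = 0 then deriv (invMobility β m) p.1 else 0) * v p)
      2 volume ∧
    HasWeakDeriv (Pi.single i 1) (opB β J m v)
      (fun p => opB β J m g p + (if i = 0 then deriv (invMobility β m) p.1 else 0) * v p) := by
  have hK := hJ.isSmoothKernel
  obtain ⟨C, hC, hCb⟩ := hp.exists_abs_deriv_invMobility_le hβ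
  obtain ⟨M, hM, hMb⟩ := hp.exists_deriv_bound
  have hdc : Continuous (deriv (invMobility β m)) :=
    (hp.contDiff_invMobility hβ).continuous_deriv (by simp)
  have hdv : MemLp (fun p => (if i = 0 then deriv (invMobility β m) p.1 else 0) * v p)
      2 volume := by
    split_ifs
    · exact memLp_bdd_mul hdc (fun x => (hCb x).trans
        (mul_le_mul_of_nonneg_left (hMb x) hC.le)) hv
    · simp
  have hbg := hp.memLp_invMobility_mul hβ hg
  have h1 := HasWeakDeriv.smooth_mul (hp.contDiff_invMobility hβ) hv hg h
  have h2 := HasWeakDeriv.cylConv hK hv hg h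
  have h3 := h1.sub (hp.memLp_invMobility_mul hβ hv) (hbg.add hdv) (memLp_cylConv hK.integrable hv)
    (memLp_cylConv hK.integrable hg) h2 fun φ hφ => memLp_multiDeriv_single i hφ
  refine ⟨(hp.memLp_opB hβ hJ hg).add hdv, ?_⟩
  rw [funext (opB_eq v)]
  convert h3 using 1
  ext p
  simp only [opB_eq, Pi.add_apply]
  ring

theorem setIntegral_slab_cylConv_sq_le {K : Space d → ℝ} (hK : IsSmoothKernel K) (X : ℝ) :
    ∃ Y C : ℝ, 0 ≤ C ∧ ∀ v : Cylinder d L → ℝ, MemLp v 2 volume →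
      ∫ p in slab d L X, cylConv K v p ^ 2 ≤ C * ∫ p in slab d L Y, v p ^ 2 := by
  obtain ⟨R, hR⟩ := hK.2.isCompact.isBounded.exists_norm_le
  refine ⟨X + R, (∫ z, |K z|) ^ 2, sq_nonneg _, fun v hv => ?_⟩
  have hv' : MemLp ((slab d L (X + R)).indicator v) 2 volume :=
    hv.indicator (measurableSet_slab _)
  have h1 : ∀ p ∈ slab d L X, cylConv K v p ^ 2 =
      cylConv K ((slab d L (X + R)).indicator v) p ^ 2 := by
    intro p hp
    congr 1
    refine integral_congr_ae (Eventually.of_forall fun z => ?_)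
    dsimp only
    by_cases hz : K z = 0
    · rw [hz, zero_mul, zero_mul]
    · rw [indicator_of_mem]
      have h2 := add_mem_slab (L := L) (w := -z) hp (C := R) (by
        rw [norm_neg]
        exact hR z (subset_tsupport _ hz))
      rwa [toCylinder_neg, ← sub_eq_add_neg] at h2
  rw [setIntegral_congr_fun (measurableSet_slab X) h1]
  refine (setIntegral_le_integral (memLp_cylConv hK.integrable hv').integrable_sq
    (Eventually.of_forall fun p => sq_nonneg _)).trans ?_
  refine (integral_cylConv_sq_le hK.integrable hv').trans (le_of_eq ?_)
  congr 1
  rw [← integral_indicator (measurableSet_slab _)]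
  refine integral_congr_ae (Eventually.of_forall fun p => ?_)
  by_cases hp : p ∈ slab d L (X + R) <;> simp [hp]

theorem setIntegral_slab_sq_le {γ Y : ℝ} (hγ : 0 ≤ γ) (hv : MemLp v 2 volume) :
    ∫ p in slab d L Y, v p ^ 2 ≤ Real.exp (2 * γ * Y) * ∫ p, (expWeight γ p.1 * v p) ^ 2 := by
  have hW := memLp_expWeight_mul hγ hv
  rw [← integral_const_mul]
  refine (setIntegral_mono_on hv.integrable_sq.integrableOn
    (hW.integrable_sq.const_mul _).integrableOn (measurableSet_slab Y) fun p hp => ?_).trans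
    (setIntegral_le_integral (hW.integrable_sq.const_mul _) (Eventually.of_forall fun p => ?_))
  · have h1 : 1 ≤ Real.exp (2 * γ * Y) * expWeight γ p.1 ^ 2 := by
      rw [expWeight, ← Real.exp_nat_mul, ← Real.exp_add]
      refine Real.one_le_exp ?_
      have := mul_le_mul_of_nonneg_left (show |p.1| ≤ Y from hp) hγ
      push_cast
      linarith
    have := mul_le_mul_of_nonneg_right h1 (sq_nonneg (v p))
    rw [mul_pow]
    linarith
  · exact mul_nonneg (Real.exp_pos _).le (sq_nonneg _)

theorem sq_add_le (a b : ℝ) : (a + b) ^ 2 ≤ 2 * a ^ 2 + 2 * b ^ 2 := by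
  nlinarith [sq_nonneg (a - b)]

theorem integral_sq_add_le {α : Type*} [MeasurableSpace α] {μ : Measure α} {f g h : α → ℝ}
    (hf : MemLp f 2 μ) (hg : MemLp g 2 μ) (hh : MemLp h 2 μ) (he : ∀ᵐ x ∂μ, h x = f x + g x) :
    ∫ x, h x ^ 2 ∂μ ≤ 2 * (∫ x, f x ^ 2 ∂μ) + 2 * ∫ x, g x ^ 2 ∂μ := by
  have i1 : Integrable (fun x => 2 * f x ^ 2) μ := hf.integrable_sq.const_mul 2
  have i2 : Integrable (fun x => 2 * g x ^ 2) μ := hg.integrable_sq.const_mul 2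
  rw [← integral_const_mul, ← integral_const_mul, ← integral_add i1 i2]
  refine integral_mono_ae hh.integrable_sq (i1.add i2) ?_
  filter_upwards [he] with x hx
  rw [hx]
  exact sq_add_le _ _

/-- The gradient of `B v` controls the longitudinal derivative of `v` and the product of `v` with
the translation mode, for `v` orthogonal to the translation mode. -/
theorem IsProfile.exists_coercive (hp : IsProfile β J m) (hβ : 0 < β) (hJ : IsKernel J) :
    ∃ C : ℝ, 0 ≤ C ∧ ∀ (v w : Cylinder d L → ℝ) (h : Fin (d + 1) → Cylinder d L → ℝ),
      MemLp v 2 volume → MemLp w 2 volume → HasWeakDeriv (Pi.single 0 1) v w →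
      (∀ i, MemLp (h i) 2 volume) → (∀ i, HasWeakDeriv (Pi.single i 1) (opB β J m v) (h i)) →
      ∫ p, v p * deriv m p.1 = 0 →
        (∫ p, (deriv m p.1 * v p) ^ 2) + ∫ p, w p ^ 2 ≤ C * ∑ i, ∫ p, h i p ^ 2 := by
  obtain ⟨γ, C₁, M, hγ, hC₁, hM, hψM, hgap⟩ := hp.exists_weighted_gap (L := L) hβ hJ
  obtain ⟨C₂, hC₂, hgrad⟩ := hp.exists_gradient_bound (d := d) (L := L) hγ hM.le hψM
  obtain ⟨C₃, hC₃, hb'⟩ := hp.exists_abs_deriv_invMobility_le hβ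
  obtain ⟨X, δ, hX, hδ, hfar⟩ := hp.exists_far_bound (L := L) hβ hJ
  have hK' : IsSmoothKernel (kernelDeriv 0 J) := hJ.isSmoothKernel.kernelDeriv 0
  obtain ⟨Y, C₄, hC₄, hnear⟩ := setIntegral_slab_cylConv_sq_le (L := L) hK' X
  obtain ⟨Mψ, hMψ, hψb⟩ := hp.exists_deriv_bound
  have hψ0 : ∀ x, 0 ≤ deriv m x := fun x => (hp.deriv_pos x).le
  set C₅ := M ^ 2 * (C₁ * C₂) with hC₅
  set C₆ := C₄ * (Real.exp (2 * γ * Y) * (C₁ * C₂)) with hC₆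
  have hC₅0 : 0 ≤ C₅ := by positivity
  have hC₆0 : 0 ≤ C₆ := by positivity
  set Cr := 2 + 2 * (C₃ ^ 2 * C₅) with hCr
  have hCr0 : 0 ≤ Cr := by positivity
  refine ⟨C₅ + 2 / δ * (1 / (2 * δ) * Cr + (1 + δ) * (β ^ 2 * (2 * Cr + 2 * C₆))), by positivity,
    fun v w h hv hw hvw hh hwh hv0 => ?_⟩
  set G := ∑ i, ∫ p, h i p ^ 2 with hG
  have hG0 : 0 ≤ G := Finset.sum_nonneg fun i _ => integral_nonneg fun p => sq_nonneg _
  have hG1 : ∫ p, h 0 p ^ 2 ≤ G := Finset.single_le_sum (f := fun i => ∫ p, h i p ^ 2)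
    (fun i _ => integral_nonneg fun p => sq_nonneg _) (Finset.mem_univ 0)
  have hB := hp.memLp_opB hβ hJ hv
  have hW := memLp_expWeight_mul hγ.le hv
  have hWv : ∫ p, (expWeight γ p.1 * v p) ^ 2 ≤ C₁ * C₂ * G := by
    rw [mul_assoc]
    refine (hgap v hv hv0).trans (mul_le_mul_of_nonneg_left (hgrad _ h hB hh hwh ?_) hC₁)
    rw [hp.integral_opB_mul_comm hβ hJ hv hp.memLp_deriv]
    simp [hp.opB_deriv hβ]
  have hψv : MemLp (fun p => deriv m p.1 * v p) 2 volume :=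
    memLp_bdd_mul hp.continuous_deriv (fun x => by
      rw [abs_of_nonneg (hψ0 x)]
      exact hψb x) hv
  have h1 : ∫ p, (deriv m p.1 * v p) ^ 2 ≤ C₅ * G := by
    have e : C₅ * G = M ^ 2 * (C₁ * C₂ * G) := by rw [hC₅]; ring
    rw [e]
    refine le_trans ?_ (mul_le_mul_of_nonneg_left hWv (sq_nonneg M))
    rw [← integral_const_mul]
    refine integral_mono hψv.integrable_sq (hW.integrable_sq.const_mul _) fun p => ?_
    dsimp only
    rw [← mul_pow, ← mul_assoc, mul_pow, mul_pow _ (v p)]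
    exact mul_le_mul_of_nonneg_right (pow_le_pow_left₀ (hψ0 _) (hψM _) 2) (sq_nonneg _)
  obtain ⟨hm0, hw0⟩ := hp.hasWeakDeriv_opB hβ hJ hv hw hvw
  have hBw := hp.memLp_opB hβ hJ hw
  simp only [if_pos] at hm0 hw0
  have hae : ∀ᵐ p, opB β J m w p + deriv (invMobility β m) p.1 * v p = h 0 p :=
    HasWeakDeriv.ae_unique hm0 (hh 0) hw0 (hwh 0)
  have hdv : MemLp (fun p => -(deriv (invMobility β m) p.1 * v p)) 2 volume := by
    refine (memLp_bdd_mul ((hp.contDiff_invMobility hβ).continuous_deriv (by simp))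
      (fun x => (hb' x).trans (mul_le_mul_of_nonneg_left (hψb x) hC₃.le)) hv).neg
  have hr : ∫ p, opB β J m w p ^ 2 ≤ Cr * G := by
    have k1 := integral_sq_add_le (hh 0) hdv hBw (by
      filter_upwards [hae] with p hp'
      rw [← hp']; ring)
    have k2 : ∫ p, (-(deriv (invMobility β m) p.1 * v p)) ^ 2 ≤ C₃ ^ 2 * (C₅ * G) := by
      refine le_trans ?_ (mul_le_mul_of_nonneg_left h1 (sq_nonneg C₃))
      rw [← integral_const_mul]
      refine integral_mono hdv.integrable_sq (hψv.integrable_sq.const_mul _) fun p => ?_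
      dsimp only
      rw [neg_sq, ← mul_pow, ← mul_assoc, mul_pow, mul_pow _ (v p),
        ← sq_abs (deriv (invMobility β m) _)]
      exact mul_le_mul_of_nonneg_right (pow_le_pow_left₀ (abs_nonneg _) (hb' _) 2) (sq_nonneg _)
    rw [hCr]
    linarith
  have hKv := memLp_cylConv hK'.integrable hv
  have hconv : cylConv (kernelDeriv 0 J) v =ᵐ[volume] cylConv J w :=
    cylConv_iterate_kernelDeriv (k := 1) hJ.isSmoothKernel hv hw hvw
  have hslab : ∫ p in slab d L X, w p ^ 2 ≤ β ^ 2 * ((2 * Cr + 2 * C₆) * G) := by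
    have k1 : ∫ p in slab d L X, (invMobility β m p.1 * w p) ^ 2 ≤
        2 * (∫ p in slab d L X, opB β J m w p ^ 2) +
          2 * ∫ p in slab d L X, cylConv (kernelDeriv 0 J) v p ^ 2 := by
      refine integral_sq_add_le (hBw.restrict _) (hKv.restrict _)
        ((hp.memLp_invMobility_mul hβ hw).restrict _) (ae_restrict_of_ae ?_)
      filter_upwards [hconv] with p hp'
      rw [hp', opB_eq]; ring
    have k2 : ∫ p in slab d L X, opB β J m w p ^ 2 ≤ Cr * G :=
      (setIntegral_le_integral hBw.integrable_sq (Eventually.of_forall fun p =>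
        sq_nonneg _)).trans hr
    have k3 : ∫ p in slab d L X, cylConv (kernelDeriv 0 J) v p ^ 2 ≤ C₆ * G := by
      refine (hnear v hv).trans ?_
      rw [hC₆, mul_assoc, mul_assoc]
      refine mul_le_mul_of_nonneg_left ?_ hC₄
      exact (setIntegral_slab_sq_le hγ.le hv).trans
        (mul_le_mul_of_nonneg_left hWv (Real.exp_pos _).le)
    have k4 : ∫ p in slab d L X, w p ^ 2 ≤
        β ^ 2 * ∫ p in slab d L X, (invMobility β m p.1 * w p) ^ 2 := by
      rw [← integral_const_mul]
      refine integral_mono hw.integrable_sq.integrableOn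
        ((hp.memLp_invMobility_mul hβ hw).integrable_sq.const_mul _).integrableOn fun p => ?_
      dsimp only
      rw [mul_pow, ← mul_assoc, ← mul_pow]
      refine le_mul_of_one_le_left (sq_nonneg _) (one_le_pow₀ ?_)
      rw [invMobility, mul_one_div, one_le_div (mul_pos hβ (hp.one_sub_sq_pos _))]
      nlinarith [sq_nonneg (m p.1)]
    refine k4.trans (mul_le_mul_of_nonneg_left ?_ (sq_nonneg β))
    linarith
  have hcross : ∫ p, w p * opB β J m w p ≤
      δ / 2 * (∫ p, w p ^ 2) + 1 / (2 * δ) * ∫ p, opB β J m w p ^ 2 := by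
    have i1 : Integrable fun p => δ / 2 * w p ^ 2 := hw.integrable_sq.const_mul _
    have i2 : Integrable fun p => 1 / (2 * δ) * opB β J m w p ^ 2 := hBw.integrable_sq.const_mul _
    rw [← integral_const_mul, ← integral_const_mul, ← integral_add i1 i2]
    refine integral_mono (integrable_fun_mul hw hBw) (i1.add i2) fun p => ?_
    dsimp only [Pi.add_apply]
    have e : δ / 2 * w p ^ 2 + 1 / (2 * δ) * opB β J m w p ^ 2 - w p * opB β J m w p =
        1 / (2 * δ) * (δ * w p - opB β J m w p) ^ 2 := by
      field_simp
      ring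
    have := mul_nonneg (show 0 ≤ 1 / (2 * δ) by positivity)
      (sq_nonneg (δ * w p - opB β J m w p))
    linarith
  have hf := hfar w hw
  have h2 : δ / 2 * ∫ p, w p ^ 2 ≤
      (1 / (2 * δ) * Cr + (1 + δ) * (β ^ 2 * (2 * Cr + 2 * C₆))) * G := by
    have k1 := mul_le_mul_of_nonneg_left hr (show 0 ≤ 1 / (2 * δ) by positivity)
    have k2 := mul_le_mul_of_nonneg_left hslab (show 0 ≤ 1 + δ by positivity)
    linarith
  have h3 : ∫ p, w p ^ 2 ≤
      2 / δ * (1 / (2 * δ) * Cr + (1 + δ) * (β ^ 2 * (2 * Cr + 2 * C₆))) * G := by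
    have := mul_le_mul_of_nonneg_left h2 (show 0 ≤ 2 / δ by positivity)
    rw [← mul_assoc, ← mul_assoc, show 2 / δ * (δ / 2) = 1 by field_simp, one_mul] at this
    exact this
  rw [add_mul]
  exact add_le_add h1 h3

end Coercivity

section Shift

variable {d : ℕ} {L : ℝ} [Fact (0 < L)] {J : Space d → ℝ} {β : ℝ} {m : ℝ → ℝ}
  {v w u g : Cylinder d L → ℝ}

theorem deriv_shiftFront (m : ℝ → ℝ) (a x : ℝ) : deriv (shiftFront m a) x = deriv m (x - a) :=
  deriv_comp_sub_const m a x

theorem IsProfile.shift (hp : IsProfile β J m) (a : ℝ) : IsProfile β J (shiftFront m a) := by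
  have hd : deriv (shiftFront m a) = fun x => deriv m (x + -a) := by
    ext x
    rw [deriv_shiftFront, sub_eq_add_neg]
  refine ⟨?_, ?_, fun x => ?_, fun x => ?_, ?_, ?_⟩
  · exact hp.contDiff.comp (contDiff_id.sub contDiff_const)
  · obtain ⟨ρ, hρ, hb⟩ := hp.exists_bound
    exact ⟨ρ, hρ, fun x => hb _⟩
  · rw [hd]
    exact hp.deriv_pos _
  · rw [hd, avg_comp_add, shiftFront, ← sub_eq_add_neg]
    exact hp.deriv_eq _
  · obtain ⟨M, γ, hM, hγ, h⟩ := hp.deriv_decay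
    refine ⟨M * Real.exp (γ * |a|), γ, by positivity, hγ, fun x => ?_⟩
    rw [deriv_shiftFront]
    refine (h _).trans ?_
    rw [mul_assoc, ← Real.exp_add]
    refine mul_le_mul_of_nonneg_left (Real.exp_le_exp.2 ?_) hM.le
    have h1 := abs_sub_abs_le_abs_sub x a
    have h2 := mul_le_mul_of_nonneg_left h1 hγ.le
    linarith
  · obtain ⟨X, δ, hX, hδ, h⟩ := hp.far
    refine ⟨X + |a|, δ, by positivity, hδ, fun x hx => h _ ?_⟩
    have h1 := abs_sub_abs_le_abs_sub x a
    linarith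

theorem fst_add_toCylinder_single (p : Cylinder d L) (a : ℝ) :
    (p + toCylinder d L (EuclideanSpace.single 0 a)).1 = p.1 + a := by
  simp [toCylinder]

/-- The coercivity estimate, uniformly over the translates of a profile. -/
theorem IsProfile.exists_coercive_shift (hp : IsProfile β J m) (hβ : 0 < β) (hJ : IsKernel J) :
    ∃ C : ℝ, 0 ≤ C ∧ ∀ (a : ℝ) (v w : Cylinder d L → ℝ) (h : Fin (d + 1) → Cylinder d L → ℝ),
      MemLp v 2 volume → MemLp w 2 volume → HasWeakDeriv (Pi.single 0 1) v w →
      (∀ i, MemLp (h i) 2 volume) →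
      (∀ i, HasWeakDeriv (Pi.single i 1) (opB β J (shiftFront m a) v) (h i)) →
      ∫ p, v p * deriv (shiftFront m a) p.1 = 0 →
        (∫ p, (deriv (shiftFront m a) p.1 * v p) ^ 2) + ∫ p, w p ^ 2 ≤
          C * ∑ i, ∫ p, h i p ^ 2 := by
  obtain ⟨C, hC, hco⟩ := hp.exists_coercive (L := L) hβ hJ
  refine ⟨C, hC, fun a v w h hv hw hvw hh hwh hv0 => ?_⟩
  set t := toCylinder d L (EuclideanSpace.single 0 a) with ht
  have hfst : ∀ p : Cylinder d L, (p + t).1 - a = p.1 := fun p => by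
    rw [ht, fst_add_toCylinder_single, add_sub_cancel_right]
  have hB : opB β J m (fun p => v (p + t)) = fun p => opB β J (shiftFront m a) v (p + t) := by
    ext p
    rw [opB, opB, shiftFront, hfst, cylConv_comp_add]
  have hψ : ∀ p : Cylinder d L, deriv (shiftFront m a) (p + t).1 = deriv m p.1 := fun p => by
    rw [deriv_shiftFront, hfst]
  have key := hco (fun p => v (p + t)) (fun p => w (p + t)) (fun i p => h i (p + t))
    (memLp_comp_add hv t) (memLp_comp_add hw t) (hvw.comp_add t)
    (fun i => memLp_comp_add (hh i) t) (fun i => by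
      rw [hB]
      exact (hwh i).comp_add t) (by
      rw [← hv0, ← integral_comp_add (fun p => v p * deriv (shiftFront m a) p.1) t]
      simp only [hψ])
  rw [← integral_comp_add (fun p => (deriv (shiftFront m a) p.1 * v p) ^ 2) t,
    ← integral_comp_add (fun p => w p ^ 2) t]
  simp only [hψ]
  refine key.trans (le_of_eq ?_)
  congr 1
  exact Finset.sum_congr rfl fun i _ => integral_comp_add (fun p => h i p ^ 2) t

end Shift

section Sobolev

variable {d : ℕ} {L : ℝ} [Fact (0 < L)] {J : Space d → ℝ} {β : ℝ} {m : ℝ → ℝ}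
  {v g : Cylinder d L → ℝ}

theorem eq_zero_or_eq_single {α : Fin (d + 1) → ℕ} (h : ∑ i, α i ≤ 1) :
    α = 0 ∨ ∃ i, α = Pi.single i 1 := by
  by_cases h0 : α = 0
  · exact Or.inl h0
  · right
    obtain ⟨i, hi⟩ := Function.ne_iff.1 h0
    refine ⟨i, ?_⟩
    have h1 : α i + ∑ j ∈ Finset.univ.erase i, α j = ∑ j, α j :=
      Finset.add_sum_erase _ _ (Finset.mem_univ i)
    have hi' : α i ≠ 0 := hi
    have h2 : ∑ j ∈ Finset.univ.erase i, α j = 0 := by omega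
    ext j
    by_cases hj : j = i
    · subst hj
      rw [Pi.single_eq_same]
      omega
    · rw [Pi.single_eq_of_ne hj]
      exact (Finset.sum_eq_zero_iff.1 h2) j (Finset.mem_erase.2 ⟨hj, Finset.mem_univ j⟩)

theorem MemSobolev.exists_single {k n : ℕ} (hv : MemSobolev k v) (hn : n ≤ k) (i : Fin (d + 1)) :
    ∃ g, MemLp g 2 volume ∧ HasWeakDeriv (Pi.single i n) v g :=
  hv.2 _ (by simpa using hn)

theorem IsProfile.memSobolev_opB (hp : IsProfile β J m) (hβ : 0 < β) (hJ : IsKernel J) {k : ℕ}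
    (hk : 1 ≤ k) (hv : MemSobolev k v) : MemSobolev 1 (opB β J m v) := by
  have hB := hp.memLp_opB hβ hJ hv.1
  refine ⟨hB, fun α hα => ?_⟩
  rcases eq_zero_or_eq_single hα with rfl | ⟨i, rfl⟩
  · exact ⟨_, hB, hasWeakDeriv_zero _⟩
  · obtain ⟨g, hg, hvg⟩ := hv.exists_single hk i
    exact ⟨_, hp.hasWeakDeriv_opB hβ hJ hv.1 hg hvg⟩

theorem norm_add_sum_le_sobolevNorm {k : ℕ} (hk : k ≠ 0) (hv : MemLp v 2 volume) :
    (eLpNorm v 2 volume).toReal +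
      ∑ j, (eLpNorm (weakDeriv (Pi.single j k) v) 2 volume).toReal ≤ sobolevNorm k v := by
  set f : (Fin (d + 1) → ℕ) → ℝ := fun α => (eLpNorm (weakDeriv α v) 2 volume).toReal with hf
  have hf0 : ∀ α, 0 ≤ f α := fun α => ENNReal.toReal_nonneg
  have e0 : (eLpNorm v 2 volume).toReal = f 0 := by
    simp only [hf]
    rw [eLpNorm_congr_ae ((hasWeakDeriv_zero v).weakDeriv_ae_eq hv)]
  set F : ℕ → ℝ := fun n => ∑ α ∈ Finset.piAntidiag (Finset.univ : Finset (Fin (d + 1))) n, f α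
    with hF
  have hF0 : ∀ n, 0 ≤ F n := fun n => Finset.sum_nonneg fun α _ => hf0 α
  have h0 : f 0 ≤ F 0 := Finset.single_le_sum (fun α _ => hf0 α) (by simp)
  have hinj : Function.Injective fun j : Fin (d + 1) => (Pi.single j k : Fin (d + 1) → ℕ) := by
    intro i j hij
    by_contra hne
    have := congrFun hij i
    simp only [Pi.single_eq_same, Pi.single_eq_of_ne hne] at this
    exact hk this
  have hk1 : ∑ j, f (Pi.single j k) ≤ F k := by
    rw [← Finset.sum_image (f := f) (s := Finset.univ)
      (g := fun j : Fin (d + 1) => (Pi.single j k : Fin (d + 1) → ℕ)) (hinj.injOn)]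
    refine Finset.sum_le_sum_of_subset_of_nonneg (fun α hα => ?_) fun α _ _ => hf0 α
    obtain ⟨j, -, rfl⟩ := Finset.mem_image.1 hα
    simp [Finset.mem_piAntidiag]
  have hsum : F 0 + F k ≤ ∑ n ∈ Finset.range (k + 1), F n := by
    rw [← Finset.sum_pair (f := F) (Ne.symm hk)]
    refine Finset.sum_le_sum_of_subset_of_nonneg (fun n hn => ?_) fun n _ _ => hF0 n
    simp only [Finset.mem_insert, Finset.mem_singleton] at hn
    rw [Finset.mem_range]
    omega
  rw [e0]
  exact (add_le_add h0 hk1).trans hsum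

/-- The Sobolev embedding `W^{k,2} ⊆ L^∞`. -/
theorem exists_sup_bound {k : ℕ} (hk : d + 3 ≤ 2 * k) :
    ∃ C : ℝ, 0 ≤ C ∧ ∀ v : Cylinder d L → ℝ, MemSobolev k v →
      ∀ᵐ p, |v p| ≤ C * sobolevNorm k v := by
  obtain ⟨C, hC, h⟩ := exists_sobolev_bound (d := d) (L := L) hk
  refine ⟨C, hC, fun v hv => ?_⟩
  have hs := fun j => weakDeriv_spec (hv.exists_single le_rfl j)
  filter_upwards [h v _ hv.1 (fun j => (hs j).1) (fun j => (hs j).2)] with p hp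
  exact hp.trans (mul_le_mul_of_nonneg_left (norm_add_sum_le_sobolevNorm (by omega) hv.1) hC)

end Sobolev

section Nonlinear

/-- A pointwise bound for the nonlinear term. -/
theorem exists_nonlinear_bound {β ρ : ℝ} (hβ : 0 < β) (hρ0 : 0 ≤ ρ) (hρ : ρ < 1) :
    ∃ K : ℝ, 0 ≤ K ∧ ∀ a v g ψ : ℝ, |a| ≤ ρ → |v| ≤ (1 - ρ) / 2 →
      |(1 / β) * (2 * a / (1 - a ^ 2) ^ 2) * v * g +
        (1 / β) * ((1 + 3 * a ^ 2 + 2 * a * v) / ((1 - a ^ 2) ^ 2 * (1 - (a + v) ^ 2))) * v ^ 2 *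
          (g + ψ)| ≤ K * |v| * (|g| + |ψ * v|) := by
  set κ := 1 - ρ ^ 2 with hκ
  set κ' := 1 - ((1 + ρ) / 2) ^ 2 with hκ'
  have hκ0 : 0 < κ := by nlinarith
  have hκ'0 : 0 < κ' := by nlinarith
  refine ⟨(1 / β) * (2 / κ ^ 2) + (1 / β) * (6 / (κ ^ 2 * κ')), by positivity,
    fun a v g ψ ha hv => ?_⟩
  have h1 := (one_sub_sq_pos_of_bound hρ ha).1
  have hav : |a + v| ≤ (1 + ρ) / 2 := (abs_add_le _ _).trans (by linarith)
  have h2 := (one_sub_sq_pos_of_bound (by linarith : (1 + ρ) / 2 < 1) hav).1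
  have h3 : 0 < 1 - a ^ 2 := hκ0.trans_le h1
  have h4 : 0 < 1 - (a + v) ^ 2 := hκ'0.trans_le h2
  have ha1 : |a| ≤ 1 := by linarith
  have hv1 : |v| ≤ 1 := by linarith
  have b1 : |(1 / β) * (2 * a / (1 - a ^ 2) ^ 2)| ≤ (1 / β) * (2 / κ ^ 2) := by
    rw [abs_mul, abs_of_pos (by positivity : 0 < 1 / β), abs_div, abs_of_pos (by positivity :
      0 < (1 - a ^ 2) ^ 2), abs_mul, abs_two]
    gcongr
    linarith
  have b2 : |(1 / β) * ((1 + 3 * a ^ 2 + 2 * a * v) / ((1 - a ^ 2) ^ 2 * (1 - (a + v) ^ 2)))| ≤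
      (1 / β) * (6 / (κ ^ 2 * κ')) := by
    have hn : |1 + 3 * a ^ 2 + 2 * a * v| ≤ 6 := by
      have c1 := abs_le.1 ha1
      have c2 : a ^ 2 ≤ 1 := (sq_le_one_iff_abs_le_one a).2 ha1
      have c3 : |a * v| ≤ 1 := by
        rw [abs_mul]
        exact mul_le_one₀ ha1 (abs_nonneg _) hv1
      have c4 := abs_le.1 c3
      rw [abs_le]
      constructor <;> nlinarith [sq_nonneg a]
    rw [abs_mul, abs_of_pos (by positivity : 0 < 1 / β), abs_div, abs_of_pos (by positivity :
      0 < (1 - a ^ 2) ^ 2 * (1 - (a + v) ^ 2))]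
    gcongr
  set A := (1 / β) * (2 * a / (1 - a ^ 2) ^ 2)
  set B := (1 / β) * ((1 + 3 * a ^ 2 + 2 * a * v) / ((1 - a ^ 2) ^ 2 * (1 - (a + v) ^ 2)))
  have t1 : |A * v * g| ≤ (1 / β) * (2 / κ ^ 2) * (|v| * (|g| + |ψ * v|)) := by
    rw [mul_assoc, abs_mul, abs_mul v]
    refine mul_le_mul b1 (mul_le_mul_of_nonneg_left ?_ (abs_nonneg _)) (by positivity)
      (by positivity)
    linarith [abs_nonneg (ψ * v)]
  have t2 : |B * v ^ 2 * (g + ψ)| ≤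
      (1 / β) * (6 / (κ ^ 2 * κ')) * (|v| * (|g| + |ψ * v|)) := by
    have e : B * v ^ 2 * (g + ψ) = B * (v * (g * v + ψ * v)) := by ring
    rw [e, abs_mul, abs_mul v]
    refine mul_le_mul b2 (mul_le_mul_of_nonneg_left ?_ (abs_nonneg _)) (by positivity)
      (by positivity)
    refine (abs_add_le _ _).trans (add_le_add ?_ le_rfl)
    rw [abs_mul]
    exact mul_le_of_le_one_right (abs_nonneg _) hv1
  refine (abs_add_le _ _).trans ((add_le_add t1 t2).trans (le_of_eq ?_))
  ring

variable {d : ℕ} {L : ℝ} [Fact (0 < L)] {J : Space d → ℝ} {β : ℝ} {m : ℝ → ℝ}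
  {v : Cylinder d L → ℝ}

theorem IsProfile.aestronglyMeasurable_opU (hp : IsProfile β J m)
    (hv : MemLp v 2 volume) (hg : MemLp (weakPartial 0 v) 2 volume) :
    AEStronglyMeasurable (opU β m v) volume := by
  have h1 : AEMeasurable (fun p : Cylinder d L => m p.1) volume :=
    (hp.continuous.measurable.comp measurable_fst).aemeasurable
  have h2 : AEMeasurable (fun p : Cylinder d L => deriv m p.1) volume :=
    (hp.continuous_deriv.measurable.comp measurable_fst).aemeasurable
  have h3 := hv.1.aemeasurable
  have h4 := hg.1.aemeasurable
  refine AEMeasurable.aestronglyMeasurable ?_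
  unfold opU
  exact (((aemeasurable_const.mul ((h1.const_mul 2).div
    ((aemeasurable_const.sub (h1.pow_const 2)).pow_const 2))).mul h3).mul h4).add
    (((aemeasurable_const.mul
      (((aemeasurable_const.add ((h1.pow_const 2).const_mul 3)).add ((h1.const_mul 2).mul h3)).div
        (((aemeasurable_const.sub (h1.pow_const 2)).pow_const 2).mul
          (aemeasurable_const.sub ((h1.add h3).pow_const 2))))).mul (h3.pow_const 2)).mul
      (h4.add h2))

/-- The nonlinear term is small compared with the coercive quantities. -/
theorem IsProfile.integral_opU_sq_le (hp : IsProfile β J m) (hβ : 0 < β) {ρ K N : ℝ}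
    (hm : ∀ x, |m x| ≤ ρ) (hK : 0 ≤ K)
    (hKb : ∀ a v g ψ : ℝ, |a| ≤ ρ → |v| ≤ (1 - ρ) / 2 →
      |(1 / β) * (2 * a / (1 - a ^ 2) ^ 2) * v * g +
        (1 / β) * ((1 + 3 * a ^ 2 + 2 * a * v) / ((1 - a ^ 2) ^ 2 * (1 - (a + v) ^ 2))) * v ^ 2 *
          (g + ψ)| ≤ K * |v| * (|g| + |ψ * v|))
    (hv : MemLp v 2 volume) (hg : MemLp (weakPartial 0 v) 2 volume)
    (hN : ∀ᵐ p, |v p| ≤ N) (hNρ : N ≤ (1 - ρ) / 2) :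
    Integrable (fun p : Cylinder d L => mobility β (m p.1) * opU β m v p ^ 2) ∧
      ∫ p : Cylinder d L, mobility β (m p.1) * opU β m v p ^ 2 ≤
        2 * β * K ^ 2 * N ^ 2 *
          ((∫ p, (deriv m p.1 * v p) ^ 2) + ∫ p, weakPartial 0 v p ^ 2) := by
  obtain ⟨M, hM, hψM⟩ := hp.exists_deriv_bound
  have hψv : MemLp (fun p => deriv m p.1 * v p) 2 volume :=
    memLp_bdd_mul hp.continuous_deriv (fun x => by
      rw [abs_of_pos (hp.deriv_pos x)]
      exact hψM x) hv
  have hσ : ∀ x, 0 ≤ mobility β (m x) := fun x => (mul_pos hβ (hp.one_sub_sq_pos x)).le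
  have hσ' : ∀ x, mobility β (m x) ≤ β := fun x =>
    mul_le_of_le_one_right hβ.le (by linarith [sq_nonneg (m x)])
  have hbd : ∀ᵐ p : Cylinder d L, mobility β (m p.1) * opU β m v p ^ 2 ≤
      2 * β * K ^ 2 * N ^ 2 * ((deriv m p.1 * v p) ^ 2 + weakPartial 0 v p ^ 2) := by
    filter_upwards [hN] with p hp'
    have h1 : |opU β m v p| ≤ K * N * (|weakPartial 0 v p| + |deriv m p.1 * v p|) := by
      refine (hKb (m p.1) (v p) (weakPartial 0 v p) (deriv m p.1) (hm _)
        (hp'.trans hNρ)).trans ?_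
      gcongr
    have h2 : opU β m v p ^ 2 ≤
        (K * N) ^ 2 * (2 * (weakPartial 0 v p) ^ 2 + 2 * (deriv m p.1 * v p) ^ 2) := by
      rw [← sq_abs]
      refine (pow_le_pow_left₀ (abs_nonneg _) h1 2).trans ?_
      rw [mul_pow]
      refine mul_le_mul_of_nonneg_left ((sq_add_le _ _).trans (le_of_eq ?_)) (sq_nonneg _)
      rw [sq_abs, sq_abs]
    calc mobility β (m p.1) * opU β m v p ^ 2 ≤ β * ((K * N) ^ 2 *
          (2 * (weakPartial 0 v p) ^ 2 + 2 * (deriv m p.1 * v p) ^ 2)) :=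
          mul_le_mul (hσ' _) h2 (sq_nonneg _) hβ.le
      _ = _ := by ring
  have i1 : Integrable fun p => (deriv m p.1 * v p) ^ 2 + weakPartial 0 v p ^ 2 :=
    hψv.integrable_sq.add hg.integrable_sq
  have hmeas : AEStronglyMeasurable
      (fun p : Cylinder d L => mobility β (m p.1) * opU β m v p ^ 2) volume := by
    have h1 : Continuous fun p : Cylinder d L => mobility β (m p.1) := by
      have := hp.continuous
      unfold mobility
      fun_prop
    exact h1.aestronglyMeasurable.mul ((hp.aestronglyMeasurable_opU hv hg).pow 2)
  have hint : Integrable fun p : Cylinder d L => mobility β (m p.1) * opU β m v p ^ 2 := by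
    refine (i1.const_mul (2 * β * K ^ 2 * N ^ 2)).mono' hmeas ?_
    filter_upwards [hbd] with p hp'
    rwa [Real.norm_of_nonneg (mul_nonneg (hσ _) (sq_nonneg _))]
  refine ⟨hint, ?_⟩
  have i2 : Integrable fun p => (deriv m p.1 * v p) ^ 2 := hψv.integrable_sq
  have i3 : Integrable fun p => weakPartial 0 v p ^ 2 := hg.integrable_sq
  rw [← integral_add i2 i3, ← integral_const_mul]
  exact integral_mono_ae hint (i1.const_mul _) hbd

theorem IsProfile.le_integral_mobility_mul_sq (hp : IsProfile β J m) (hβ : 0 < β) {ρ : ℝ}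
    (hρ : ρ < 1) (hm : ∀ x, |m x| ≤ ρ) {h : Cylinder d L → ℝ} (hh : MemLp h 2 volume) :
    β * (1 - ρ ^ 2) * ∫ p, h p ^ 2 ≤ ∫ p : Cylinder d L, mobility β (m p.1) * h p ^ 2 := by
  have hc : Continuous fun x => mobility β (m x) := by
    have := hp.continuous
    unfold mobility
    fun_prop
  have hσ : ∀ x, |mobility β (m x)| ≤ β := fun x => by
    rw [mobility, abs_of_pos (mul_pos hβ (hp.one_sub_sq_pos x))]
    exact mul_le_of_le_one_right hβ.le (by linarith [sq_nonneg (m x)])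
  have i1 : Integrable fun p : Cylinder d L => mobility β (m p.1) * h p ^ 2 := by
    have := integrable_fun_mul (memLp_bdd_mul hc hσ hh) hh
    refine this.congr (Eventually.of_forall fun p => ?_)
    dsimp only
    ring
  rw [← integral_const_mul]
  refine integral_mono (hh.integrable_sq.const_mul _) i1 fun p => ?_
  exact mul_le_mul_of_nonneg_right
    (mul_le_mul_of_nonneg_left (one_sub_sq_pos_of_bound hρ (hm _)).1 hβ.le) (sq_nonneg _)

end Nonlinear

end

end PlanarFront

theorem proposition3p3 :
    ∃ r : ℝ → ℝ, (∀ L, 0 < L → 0 < r L) ∧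
      ∀ (d s : ℕ) (L β mβ : ℝ) [Fact (0 < L)] (J : Space d → ℝ) (m₀ : ℝ → ℝ),
        ((d : ℝ) + 1) / 2 < (s : ℝ) → 1 < β → IsKernel J → IsPosMinimizer β mβ →
        IsFront β mβ J m₀ →
        ∃ ε₁ : ℝ, 0 < ε₁ ∧
          ∀ ε : ℝ, 0 < ε → ε ≤ ε₁ →
          ∀ (a : ℝ) (v : Cylinder d L → ℝ),
            MemSobolev (s + 1) v →
            ∫ p : Cylinder d L, v p * deriv (shiftFront m₀ a) p.1 = 0 →
            sobolevNorm (s + 1) v ^ 2 ≤ ε ^ (2 + r L) →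
            MemSobolev 1 (opB β J (shiftFront m₀ a) v) ∧
            Integrable (fun p : Cylinder d L =>
              mobility β (shiftFront m₀ a p.1) * opU β (shiftFront m₀ a) v p ^ 2) ∧
            0 ≤ functionalG β J (shiftFront m₀ a) ε v := by
  refine ⟨fun _ => 1, fun _ _ => one_pos, fun d s L β mβ _ J m₀ hs hβ1 hJ hmβ hfront => ?_⟩
  have hβ : 0 < β := one_pos.trans hβ1
  have hp := hfront.isProfile hmβ hJ hβ
  obtain ⟨ρ, hρ, hmρ⟩ := hp.exists_bound
  have hρ0 : 0 ≤ ρ := (abs_nonneg _).trans (hmρ 0)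
  obtain ⟨C, hC, hco⟩ := hp.exists_coercive_shift (L := L) hβ hJ
  obtain ⟨S, hS, hsup⟩ := exists_sup_bound (d := d) (L := L) (k := s + 1) (by
    rw [div_lt_iff₀ two_pos] at hs
    have : d + 1 < s * 2 := by exact_mod_cast hs
    omega)
  obtain ⟨K, hK, hKb⟩ := exists_nonlinear_bound hβ hρ0 hρ
  have hκ : 0 < 1 - ρ ^ 2 := by nlinarith
  set A := 2 * β * K ^ 2 * S ^ 2 * C with hA
  have hA0 : 0 ≤ A := by positivity
  set η := (1 - ρ) / 2 with hη
  have hη0 : 0 < η := by rw [hη]; linarith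
  refine ⟨min 1 (min (η ^ 2 / (S ^ 2 + 1)) (β * (1 - ρ ^ 2) / (A + 1))), by positivity,
    fun ε hε hε1 a v hv hv0 hnorm => ?_⟩
  have k1 : ε ≤ 1 := hε1.trans (min_le_left _ _)
  have k2 : ε * (S ^ 2 + 1) ≤ η ^ 2 := (le_div_iff₀ (by positivity)).1
    ((hε1.trans (min_le_right _ _)).trans (min_le_left _ _))
  have k3 : ε * (A + 1) ≤ β * (1 - ρ ^ 2) := (le_div_iff₀ (by positivity)).1
    ((hε1.trans (min_le_right _ _)).trans (min_le_right _ _))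
  have hnorm' : sobolevNorm (s + 1) v ^ 2 ≤ ε ^ 3 := by
    refine hnorm.trans (le_of_eq ?_)
    rw [show (2 + 1 : ℝ) = ((3 : ℕ) : ℝ) by norm_num, Real.rpow_natCast]
  have hp' := hp.shift a
  have hB := hp'.memSobolev_opB hβ hJ (by omega) hv
  set N := S * sobolevNorm (s + 1) v with hN
  have hN2 : N ^ 2 ≤ S ^ 2 * ε ^ 3 := by
    rw [hN, mul_pow]
    exact mul_le_mul_of_nonneg_left hnorm' (sq_nonneg S)
  have hε3 : ε ^ 3 ≤ ε := by
    calc ε ^ 3 = ε * ε ^ 2 := by ring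
      _ ≤ ε * 1 := mul_le_mul_of_nonneg_left (pow_le_one₀ hε.le k1) hε.le
      _ = ε := mul_one ε
  have hNη : N ≤ η := by
    refine le_of_sq_le_sq ?_ hη0.le
    have := mul_le_mul_of_nonneg_left hε3 (sq_nonneg S)
    linarith
  have hgs := weakDeriv_spec (hv.exists_single (Nat.le_add_left 1 s) 0)
  have hhs := fun i => weakDeriv_spec (hB.exists_single le_rfl i)
  obtain ⟨hint, hU⟩ := hp'.integral_opU_sq_le hβ (fun x => hmρ _) hK hKb hv.1 hgs.1
    (hsup v hv) hNη
  refine ⟨hB, hint, ?_⟩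
  have hcoer := hco a v _ _ hv.1 hgs.1 hgs.2 (fun i => (hhs i).1) (fun i => (hhs i).2) hv0
  set G := ∑ i, ∫ p, weakDeriv (Pi.single i 1) (opB β J (shiftFront m₀ a) v) p ^ 2 with hG
  have hG0 : 0 ≤ G := Finset.sum_nonneg fun i _ => integral_nonneg fun p => sq_nonneg _
  have hlow : β * (1 - ρ ^ 2) * G ≤ ∑ i : Fin (d + 1), ∫ p : Cylinder d L,
      mobility β (shiftFront m₀ a p.1) * weakPartial i (opB β J (shiftFront m₀ a) v) p ^ 2 := by
    rw [hG, Finset.mul_sum]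
    exact Finset.sum_le_sum fun i _ =>
      hp'.le_integral_mobility_mul_sq hβ hρ (fun x => hmρ _) (hhs i).1
  have hup : ∫ p : Cylinder d L, mobility β (shiftFront m₀ a p.1) *
      opU β (shiftFront m₀ a) v p ^ 2 ≤ A * ε ^ 3 * G := by
    refine hU.trans ?_
    calc _ ≤ 2 * β * K ^ 2 * N ^ 2 * (C * G) :=
          mul_le_mul_of_nonneg_left hcoer (by positivity)
      _ ≤ 2 * β * K ^ 2 * (S ^ 2 * ε ^ 3) * (C * G) := by gcongr
      _ = _ := by rw [hA]; ring
  rw [functionalG, sub_nonneg]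
  calc 1 / ε * ∫ p : Cylinder d L, mobility β (shiftFront m₀ a p.1) *
        opU β (shiftFront m₀ a) v p ^ 2 ≤ 1 / ε * (A * ε ^ 3 * G) :=
        mul_le_mul_of_nonneg_left hup (by positivity)
    _ = ε * (ε * A * G) := by field_simp
    _ ≤ ε * (β * (1 - ρ ^ 2) * G) := by
        refine mul_le_mul_of_nonneg_left (mul_le_mul_of_nonneg_right ?_ hG0) hε.le
        linarith
    _ ≤ _ := mul_le_mul_of_nonneg_left hlow hε.le
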